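/- **Setting.** A game consists of a finite directed graph $(V,E)$; a finite non-empty set $\Pi$ of players; a partition of $V$ into sets $V_i$ ($i\in\Pi$), the vertices controlled by player $i$, and $V_?$, the stochastic vertices; for every stochastic vertex $u$ that has outgoing edges, a probability distribution $\mathsf p(u)$ over these edges; and, for every terminal vertex $t$ (a vertex without outgoing edges), a payoff vector $\mu(t)\in\mathbb R^\Pi$. An initial vertex $v_0\in V$ is fixed. A play is a path from $v_0$ that is infinite or ends in a terminal vertex; player $i$ receives $\mu_i(t)$ if the play ends in the terminal vertex $t$, and $0$ if the play is infinite. A strategy of player $i$ maps every finite path $hu$ from $v_0$ whose last vertex $u\in V_i$ is not terminal to a probability distribution over the edges from $u$; it is pure if all these distributions are Dirac. A strategy profile $\bar\sigma=(\sigma_i)_{i\in\Pi}$ induces a probability measure $\mathbb P_{\bar\sigma}$ over plays; $\bar\sigma$ is pure if every $\sigma_i$ is. Let $(P,O)$ be a partition of $\Pi$ into pessimists and optimists. The extreme risk measure $\mathbb X_i(\bar\sigma)$ is the essential infimum of player $i$'s payoff under $\mathbb P_{\bar\sigma}$ if $i\in P$, and its essential supremum if $i\in O$. The profile $\bar\sigma$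 is an extreme risk-sensitive equilibrium (XRSE) if for every player $i$ and every strategy $\sigma_i'$ of player $i$ we have $\mathbb X_i(\bar\sigma_{-i},\sigma_i')\le\mathbb X_i(\bar\sigma)$. A (collective) memory structure is a tuple $(S,s_0,\delta,\nu)$ with a finite set $S$ of memory states, an initial state $s_0\in S$, an update map $\delta:S\times V\to S$, and an output map $\nu$ that maps every state $s\in S$ and every non-terminal vertex $u\in V\setminus V_?$ to a probability distribution over the edges from $u$. It induces the strategy profile $\sigma_i(hu)=\nu(\delta^*(h),u)$, where $\delta^*(\varepsilon)=s_0$ and $\delta^*(hv)=\delta(\delta^*(h),v)$. A profile induced in this way is called a finite-memory profile with $|S|$ memory states. **Theorem.** Let $\bar\sigma$ be an XRSE in a game with $n=|V|$ vertices, $p=|\Pi|\ge 1$ players, initial vertex $v_0$ and partition $(P,O)$ of the players. Then there exists a finite-memory XRSE $\bar\sigma^\star$ with at most $3np-2n+p+1$ memory states such that $\mathbb X_i(\bar\sigma^\star)=\mathbb X_i(\bar\sigma)$ for every player $i$. Furthermore, if $\bar\sigma$ is pure, then there is such a profile $\bar\sigma^\star$ that is pure. -/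

import Mathlib

/-- A (simple quantitative stochastic) game on the directed graph `Adj` with vertex set `V` and set
of players `I`.  `owner u = some i` says that player `i` controls `u`, and `owner u = none` says
that `u` is stochastic.  `prob` gives a probability distribution over the outgoing edges of each
stochastic vertex that has any, and `payoff` is defined on the terminal vertices, i.e. on those
without outgoing edges.  The edges from `u` are identified with the successors of `u`. -/
structure Game (V I : Type*) where
  Adj : V → V → Prop
  owner : V → Option I
  prob : (u : {u : V // owner u = none ∧ ∃ v, Adj u v}) → PMF {v : V // Adj u v}
  payoff : {t : V // ∀ v, ¬ Adj t v} → I → ℝ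

namespace Game

variable {V I : Type*} (G : Game V I)

/-- The vertices at which player `i` has to choose: controlled by `i` and not terminal. -/
abbrev DecisionVertex (i : I) : Type _ := {u : V // G.owner u = some i ∧ ∃ v, G.Adj u v}

/-- The word `w` is a finite path of the graph that starts in `v₀`. -/
def IsPathFrom (v₀ : V) (w : List V) : Prop := w.head? = some v₀ ∧ w.IsChain G.Adj

/-- A strategy of player `i`: `σ h u` is the distribution over the edges from `u` that is used after
the history `hu`.  It is a total function of the word `h`; its values at words `hu` that are not
paths from the initial vertex play no role. -/
abbrev Strategy (i : I) : Type _ :=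
  List V → (u : G.DecisionVertex i) → PMF {v : V // G.Adj u v}

/-- A strategy profile for all players. -/
abbrev Profile : Type _ := (i : I) → G.Strategy i

/-- In the game started in `v₀`, every player plays some edge with probability one after every
history. -/
def IsPure (v₀ : V) (σ : G.Profile) : Prop :=
  ∀ (i : I) (h : List V) (u : G.DecisionVertex i), G.IsPathFrom v₀ (h ++ [u.1]) →
    ∃ v, σ i h u v = 1

open Classical in
/-- The profile `(σ_{-i}, τ)`. -/
noncomputable def deviate (σ : G.Profile) (i : I) (τ : G.Strategy i) : G.Profile :=
  Function.update σ i τ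

open Classical in
/-- The distribution of the next vertex after the history `hu`.  A play that ends in a terminal
vertex is encoded by the infinite sequence that repeats this vertex forever. -/
noncomputable def step (σ : G.Profile) (h : List V) (u : V) : PMF V :=
  if hu : ∃ v, G.Adj u v then
    match ho : G.owner u with
    | none => (G.prob ⟨u, ho, hu⟩).map Subtype.val
    | some i => (σ i h ⟨u, ho, hu⟩).map Subtype.val
  else PMF.pure u

open Classical in
/-- The payoff of player `i` in a play: the payoff of the terminal vertex that is reached, and `0`
if none is reached. -/
noncomputable def playPayoff (i : I) (π : ℕ → V) : ℝ :=
  if h : ∃ n, ∀ v, ¬ G.Adj (π n) v then G.payoff ⟨π (Nat.find h), Nat.find_spec h⟩ i else 0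

section Measure

variable [Fintype V] [MeasurableSpace V] [DiscreteMeasurableSpace V]

/-- The transition kernels of the Markov chain on histories that is induced by `σ`. -/
noncomputable def stepKernel (σ : G.Profile) (n : ℕ) :
    ProbabilityTheory.Kernel ((_ : Finset.Iic n) → V) V :=
  ProbabilityTheory.Kernel.ofFunOfCountable fun x =>
    (G.step σ (List.ofFn fun k : Fin n => x ⟨k, Finset.mem_Iic.2 k.2.le⟩)
      (x ⟨n, Finset.mem_Iic.2 le_rfl⟩)).toMeasure

instance (σ : G.Profile) (n : ℕ) : ProbabilityTheory.IsMarkovKernel (G.stepKernel σ n) :=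
  ⟨fun _ => PMF.toMeasure.isProbabilityMeasure _⟩

/-- The probability measure over plays from `v₀` that is induced by the profile `σ`. -/
noncomputable def playMeasure (v₀ : V) (σ : G.Profile) : MeasureTheory.Measure (ℕ → V) :=
  ProbabilityTheory.Kernel.traj (X := fun _ => V) (G.stepKernel σ) 0 (fun _ => v₀)

open Classical in
/-- The extreme risk measure of player `i`'s payoff under the profile `σ`: the essential infimum of
the payoff if `i` belongs to the set `P` of pessimists, and the essential supremum otherwise, i.e.
if `i` is an optimist. -/
noncomputable def extremeRisk (P : Set I) (v₀ : V) (σ : G.Profile) (i : I) : ℝ :=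
  if i ∈ P then essInf (G.playPayoff i) (G.playMeasure v₀ σ)
  else essSup (G.playPayoff i) (G.playMeasure v₀ σ)

/-- `σ` is an extreme risk-sensitive equilibrium in the game started in `v₀`: no player has a
profitable deviation with regard to the extreme risk measure. -/
def IsXRSE (P : Set I) (v₀ : V) (σ : G.Profile) : Prop :=
  ∀ (i : I) (τ : G.Strategy i),
    ¬ G.extremeRisk P v₀ σ i < G.extremeRisk P v₀ (G.deviate σ i τ) i

end Measure

/-- A collective memory structure with set of memory states `S`. -/
structure MemoryStructure (S : Type*) where
  initial : S
  update : S → V → S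
  output : S → (i : I) → (u : G.DecisionVertex i) → PMF {v : V // G.Adj u v}

variable {G} in
/-- The profile induced by a memory structure: after the history `hu`, the output is taken at `u`
in the memory state that has been reached by reading `h`. -/
def MemoryStructure.profile {S : Type*} (M : G.MemoryStructure S) : G.Profile :=
  fun i h u => M.output (h.foldl M.update M.initial) i u

end Game

/-!
The extreme risks of a profile depend only on which terminal payoffs, and whether infinite plays,
have positive probability. After a change of sign for the optimists, a profile is an equilibrium
with values `z` if every player `i` receives at most `z i` with positive probability, also when she
deviates as a pessimist, and at least `z i` almost surely, also when she deviates as an optimist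
(`Game.isStable_iff`). The first property asks for one outcome per player; the second one has to
hold everywhere.

Given an equilibrium `σ`, a player is called alive, or bounded, at a history if the first property
still holds after it. The second property is inherited by all histories in the support of `σ`, so it
is enough to construct, inside this support, a finite plan that keeps for every player some path to
an outcome with payoff at most `z i`. The nodes of the plan are pairs `(J, u)` of a vertex `u` and a
label `J`, the set of players who share the path. One starts with all players in `v₀` and follows a
history at which all players in `J` are alive. The main point is `Game.JointlyAlive.reaches`: from
such a history one reaches, while all players in `J` stay alive, a vertex that is safe for all of
them, or a history at which they can be distributed to different successors. If this fails, then
there is a trap, a set of histories in which the players in `J` can only stay alive together, and at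
whose vertices play can neither end nor safely go on forever. A player who leaves a trap is no
longer bounded, so a trap is impossible (`Game.IsTrap.not_mem`) since some player in `J` could
exceed her bound: by staying in the trap if `z j < 0`; by leaving it, as it contains no safe vertex,
if no value is positive. Otherwise play ends almost surely under `σ`, and so leaves the trap; then
an optimist or a single player in `J` can just follow `σ`. If `J` contains two pessimists `j` and
`k`, then `j` can leave the trap almost surely, for else `k` would exceed her bound by following `σ`
conditioned to stay in the trap (`Game.IsTrap.stayForever_eq_zero`, `Game.IsTrap.false_of_stay`).

Since a label is passed on to a single successor until it is distributed, at most `2 * |J| - 3`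
labels with at least two players occur below a label `J` with at least two players
(`Game.IsExpansionMap.exists_labels`). At the other successors nothing has to be satisfied except
that play ends if it has to, for which one default label per vertex suffices. Together with one
state per player for punishing the first player who leaves the plan, and an initial state, this
gives the bound. Punishing is possible with positional strategies by the qualitative determinacy of
two-player games (`Game.exists_region`). That the resulting profile is stable is shown by ranking
arguments (`HistoryChain.win_pos_of_rank`, `HistoryChain.win_zero_of_rank`). If `σ` is pure, then
the players cannot be distributed to different successors at a vertex of a player, so the plan has a
single successor there.
-/

/-! ### Averages under a distribution on a finite type -/

/-- The expectation of `f` under a distribution on a finite type. -/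
noncomputable def PMF.avg {V : Type*} [Fintype V] (μ : PMF V) (f : V → ℝ) : ℝ :=
  ∑ v, (μ v).toReal * f v

namespace PMF

variable {V : Type*} (μ : PMF V)

lemma toReal_pos {μ : PMF V} {v : V} (h : μ v ≠ 0) : 0 < (μ v).toReal :=
  ENNReal.toReal_pos h (μ.apply_ne_top v)

lemma ne_zero_of_le {μ : PMF V} {v : V} {δ : ℝ} (hδ : 0 < δ) (h : δ ≤ (μ v).toReal) :
    μ v ≠ 0 := fun h0 => by simp [h0] at h; linarith

/-- A distribution that is carried by a single point is a Dirac distribution. -/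
lemma eq_pure_of_forall {μ : PMF V} {a : V} (h : ∀ v, μ v ≠ 0 → v = a) : μ = PMF.pure a := by
  classical
  have h1 : ∀ v, v ≠ a → μ v = 0 := fun v hv => by_contra fun h0 => hv (h v h0)
  ext v
  rw [PMF.pure_apply]
  split_ifs with hv
  · rw [hv, ← μ.tsum_coe, tsum_eq_single a h1]
  · exact h1 v hv

/-- A distribution that is carried by a subtype is the image of a distribution on the subtype. -/
lemma exists_map_val {p : V → Prop} (μ : PMF V) (h : ∀ v, μ v ≠ 0 → p v) :
    ∃ μ' : PMF {v // p v}, μ'.map Subtype.val = μ := by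
  refine ⟨μ.bindOnSupport fun v hv => PMF.pure ⟨v, h v hv⟩, ?_⟩
  rw [PMF.map, ← PMF.bindOnSupport_eq_bind, PMF.bindOnSupport_bindOnSupport]
  simp only [Function.comp_apply, PMF.pure_bindOnSupport, PMF.bindOnSupport_pure]

variable [Fintype V]

lemma sum_toReal : ∑ v, (μ v).toReal = 1 := by
  rw [← ENNReal.toReal_sum fun v _ => μ.apply_ne_top v, ← tsum_fintype (L := .unconditional _),
    μ.tsum_coe, ENNReal.toReal_one]

lemma avg_const (c : ℝ) : μ.avg (fun _ => c) = c := by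
  rw [avg, ← Finset.sum_mul, sum_toReal, one_mul]

lemma avg_mono {f g : V → ℝ} (h : ∀ v, μ v ≠ 0 → f v ≤ g v) : μ.avg f ≤ μ.avg g := by
  refine Finset.sum_le_sum fun v _ => ?_
  by_cases hv : μ v = 0
  · simp [hv]
  · exact mul_le_mul_of_nonneg_left (h v hv) ENNReal.toReal_nonneg

lemma avg_congr {f g : V → ℝ} (h : ∀ v, μ v ≠ 0 → f v = g v) : μ.avg f = μ.avg g :=
  le_antisymm (μ.avg_mono fun v hv => (h v hv).le) (μ.avg_mono fun v hv => (h v hv).ge)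

lemma avg_le {f : V → ℝ} {c : ℝ} (h : ∀ v, μ v ≠ 0 → f v ≤ c) : μ.avg f ≤ c :=
  (μ.avg_mono h).trans_eq (μ.avg_const c)

lemma le_avg {f : V → ℝ} {c : ℝ} (h : ∀ v, μ v ≠ 0 → c ≤ f v) : c ≤ μ.avg f :=
  (μ.avg_const c).symm.trans_le (μ.avg_mono h)

lemma avg_sub (f g : V → ℝ) : μ.avg (fun v => f v - g v) = μ.avg f - μ.avg g := by
  simp only [avg, mul_sub, Finset.sum_sub_distrib]

lemma avg_one_sub (f : V → ℝ) : μ.avg (fun v => 1 - f v) = 1 - μ.avg f := by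
  rw [avg_sub, avg_const]

lemma avg_mul_left (c : ℝ) (f : V → ℝ) : μ.avg (fun v => c * f v) = c * μ.avg f := by
  simp only [avg, Finset.mul_sum]
  exact Finset.sum_congr rfl fun v _ => by ring

lemma mul_le_avg {f : V → ℝ} (h : ∀ v, 0 ≤ f v) (v : V) : (μ v).toReal * f v ≤ μ.avg f :=
  Finset.single_le_sum (f := fun v => (μ v).toReal * f v)
    (fun w _ => mul_nonneg ENNReal.toReal_nonneg (h w)) (Finset.mem_univ v)

/-- If `f ≤ c` everywhere and `f ≤ c - d` at an atom of mass at least `δ`, then the average drops by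
`δ * d`. -/
lemma avg_le_of_atom {f : V → ℝ} {c d δ : ℝ} {v : V} (h : ∀ w, μ w ≠ 0 → f w ≤ c)
    (hδ : δ ≤ (μ v).toReal) (hd : 0 ≤ d) (hv : f v ≤ c - d) : μ.avg f ≤ c - δ * d := by
  classical
  have h1 : μ.avg f ≤ μ.avg fun w => c - if w = v then d else 0 := by
    refine μ.avg_mono fun w hw => ?_
    split_ifs with hwv
    · rwa [hwv]
    · simpa using h w hw
  rw [avg_sub, avg_const] at h1
  have h2 : μ.avg (fun w => if w = v then d else 0) = (μ v).toReal * d := by simp [avg]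
  nlinarith

lemma avg_pure (a : V) (f : V → ℝ) : (PMF.pure a).avg f = f a := by
  classical
  rw [avg, Finset.sum_eq_single a]
  · simp
  · intro b _ hb; simp [PMF.pure_apply, hb]
  · simp

lemma exists_ne_zero : ∃ v, μ v ≠ 0 := by
  by_contra! h
  have := μ.sum_toReal
  simp [h] at this

lemma exists_card_inv_le : ∃ v, (Fintype.card V : ℝ)⁻¹ ≤ (μ v).toReal := by
  by_contra! h
  obtain ⟨v, -⟩ := μ.exists_ne_zero
  have : ∑ v, (μ v).toReal < ∑ _v : V, (Fintype.card V : ℝ)⁻¹ :=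
    Finset.sum_lt_sum_of_nonempty ⟨v, Finset.mem_univ v⟩ fun v _ => h v
  have hc : (0 : ℝ) < Fintype.card V := by exact_mod_cast Fintype.card_pos_iff.2 ⟨v⟩
  rw [μ.sum_toReal] at this
  simp [hc.ne'] at this

lemma avg_nonneg {f : V → ℝ} (h : ∀ v, 0 ≤ f v) : 0 ≤ μ.avg f := μ.le_avg fun v _ => h v

lemma avg_eq_zero_iff {f : V → ℝ} (h : ∀ v, 0 ≤ f v) :
    μ.avg f = 0 ↔ ∀ v, μ v ≠ 0 → f v = 0 := by
  constructor
  · intro h0 v hv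
    have h1 := μ.mul_le_avg h v
    have h2 := toReal_pos hv
    have := h v
    nlinarith
  · intro h0
    rw [μ.avg_congr (g := fun _ => 0) h0, avg_const]

lemma tendsto_avg {f : ℕ → V → ℝ} {g : V → ℝ}
    (h : ∀ v, Filter.Tendsto (fun n => f n v) Filter.atTop (nhds (g v))) :
    Filter.Tendsto (fun n => μ.avg (f n)) Filter.atTop (nhds (μ.avg g)) :=
  tendsto_finsetSum _ fun v _ => (h v).const_mul _

end PMF

/-! ### Stochastic chains and the probability of reaching terminal vertices -/

/-- A stochastic process on `V`: `p h u` is the distribution of the next state after the history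
`hu`. -/
abbrev HistoryChain (V : Type*) : Type _ := List V → V → PMF V

namespace HistoryChain

variable {V : Type*} [Fintype V]

open Classical in
/-- The probability to be in `A` after `n` further steps, when the history is `hu`. -/
noncomputable def hit (p : HistoryChain V) (A : Set V) : ℕ → List V → V → ℝ
  | 0, _, u => if u ∈ A then 1 else 0
  | n + 1, h, u => (p h u).avg fun v => hit p A n (h ++ [u]) v

/-- The supremum of the probabilities `hit p A n`.  For a set `A` of absorbing states, this is the
probability to reach `A`. -/
noncomputable def reach (p : HistoryChain V) (A : Set V) (h : List V) (u : V) : ℝ :=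
  ⨆ n, hit p A n h u

/-- All states in `T` are absorbing. -/
def Absorbs {V : Type*} (p : HistoryChain V) (T : Set V) : Prop := ∀ h u, u ∈ T → p h u = PMF.pure u

lemma Absorbs.mono {V : Type*} {p : HistoryChain V} {A T : Set V} (hp : Absorbs p T) (h : A ⊆ T) :
    Absorbs p A := fun g u hu => hp g u (h hu)

open Classical in
/-- The probability, after the history `hu`, that the process ends in a state of `T ∩ F`, or, if
`inf` holds, that it never enters `T` or ends in `T ∩ F`.  The set `T` is a set of absorbing
states, and `inf` tells whether the infinite plays belong to the event. -/
noncomputable def win (p : HistoryChain V) (T F : Set V) (inf : Prop) (h : List V) (u : V) : ℝ :=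
  if inf then 1 - reach p (T \ F) h u else reach p (T ∩ F) h u

variable {p : HistoryChain V} {T A F : Set V} {inf : Prop}

lemma hit_nonneg (n : ℕ) (h : List V) (u : V) : 0 ≤ hit p A n h u := by
  induction n generalizing h u with
  | zero => simp only [hit]; split_ifs <;> norm_num
  | succ n ih => exact PMF.le_avg _ fun v _ => ih _ v

lemma hit_le_one (n : ℕ) (h : List V) (u : V) : hit p A n h u ≤ 1 := by
  induction n generalizing h u with
  | zero => simp only [hit]; split_ifs <;> norm_num
  | succ n ih => exact PMF.avg_le _ fun v _ => ih _ v

lemma bddAbove_hit (h : List V) (u : V) : BddAbove (Set.range fun n => hit p A n h u) :=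
  ⟨1, by rintro _ ⟨n, rfl⟩; exact hit_le_one n h u⟩

lemma hit_mono {A' : Set V} (hA : A ⊆ A') (n : ℕ) (h : List V) (u : V) :
    hit p A n h u ≤ hit p A' n h u := by
  induction n generalizing h u with
  | zero =>
    simp only [hit]
    split_ifs with h1 h2 h2
    · exact le_rfl
    · exact absurd (hA h1) h2
    · exact zero_le_one
    · exact le_rfl
  | succ n ih => exact PMF.avg_mono _ fun v _ => ih _ v

lemma hit_le_reach (n : ℕ) (h : List V) (u : V) : hit p A n h u ≤ reach p A h u :=
  le_ciSup (bddAbove_hit h u) n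

lemma reach_le {h : List V} {u : V} {c : ℝ} (hc : ∀ n, hit p A n h u ≤ c) : reach p A h u ≤ c :=
  ciSup_le hc

lemma reach_nonneg (h : List V) (u : V) : 0 ≤ reach p A h u :=
  (hit_nonneg 0 h u).trans (hit_le_reach 0 h u)

lemma reach_le_one (h : List V) (u : V) : reach p A h u ≤ 1 := reach_le fun n => hit_le_one n h u

lemma hit_of_mem (hp : Absorbs p A) {u : V} (hu : u ∈ A) (n : ℕ) (h : List V) :
    hit p A n h u = 1 := by
  induction n generalizing h with
  | zero => simp [hit, hu]
  | succ n ih => simp [hit, hp h u hu, PMF.avg_pure, ih]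

lemma hit_le_succ (hp : Absorbs p A) (n : ℕ) (h : List V) (u : V) :
    hit p A n h u ≤ hit p A (n + 1) h u := by
  induction n generalizing h u with
  | zero =>
    by_cases hu : u ∈ A
    · rw [hit_of_mem hp hu, hit_of_mem hp hu]
    · simp only [hit, hu, if_false]
      exact PMF.avg_nonneg _ fun v => hit_nonneg (p := p) (A := A) 0 (h ++ [u]) v
  | succ n ih => exact PMF.avg_mono _ fun v _ => ih _ v

lemma hit_monotone (hp : Absorbs p A) (h : List V) (u : V) : Monotone fun n => hit p A n h u :=
  monotone_nat_of_le_succ fun n => hit_le_succ hp n h u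

lemma tendsto_hit (hp : Absorbs p A) (h : List V) (u : V) :
    Filter.Tendsto (fun n => hit p A n h u) Filter.atTop (nhds (reach p A h u)) :=
  tendsto_atTop_ciSup (hit_monotone hp h u) (bddAbove_hit h u)

lemma reach_eq (hp : Absorbs p A) (h : List V) (u : V) :
    reach p A h u = (p h u).avg fun v => reach p A (h ++ [u]) v :=
  tendsto_nhds_unique ((tendsto_hit hp h u).comp (Filter.tendsto_add_atTop_nat 1))
    (PMF.tendsto_avg _ fun v => tendsto_hit hp (h ++ [u]) v)

lemma reach_of_mem (hp : Absorbs p A) {u : V} (hu : u ∈ A) (h : List V) : reach p A h u = 1 :=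
  le_antisymm (reach_le_one h u) ((hit_of_mem hp hu 0 h).symm.trans_le (hit_le_reach 0 h u))

lemma hit_of_absorbed (hp : Absorbs p T) {u : V} (hu : u ∈ T) (huA : u ∉ A) (n : ℕ) (h : List V) :
    hit p A n h u = 0 := by
  induction n generalizing h with
  | zero => simp [hit, huA]
  | succ n ih => simp [hit, hp h u hu, PMF.avg_pure, ih]

lemma reach_of_absorbed (hp : Absorbs p T) {u : V} (hu : u ∈ T) (huA : u ∉ A) (h : List V) :
    reach p A h u = 0 := by
  simp [reach, hit_of_absorbed hp hu huA]

lemma win_of_inf (hi : inf) (h : List V) (u : V) :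
    win p T F inf h u = 1 - reach p (T \ F) h u := if_pos hi

lemma win_of_not_inf (hi : ¬ inf) (h : List V) (u : V) :
    win p T F inf h u = reach p (T ∩ F) h u := if_neg hi

lemma win_nonneg (h : List V) (u : V) : 0 ≤ win p T F inf h u := by
  unfold win
  split_ifs
  · linarith [reach_le_one (p := p) (A := T \ F) h u]
  · exact reach_nonneg h u

lemma win_le_one (h : List V) (u : V) : win p T F inf h u ≤ 1 := by
  unfold win
  split_ifs
  · linarith [reach_nonneg (p := p) (A := T \ F) h u]
  · exact reach_le_one h u

lemma win_eq (hp : Absorbs p T) (h : List V) (u : V) :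
    win p T F inf h u = (p h u).avg fun v => win p T F inf (h ++ [u]) v := by
  unfold win
  split_ifs
  · rw [PMF.avg_one_sub, reach_eq (hp.mono Set.sdiff_subset)]
  · rw [reach_eq (hp.mono Set.inter_subset_left)]

lemma win_of_mem (hp : Absorbs p T) {u : V} (hu : u ∈ T) (huF : u ∈ F) (h : List V) :
    win p T F inf h u = 1 := by
  unfold win
  split_ifs
  · rw [reach_of_absorbed hp hu (fun h => h.2 huF), sub_zero]
  · exact reach_of_mem (hp.mono Set.inter_subset_left) ⟨hu, huF⟩ h

lemma win_of_not_mem (hp : Absorbs p T) {u : V} (hu : u ∈ T) (huF : u ∉ F) (h : List V) :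
    win p T F inf h u = 0 := by
  unfold win
  split_ifs
  · rw [reach_of_mem (hp.mono Set.sdiff_subset) ⟨hu, huF⟩, sub_self]
  · exact reach_of_absorbed hp hu (fun h => huF h.2) h

lemma win_child_eq_zero (hp : Absorbs p T) {h : List V} {u v : V}
    (h0 : win p T F inf h u = 0) (hv : p h u v ≠ 0) : win p T F inf (h ++ [u]) v = 0 := by
  rw [win_eq hp] at h0
  exact ((p h u).avg_eq_zero_iff fun v => win_nonneg _ v).1 h0 v hv

lemma win_eq_zero_of_children (hp : Absorbs p T) {h : List V} {u : V}
    (h0 : ∀ v, p h u v ≠ 0 → win p T F inf (h ++ [u]) v = 0) : win p T F inf h u = 0 := by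
  rw [win_eq hp]
  exact ((p h u).avg_eq_zero_iff fun v => win_nonneg _ v).2 h0

/-- Only the behaviour of the process after the history `hu` matters for the probability of the
event after `hu`. -/
lemma hit_congr {p' : HistoryChain V} {n : ℕ} {h : List V} {u : V}
    (hpp : ∀ g w, (h ++ [u]) <+: (g ++ [w]) → p g w = p' g w) : hit p A n h u = hit p' A n h u := by
  induction n generalizing h u with
  | zero => rfl
  | succ n ih =>
    simp only [hit]
    rw [hpp h u List.prefix_rfl]
    refine congrArg _ (funext fun v => ih fun g w hg => hpp g w ?_)
    exact (List.prefix_append _ _).trans hg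

lemma win_congr {p' : HistoryChain V} {h : List V} {u : V}
    (hpp : ∀ g w, (h ++ [u]) <+: (g ++ [w]) → p g w = p' g w) :
    win p T F inf h u = win p' T F inf h u := by
  simp only [win, reach, hit_congr hpp]

/-- A ranking argument for a positive probability: `G` is a set of histories with a bounded rank.
At every history in `G` the event has probability at least `ε`, or it has occurred, or with
probability at least `δ` the next history lies in `G` and has a smaller rank or gives the event the
probability `ε`, or all moves stay in `G` without increasing the rank or give the event the
probability `ε`; the last case requires that infinite plays belong to the event.  The resulting
bound is uniform in the process. -/
lemma win_pos_of_rank (hp : Absorbs p T) {δ ε : ℝ} (hδ : 0 < δ) (hδ1 : δ ≤ 1) (hε : 0 < ε)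
    (hε1 : ε ≤ 1) {N : ℕ} {G : List V → V → Prop} {b : List V → V → ℕ}
    (hb : ∀ h u, G h u → b h u ≤ N)
    (H : ∀ h u, G h u → ε ≤ win p T F inf h u ∨ (u ∈ T ∧ u ∈ F) ∨
      (u ∉ T ∧ ∃ v, δ ≤ (p h u v).toReal ∧ (ε ≤ win p T F inf (h ++ [u]) v ∨
        (G (h ++ [u]) v ∧ b (h ++ [u]) v < b h u))) ∨
      (inf ∧ u ∉ T ∧ ∀ v, p h u v ≠ 0 → (ε ≤ win p T F inf (h ++ [u]) v ∨
        (G (h ++ [u]) v ∧ b (h ++ [u]) v ≤ b h u)))) {h : List V} {u : V} (hG : G h u) :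
    ε * δ ^ (N + 1) ≤ win p T F inf h u := by
  have hpow : ∀ {m n : ℕ}, m ≤ n → ε * δ ^ n ≤ ε * δ ^ m := fun hmn =>
    mul_le_mul_of_nonneg_left (pow_le_pow_of_le_one hδ.le hδ1 hmn) hε.le
  have hpow' : ∀ n : ℕ, ε * δ ^ (n + 1) = δ * (ε * δ ^ n) := fun n => by ring
  have hpos : ∀ n : ℕ, 0 < ε * δ ^ n := fun n => by positivity
  have hpow1 : ∀ n : ℕ, ε * δ ^ n ≤ ε := fun n => by simpa using hpow (Nat.zero_le n)
  suffices hmain : ∀ h u, G h u → ε * δ ^ (b h u + 1) ≤ win p T F inf h u from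
    (hpow (Nat.succ_le_succ (hb h u hG))).trans (hmain h u hG)
  by_cases hi : inf
  · have hwin : ∀ {n h u}, ε ≤ win p T F inf h u → hit p (T \ F) n h u ≤ 1 - ε := by
      intro n h u hw
      rw [win_of_inf hi] at hw
      linarith [hit_le_reach (p := p) (A := T \ F) n h u]
    -- The rank need not decrease if infinite plays count, so the induction is on the time in which
    -- the complementary event can occur.
    have key : ∀ n h u, G h u → hit p (T \ F) n h u ≤ 1 - ε * δ ^ (b h u + 1) := by
      intro n
      induction n with
      | zero =>
        intro h u hG
        have hz : u ∉ T \ F → hit p (T \ F) 0 h u ≤ 1 - ε * δ ^ (b h u + 1) := fun hu => by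
          simp only [hit, hu, if_false]; linarith [hpow1 (b h u + 1)]
        rcases H h u hG with h1 | h1 | h1 | h1
        · linarith [hwin (n := 0) h1, hpow1 (b h u + 1)]
        · exact hz fun h => h.2 h1.2
        · exact hz fun h => h1.1 h.1
        · exact hz fun h => h1.2.1 h.1
      | succ n ih =>
        intro h u hG
        rcases H h u hG with h1 | h1 | ⟨_, v, hv, h1⟩ | ⟨_, _, h1⟩
        · linarith [hwin (n := n + 1) h1, hpow1 (b h u + 1)]
        · rw [hit_of_absorbed hp h1.1 (fun h => h.2 h1.2)]
          linarith [hpow1 (b h u + 1)]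
        · simp only [hit]
          have h2 : hit p (T \ F) n (h ++ [u]) v ≤ 1 - ε * δ ^ b h u := by
            rcases h1 with h1 | ⟨h1, h2⟩
            · linarith [hwin (n := n) h1, hpow1 (b h u)]
            · have h3 : ε * δ ^ b h u ≤ ε * δ ^ (b (h ++ [u]) v + 1) := hpow h2
              linarith [ih _ _ h1]
          rw [hpow']
          exact (p h u).avg_le_of_atom (fun w _ => hit_le_one n _ w) hv (hpos _).le h2
        · simp only [hit]
          refine PMF.avg_le _ fun v hv => ?_
          rcases h1 v hv with h2 | ⟨h2, h3⟩
          · linarith [hwin (n := n) h2, hpow1 (b h u + 1)]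
          · have h4 : ε * δ ^ (b h u + 1) ≤ ε * δ ^ (b (h ++ [u]) v + 1) :=
              hpow (Nat.succ_le_succ h3)
            linarith [ih _ _ h2]
    intro h u hG
    rw [win_of_inf hi]
    linarith [reach_le (p := p) (A := T \ F) fun n => key n h u hG]
  · have key : ∀ m h u, G h u → b h u = m → ε * δ ^ (m + 1) ≤ win p T F inf h u := by
      intro m
      induction m using Nat.strong_induction_on with
      | _ m ih =>
        rintro h u hG rfl
        rcases H h u hG with h1 | h1 | ⟨_, v, hv, h1⟩ | ⟨h1, _⟩
        · exact (hpow1 _).trans h1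
        · rw [win_of_mem hp h1.1 h1.2]
          exact (hpow1 _).trans hε1
        · have h2 : ε * δ ^ b h u ≤ win p T F inf (h ++ [u]) v := by
            rcases h1 with h1 | ⟨h1, h2⟩
            · exact (hpow1 _).trans h1
            · exact (hpow (Nat.succ_le_of_lt h2)).trans (ih _ h2 _ _ h1 rfl)
          rw [win_eq hp, hpow']
          refine (mul_le_mul hv h2 (hpos _).le ENNReal.toReal_nonneg).trans ?_
          exact (p h u).mul_le_avg (fun v => win_nonneg (h ++ [u]) v) v
        · exact absurd h1 hi
    exact fun h u hG => key _ h u hG rfl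

/-- A ranking argument for probability zero: `G` is a set of histories that the process can only
leave towards histories after which the event has probability zero, and that contains no terminal
state of `F`.  If infinite plays belong to the event, then a bounded rank has to decrease with
probability at least `δ` in every step, so that almost surely the play does not stay in `G`. -/
lemma win_zero_of_rank (hp : Absorbs p T) {δ : ℝ} (hδ : 0 < δ) (hδ1 : δ ≤ 1)
    {N : ℕ} {G : List V → V → Prop} {b : List V → V → ℕ}
    (hb : inf → ∀ h u, G h u → b h u ≤ N)
    (H : ∀ h u, G h u → (u ∈ T ∧ u ∉ F) ∨ (u ∉ T ∧
      (∀ v, p h u v ≠ 0 → win p T F inf (h ++ [u]) v = 0 ∨ G (h ++ [u]) v) ∧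
      (inf → ∃ v, δ ≤ (p h u v).toReal ∧ (win p T F inf (h ++ [u]) v = 0 ∨
        b (h ++ [u]) v < b h u)))) {h : List V} {u : V} (hG : G h u) :
    win p T F inf h u = 0 := by
  by_cases hi : inf
  · -- Every upper bound on `G` can be improved by a constant factor.
    have step : ∀ C : ℝ, 0 ≤ C → (∀ h u, G h u → win p T F inf h u ≤ C) →
        ∀ m h u, G h u → b h u = m → win p T F inf h u ≤ C - δ ^ (m + 1) * C := by
      intro C hC hle m
      induction m using Nat.strong_induction_on with
      | _ m ih =>
        rintro h u hG rfl
        have hp1 : δ ^ (b h u + 1) ≤ 1 := pow_le_one₀ hδ.le hδ1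
        rcases H h u hG with h1 | ⟨_, h1, h2⟩
        · rw [win_of_not_mem hp h1.1 h1.2]
          nlinarith
        · obtain ⟨v, hv, h3⟩ := h2 hi
          have hall : ∀ w, p h u w ≠ 0 → win p T F inf (h ++ [u]) w ≤ C := fun w hw =>
            (h1 w hw).elim (fun h0 => h0.trans_le hC) (hle _ w)
          have hv' : win p T F inf (h ++ [u]) v ≤ C - δ ^ b h u * C := by
            have h0 : win p T F inf (h ++ [u]) v = 0 →
                win p T F inf (h ++ [u]) v ≤ C - δ ^ b h u * C := fun h0 => by
              rw [h0]
              have : δ ^ b h u ≤ 1 := pow_le_one₀ hδ.le hδ1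
              nlinarith
            rcases h3 with h3 | h3
            · exact h0 h3
            · rcases h1 v (PMF.ne_zero_of_le hδ hv) with h4 | h4
              · exact h0 h4
              · refine (ih _ h3 _ _ h4 rfl).trans ?_
                have : δ ^ b h u ≤ δ ^ (b (h ++ [u]) v + 1) :=
                  pow_le_pow_of_le_one hδ.le hδ1 h3
                nlinarith
          rw [win_eq hp, pow_succ', mul_assoc]
          exact (p h u).avg_le_of_atom hall hv (by positivity) hv'
    have hN : 0 < δ ^ (N + 1) := by positivity
    have hN1 : δ ^ (N + 1) ≤ 1 := pow_le_one₀ hδ.le hδ1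
    have iter : ∀ k : ℕ, ∀ h u, G h u → win p T F inf h u ≤ (1 - δ ^ (N + 1)) ^ k := by
      intro k
      induction k with
      | zero => intro h u _; simpa using win_le_one h u
      | succ k ih =>
        intro h u hG
        have hC : 0 ≤ (1 - δ ^ (N + 1)) ^ k := pow_nonneg (by linarith) k
        refine (step _ hC ih _ h u hG rfl).trans ?_
        have : δ ^ (N + 1) ≤ δ ^ (b h u + 1) :=
          pow_le_pow_of_le_one hδ.le hδ1 (Nat.succ_le_succ (hb hi h u hG))
        rw [pow_succ (1 - δ ^ (N + 1)) k]
        nlinarith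
    refine le_antisymm (ge_of_tendsto' (tendsto_pow_atTop_nhds_zero_of_lt_one (by linarith)
      (show 1 - δ ^ (N + 1) < 1 by linarith)) fun k => iter k h u hG) (win_nonneg h u)
  · have key : ∀ n h u, (G h u ∨ win p T F inf h u = 0) → hit p (T ∩ F) n h u = 0 := by
      intro n
      induction n with
      | zero =>
        rintro h u (hG | h0)
        · have : u ∉ T ∩ F := fun hu => by
            rcases H h u hG with h1 | h1
            · exact h1.2 hu.2
            · exact h1.1 hu.1
          simp [hit, this]
        · rw [win_of_not_inf hi] at h0
          exact le_antisymm (h0 ▸ hit_le_reach 0 h u) (hit_nonneg 0 h u)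
      | succ n ih =>
        rintro h u (hG | h0)
        · rcases H h u hG with h1 | ⟨_, h1, _⟩
          · exact hit_of_absorbed hp h1.1 (fun h => h1.2 h.2) _ _
          · exact ((p h u).avg_eq_zero_iff fun v => hit_nonneg n _ v).2 fun v hv =>
              ih _ _ (h1 v hv).symm
        · rw [win_of_not_inf hi] at h0
          exact le_antisymm (h0 ▸ hit_le_reach _ h u) (hit_nonneg _ h u)
    rw [win_of_not_inf hi]
    exact le_antisymm (reach_le fun n => (key n h u (Or.inl hG)).le) (reach_nonneg h u)

end HistoryChain

/-! ### Ranks of least fixed points -/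

/-- The elements of a least fixed point on a finite type can be ranked by the stage at which they
enter it. -/
lemma OrderHom.exists_rank {V : Type*} [Finite V] (f : Set V →o Set V) :
    ∃ r : V → ℕ, (∀ u ∈ f.lfp, u ∈ f {v | v ∈ f.lfp ∧ r v < r u}) ∧
      ∀ n, ∀ u ∈ f {v | v ∈ f.lfp ∧ r v < n}, r u ≤ n := by
  classical
  set S : ℕ → Set V := fun n => f^[n] ∅
  have hS1 : ∀ n, S (n + 1) = f (S n) := fun n => Function.iterate_succ_apply' f n ∅
  have hmono : Monotone S := by
    refine monotone_nat_of_le_succ fun n => ?_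
    induction n with
    | zero => exact Set.empty_subset _
    | succ n ih => rw [hS1, hS1]; exact f.monotone ih
  have hle : ∀ n, S n ⊆ f.lfp := by
    intro n
    induction n with
    | zero => exact Set.empty_subset _
    | succ n ih => rw [hS1]; exact (f.monotone ih).trans f.map_lfp.le
  have hex : ∀ u ∈ f.lfp, ∃ n, u ∈ S n := by
    obtain ⟨n, hn⟩ := WellFoundedGT.monotone_chain_condition ⟨S, hmono⟩
    have : f (S n) ≤ S n := by rw [← hS1]; exact (hn (n + 1) (Nat.le_succ n)).ge
    exact fun u hu => ⟨n, f.lfp_le this hu⟩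
  have hmem : ∀ n,
      {v | v ∈ f.lfp ∧ (if h : ∃ n, v ∈ S n then Nat.find h - 1 else 0) < n} = S n := by
    intro n
    ext v
    constructor
    · rintro ⟨hv, hlt⟩
      have h := hex v hv
      rw [dif_pos h] at hlt
      exact hmono (by omega : Nat.find h ≤ n) (Nat.find_spec h)
    · intro hv
      refine ⟨hle n hv, ?_⟩
      have h : ∃ n, v ∈ S n := ⟨n, hv⟩
      have h0 : Nat.find h ≠ 0 := fun h0 => by
        have := Nat.find_spec h
        rw [h0] at this
        exact this
      have := Nat.find_min' h hv
      rw [dif_pos h]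
      omega
  refine ⟨fun v => if h : ∃ n, v ∈ S n then Nat.find h - 1 else 0, fun u hu => ?_, fun n u hu => ?_⟩
  · rw [hmem]
    have h := hex u hu
    have h0 : Nat.find h ≠ 0 := fun h0 => by
      have := Nat.find_spec h
      rw [h0] at this
      exact this
    simp only [dif_pos h]
    rw [← hS1, Nat.sub_add_cancel (Nat.pos_of_ne_zero h0)]
    exact Nat.find_spec h
  · rw [hmem, ← hS1] at hu
    have h : ∃ n, u ∈ S n := ⟨_, hu⟩
    have := Nat.find_min' h hu
    simp only [dif_pos h]
    omega

lemma Finite.exists_nat_bound {α : Type*} [Finite α] (r : α → ℕ) : ∃ N, ∀ a, r a ≤ N :=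
  let ⟨N, hN⟩ := Set.Finite.bddAbove (Set.finite_range r)
  ⟨N, fun a => hN ⟨a, rfl⟩⟩

namespace Game

/-! ### One step of a play -/

section Step

variable {V I : Type*} (G : Game V I)

/-- The set of terminal vertices. -/
def terminals : Set V := {u | ∀ v, ¬ G.Adj u v}

variable {G} in
lemma exists_adj {u : V} (hu : u ∉ G.terminals) : ∃ v, G.Adj u v := by
  simpa [terminals] using hu

open Classical in
/-- The distribution of the successor of a stochastic vertex; the junk value at other vertices is a
Dirac distribution. -/
noncomputable def nature (u : V) : PMF V :=
  if h : G.owner u = none ∧ ∃ v, G.Adj u v then (G.prob ⟨u, h⟩).map Subtype.val else PMF.pure u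

lemma absorbs_step (σ : G.Profile) : HistoryChain.Absorbs (G.step σ) G.terminals := by
  intro h u hu
  have : ¬ ∃ v, G.Adj u v := by simpa [terminals] using hu
  simp [step, this]

variable {G}

lemma step_of_nature (σ : G.Profile) (h : List V) {u : V} (hu : u ∉ G.terminals)
    (ho : G.owner u = none) : G.step σ h u = G.nature u := by
  have hu' := exists_adj hu
  unfold step nature
  rw [dif_pos hu', dif_pos ⟨ho, hu'⟩]
  split
  · rfl
  · rename_i j hj
    rw [ho] at hj
    cases hj

lemma step_of_owner (σ : G.Profile) (h : List V) {u : V} {i : I}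
    (ho : G.owner u = some i) (hu : ∃ v, G.Adj u v) :
    G.step σ h u = (σ i h ⟨u, ho, hu⟩).map Subtype.val := by
  unfold step
  rw [dif_pos hu]
  split
  · rename_i hn
    rw [ho] at hn
    cases hn
  · rename_i j hj
    obtain rfl : j = i := by simpa [hj] using ho
    rfl

lemma map_val_ne_zero {u v : V} {μ : PMF {v : V // G.Adj u v}} (h : μ.map Subtype.val v ≠ 0) :
    G.Adj u v := by
  rw [← PMF.mem_support_iff, PMF.mem_support_map_iff] at h
  obtain ⟨w, -, rfl⟩ := h
  exact w.2

lemma adj_of_nature {u v : V} (hu : u ∉ G.terminals) (ho : G.owner u = none)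
    (hv : G.nature u v ≠ 0) : G.Adj u v := by
  unfold nature at hv
  rw [dif_pos ⟨ho, exists_adj hu⟩] at hv
  exact map_val_ne_zero hv

lemma adj_of_step {σ : G.Profile} {h : List V} {u v : V} (hu : u ∉ G.terminals)
    (hv : G.step σ h u v ≠ 0) : G.Adj u v := by
  rcases ho : G.owner u with _ | i
  · rw [step_of_nature σ h hu ho] at hv
    exact adj_of_nature hu ho hv
  · rw [step_of_owner σ h ho (exists_adj hu)] at hv
    exact map_val_ne_zero hv

lemma deviate_self (σ : G.Profile) (i : I) (τ : G.Strategy i) : G.deviate σ i τ i = τ := by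
  simp [deviate]

lemma deviate_of_ne (σ : G.Profile) {i j : I} (τ : G.Strategy i) (h : j ≠ i) :
    G.deviate σ i τ j = σ j := by
  simp [deviate, h]

lemma deviate_eq_self (σ : G.Profile) (i : I) : G.deviate σ i (σ i) = σ := by
  simp [deviate]

lemma step_deviate_of_ne (σ : G.Profile) {i : I} (τ : G.Strategy i) (h : List V) {u : V}
    (hu : G.owner u ≠ some i) : G.step (G.deviate σ i τ) h u = G.step σ h u := by
  by_cases ht : u ∈ G.terminals
  · rw [G.absorbs_step _ _ _ ht, G.absorbs_step _ _ _ ht]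
  rcases ho : G.owner u with _ | j
  · rw [step_of_nature _ h ht ho, step_of_nature _ h ht ho]
  · have hj : j ≠ i := fun hj => hu (hj ▸ ho)
    rw [step_of_owner _ h ho (exists_adj ht), step_of_owner _ h ho (exists_adj ht),
      deviate_of_ne σ τ hj]

variable (G) in
/-- A common positive lower bound for the probabilities of the edges from the stochastic vertices
and for the mass of the largest atom of a distribution on the vertices. -/
lemma exists_min_prob [Fintype V] [Nonempty V] : ∃ δ : ℝ, 0 < δ ∧ δ ≤ 1 ∧
    δ ≤ (Fintype.card V : ℝ)⁻¹ ∧ ∀ u v, G.nature u v ≠ 0 → δ ≤ (G.nature u v).toReal := by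
  classical
  set f : V × V → ℝ := fun x => if G.nature x.1 x.2 = 0 then 1 else (G.nature x.1 x.2).toReal
  obtain ⟨x, hx⟩ := Finite.exists_min f
  have hfx : 0 < f x := by
    simp only [f]
    split_ifs with h
    · exact one_pos
    · exact PMF.toReal_pos h
  have hc : (0 : ℝ) < Fintype.card V := by exact_mod_cast Fintype.card_pos
  refine ⟨min (min 1 (Fintype.card V : ℝ)⁻¹) (f x), by positivity,
    (min_le_left _ _).trans (min_le_left _ _), (min_le_left _ _).trans (min_le_right _ _),
    fun u v huv => (min_le_right _ _).trans ?_⟩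
  have := hx (u, v)
  simpa [f, huv] using this

end Step

/-! ### Qualitative determinacy of two-player stochastic games -/

section Determinacy

variable {V I : Type*} (G : Game V I)

/-- The process `p` is a play after the history `hu` in which the players in `ctl` play the
positional strategy `f`, and the other players play arbitrarily. -/
def Conforms (ctl : I → Prop) (f : V → V) (p : HistoryChain V) (h : List V) (u : V) : Prop :=
  HistoryChain.Absorbs p G.terminals ∧ ∀ g w, (h ++ [u]) <+: (g ++ [w]) → w ∉ G.terminals →
    (G.owner w = none → p g w = G.nature w) ∧
    ∀ i, G.owner w = some i → (ctl i → p g w = PMF.pure (f w)) ∧ ∀ v, p g w v ≠ 0 → G.Adj w v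

variable {G}

lemma Conforms.child {ctl : I → Prop} {f : V → V} {p : HistoryChain V} {h : List V} {u : V}
    (hc : G.Conforms ctl f p h u) (v : V) : G.Conforms ctl f p (h ++ [u]) v :=
  ⟨hc.1, fun g w hgw => hc.2 g w ((List.prefix_append _ _).trans hgw)⟩

variable (G)

/-- `B` is a winning region for the event to end in `F`, or, if `inf` holds, to play infinitely
long: on `B` the players in `ctl` can ensure by the positional strategy `f` that the event has a
probability that is bounded below, and outside `B` the other players can ensure by `f` that the
event has probability zero. -/
structure IsRegion [Fintype V] (ctl : I → Prop) (F : Set V) (inf : Prop) (B : Set V) (f : V → V)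
    (ε : ℝ) : Prop where
  pos : 0 < ε
  le_one : ε ≤ 1
  adj : ∀ u, u ∉ G.terminals → G.Adj u (f u)
  win_of_mem : ∀ {p : HistoryChain V} {h : List V} {u : V}, u ∈ B → G.Conforms ctl f p h u →
    ε ≤ p.win G.terminals F inf h u
  win_of_not_mem : ∀ {p : HistoryChain V} {h : List V} {u : V}, u ∉ B →
    G.Conforms (fun i => ¬ ctl i) f p h u → p.win G.terminals F inf h u = 0

/-- The one-step operator of the positive reachability game: a vertex is kept if it is terminal and
belongs to `A`, or if one step can lead into `Y`, where the players in `ctl` choose in favour of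
`Y`, the others against it, and the stochastic vertices are resolved in favour of `Y`, subject to
the restriction that all stochastic successors belong to `X`. -/
def attract (ctl : I → Prop) (A X Y : Set V) : Set V :=
  {u | (u ∈ G.terminals ∧ u ∈ A) ∨ (u ∉ G.terminals ∧
    (G.owner u = none → (∀ v, G.nature u v ≠ 0 → v ∈ X) ∧ ∃ v, G.nature u v ≠ 0 ∧ v ∈ Y) ∧
    ∀ i, G.owner u = some i → (ctl i → ∃ v, G.Adj u v ∧ v ∈ Y) ∧
      (¬ ctl i → ∀ v, G.Adj u v → v ∈ Y))}

lemma attract_mono {ctl : I → Prop} {A X X' Y Y' : Set V} (hX : X ⊆ X') (hY : Y ⊆ Y') :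
    G.attract ctl A X Y ⊆ G.attract ctl A X' Y' := by
  rintro u (h | ⟨h, h1, h2⟩)
  · exact Or.inl h
  · exact Or.inr ⟨h, fun ho => ⟨fun v hv => hX ((h1 ho).1 v hv),
      let ⟨v, hv, hvY⟩ := (h1 ho).2; ⟨v, hv, hY hvY⟩⟩,
      fun i hi => ⟨fun hc => let ⟨v, hv, hvY⟩ := (h2 i hi).1 hc; ⟨v, hv, hY hvY⟩,
        fun hc v hv => hY ((h2 i hi).2 hc v hv)⟩⟩

/-- The operator whose least fixed point is the region from which the players in `ctl` reach `A`
while all stochastic moves stay in `X`. -/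
def attractHom (ctl : I → Prop) (A X : Set V) : Set V →o Set V :=
  ⟨G.attract ctl A X, fun _ _ h => G.attract_mono le_rfl h⟩

variable {G}

open Classical in
lemma exists_choice (Z : V → V → Prop) :
    ∃ f : V → V, (∀ u, u ∉ G.terminals → G.Adj u (f u)) ∧
      ∀ u v, G.Adj u v → Z u v → Z u (f u) := by
  have : ∀ u, ∃ w, (u ∉ G.terminals → G.Adj u w) ∧ ∀ v, G.Adj u v → Z u v → Z u w := by
    intro u
    by_cases h : ∃ v, G.Adj u v ∧ Z u v
    · obtain ⟨v, hv, hz⟩ := h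
      exact ⟨v, fun _ => hv, fun _ _ _ => hz⟩
    · by_cases hu : u ∈ G.terminals
      · exact ⟨u, fun h => absurd hu h, fun v hv => absurd hv (hu v)⟩
      · obtain ⟨v, hv⟩ := exists_adj hu
        exact ⟨v, fun _ => hv, fun w hw hz => absurd ⟨w, hw, hz⟩ h⟩
  choose f hf using this
  exact ⟨f, fun u => (hf u).1, fun u => (hf u).2⟩

variable (G)

/-- Determinacy for events that contain no infinite plays: the region is the attractor of the
terminal vertices in `F`. -/
lemma exists_region_of_not_inf [Fintype V] [Nonempty V] (ctl : I → Prop) (F : Set V) {inf : Prop}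
    (hi : ¬ inf) : ∃ B f ε, G.IsRegion ctl F inf B f ε := by
  classical
  obtain ⟨δ, hδ, hδ1, hδc, hδn⟩ := G.exists_min_prob
  set φ := G.attractHom ctl F Set.univ
  obtain ⟨r, hr, -⟩ := φ.exists_rank
  obtain ⟨N, hN⟩ := Finite.exists_nat_bound r
  obtain ⟨f, hfa, hf⟩ := exists_choice (G := G)
    (fun u v => if u ∈ φ.lfp then v ∈ φ.lfp ∧ r v < r u else v ∉ φ.lfp)
  refine ⟨φ.lfp, f, 1 * δ ^ (N + 1), by positivity, by
    simpa using pow_le_one₀ hδ.le hδ1, hfa, ?_, ?_⟩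
  · intro p h u hu hc
    refine HistoryChain.win_pos_of_rank hc.1 hδ hδ1 one_pos le_rfl (N := N)
      (G := fun h u => u ∈ φ.lfp ∧ G.Conforms ctl f p h u) (b := fun _ u => r u)
      (fun h u _ => hN u) ?_ ⟨hu, hc⟩
    rintro h u ⟨hu, hc⟩
    refine Or.inr ?_
    rcases hr u hu with hu1 | ⟨hu1, h1, h2⟩
    · exact Or.inl hu1
    refine Or.inr (Or.inl ⟨hu1, ?_⟩)
    have hcu := hc.2 h u List.prefix_rfl hu1
    rcases ho : G.owner u with _ | i
    · obtain ⟨v, hv, hvY⟩ := (h1 ho).2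
      refine ⟨v, ?_, Or.inr ⟨⟨hvY.1, hc.child v⟩, hvY.2⟩⟩
      rw [hcu.1 ho]
      exact hδn u v hv
    · by_cases hci : ctl i
      · obtain ⟨v, hv, hvY⟩ := (h2 i ho).1 hci
        have hz := hf u v hv (by rw [if_pos hu]; exact hvY)
        rw [if_pos hu] at hz
        refine ⟨f u, ?_, Or.inr ⟨⟨hz.1, hc.child _⟩, hz.2⟩⟩
        rw [(hcu.2 i ho).1 hci]
        simpa using hδ1
      · obtain ⟨v, hv⟩ := (p h u).exists_card_inv_le
        have hv' : δ ≤ (p h u v).toReal := hδc.trans hv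
        have hvY := (h2 i ho).2 hci v ((hcu.2 i ho).2 v (PMF.ne_zero_of_le hδ hv'))
        exact ⟨v, hv', Or.inr ⟨⟨hvY.1, hc.child v⟩, hvY.2⟩⟩
  · intro p h u hu hc
    refine HistoryChain.win_zero_of_rank hc.1 hδ hδ1 (N := N)
      (G := fun h u => u ∉ φ.lfp ∧ G.Conforms (fun i => ¬ ctl i) f p h u) (b := fun _ u => r u)
      (fun _ h u _ => hN u) ?_ ⟨hu, hc⟩
    rintro h u ⟨hu, hc⟩
    have hu2 : u ∉ φ φ.lfp := by rwa [φ.map_lfp]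
    by_cases hu1 : u ∈ G.terminals
    · exact Or.inl ⟨hu1, fun hF => hu2 (Or.inl ⟨hu1, hF⟩)⟩
    refine Or.inr ⟨hu1, fun v hv => Or.inr ⟨fun hvY => ?_, hc.child v⟩, fun h => absurd h hi⟩
    have hcu := hc.2 h u List.prefix_rfl hu1
    rcases ho : G.owner u with _ | i
    · rw [hcu.1 ho] at hv
      exact hu2 (Or.inr ⟨hu1, fun _ => ⟨fun _ _ => trivial, v, hv, hvY⟩, by simp [ho]⟩)
    · by_cases hci : ctl i
      · exact hu2 (Or.inr ⟨hu1, by simp [ho], fun j hj => by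
          obtain rfl : i = j := by simpa [ho] using hj
          exact ⟨fun _ => ⟨v, (hcu.2 i ho).2 v hv, hvY⟩, fun h => absurd hci h⟩⟩)
      · rw [(hcu.2 i ho).1 hci] at hv
        obtain rfl : v = f u := by simpa using hv
        refine hu2 (Or.inr ⟨hu1, by simp [ho], fun j hj => ?_⟩)
        obtain rfl : i = j := by simpa [ho] using hj
        refine ⟨fun h => absurd h hci, fun _ w hw => by_contra fun hwY => ?_⟩
        have hz := hf u w hw (by rw [if_neg hu]; exact hwY)
        rw [if_neg hu] at hz
        exact hz hvY

/-- Determinacy for events that contain the infinite plays: the region is the complement of the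
region from which the other players almost surely reach a terminal vertex outside `F`, which is a
greatest fixed point of attractors; the region itself is a least fixed point. -/
lemma exists_region_of_inf [Fintype V] [Nonempty V] (ctl : I → Prop) (F : Set V) {inf : Prop}
    (hi : inf) : ∃ B f ε, G.IsRegion ctl F inf B f ε := by
  classical
  obtain ⟨δ, hδ, hδ1, hδc, hδn⟩ := G.exists_min_prob
  set ctl' : I → Prop := fun i => ¬ ctl i
  have hlfp : ∀ {X X' : Set V}, X ⊆ X' →
      (G.attractHom ctl' Fᶜ X).lfp ⊆ (G.attractHom ctl' Fᶜ X').lfp := fun h =>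
    OrderHom.lfp.monotone fun Y => G.attract_mono h le_rfl
  set ψ : Set V →o Set V := ⟨fun S => (G.attractHom ctl' Fᶜ Sᶜ).lfpᶜ, fun S S' h =>
    Set.compl_subset_compl.2 (hlfp (Set.compl_subset_compl.2 h))⟩
  set B := ψ.lfp with hB
  have hBc : (G.attractHom ctl' Fᶜ Bᶜ).lfp = Bᶜ := by
    have : (G.attractHom ctl' Fᶜ Bᶜ).lfpᶜ = B := ψ.map_lfp
    rw [← compl_compl (G.attractHom ctl' Fᶜ Bᶜ).lfp, this]
  obtain ⟨b, hb, hb'⟩ := ψ.exists_rank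
  obtain ⟨r, hr, -⟩ := (G.attractHom ctl' Fᶜ Bᶜ).exists_rank
  rw [hBc] at hr
  obtain ⟨N, hN⟩ := Finite.exists_nat_bound b
  obtain ⟨N', hN'⟩ := Finite.exists_nat_bound r
  obtain ⟨f, hfa, hf⟩ := exists_choice (G := G)
    (fun u v => if u ∈ B then v ∈ B ∧ b v ≤ b u else v ∉ B ∧ r v < r u)
  refine ⟨B, f, 1 * δ ^ (N + 1), by positivity, by
    simpa using pow_le_one₀ hδ.le hδ1, hfa, ?_, ?_⟩
  · intro p h u hu hc
    refine HistoryChain.win_pos_of_rank hc.1 hδ hδ1 one_pos le_rfl (N := N)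
      (G := fun h u => u ∈ B ∧ G.Conforms ctl f p h u) (b := fun _ u => b u)
      (fun h u _ => hN u) ?_ ⟨hu, hc⟩
    rintro h u ⟨hu, hc⟩
    set Y := (G.attractHom ctl' Fᶜ {v | v ∈ B ∧ b v < b u}ᶜ).lfp with hY
    have huY : u ∉ Y := hb u hu
    have huY' : u ∉ G.attract ctl' Fᶜ {v | v ∈ B ∧ b v < b u}ᶜ Y := by
      have := (G.attractHom ctl' Fᶜ {v | v ∈ B ∧ b v < b u}ᶜ).map_lfp
      rw [← hY] at this
      rwa [← this] at huY
    -- leaving `Y` means to stay in the region without increasing the rank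
    have hout : ∀ v, v ∉ Y → v ∈ B ∧ b v ≤ b u := fun v hv => by
      have hv' : v ∈ ψ {v | v ∈ B ∧ b v < b u} := hv
      refine ⟨?_, hb' _ _ hv'⟩
      rw [hB, ← ψ.map_lfp]
      exact ψ.monotone (fun w hw => hw.1) hv'
    refine Or.inr ?_
    by_cases hu1 : u ∈ G.terminals
    · exact Or.inl ⟨hu1, by_contra fun hF => huY' (Or.inl ⟨hu1, hF⟩)⟩
    refine Or.inr ?_
    have hcu := hc.2 h u List.prefix_rfl hu1
    rcases ho : G.owner u with _ | i
    · by_cases hall : ∀ v, G.nature u v ≠ 0 → v ∈ ({v | v ∈ B ∧ b v < b u}ᶜ : Set V)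
      · refine Or.inr ⟨hi, hu1, fun v hv => Or.inr ?_⟩
        rw [hcu.1 ho] at hv
        have := hout v fun hvY => huY' (Or.inr ⟨hu1, fun _ => ⟨hall, v, hv, hvY⟩, by simp [ho]⟩)
        exact ⟨⟨this.1, hc.child v⟩, this.2⟩
      · push Not at hall
        obtain ⟨v, hv, hvS⟩ := hall
        rw [Set.mem_compl_iff, not_not] at hvS
        refine Or.inl ⟨hu1, v, ?_, Or.inr ⟨⟨hvS.1, hc.child v⟩, hvS.2⟩⟩
        rw [hcu.1 ho]
        exact hδn u v hv
    · refine Or.inr ⟨hi, hu1, fun v hv => Or.inr ?_⟩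
      suffices hs : v ∈ B ∧ b v ≤ b u from ⟨⟨hs.1, hc.child v⟩, hs.2⟩
      by_cases hci : ctl i
      · rw [(hcu.2 i ho).1 hci] at hv
        obtain rfl : v = f u := by simpa using hv
        have : ∃ w, G.Adj u w ∧ w ∉ Y := by
          by_contra! hcon
          exact huY' (Or.inr ⟨hu1, by simp [ho], fun j hj => by
            obtain rfl : i = j := by simpa [ho] using hj
            exact ⟨fun h => absurd hci h, fun _ w hw => hcon w hw⟩⟩)
        obtain ⟨w, hw, hwY⟩ := this
        have hz := hf u w hw (by rw [if_pos hu]; exact hout w hwY)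
        rwa [if_pos hu] at hz
      · refine hout v fun hvY => huY' (Or.inr ⟨hu1, by simp [ho], fun j hj => ?_⟩)
        obtain rfl : i = j := by simpa [ho] using hj
        exact ⟨fun _ => ⟨v, (hcu.2 i ho).2 v hv, hvY⟩, fun h => absurd hci h⟩
  · intro p h u hu hc
    refine HistoryChain.win_zero_of_rank hc.1 hδ hδ1 (N := N')
      (G := fun h u => u ∈ Bᶜ ∧ G.Conforms ctl' f p h u) (b := fun _ u => r u)
      (fun _ h u _ => hN' u) ?_ ⟨hu, hc⟩
    rintro h u ⟨hu, hc⟩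
    rcases hr u hu with hu1 | ⟨hu1, h1, h2⟩
    · exact Or.inl ⟨hu1.1, hu1.2⟩
    have hcu := hc.2 h u List.prefix_rfl hu1
    refine Or.inr ⟨hu1, ?_⟩
    rcases ho : G.owner u with _ | i
    · obtain ⟨hX, v, hv, hvY⟩ := h1 ho
      rw [hcu.1 ho]
      exact ⟨fun w hw => Or.inr ⟨hX w hw, hc.child w⟩, fun _ => ⟨v, hδn u v hv, Or.inr hvY.2⟩⟩
    · by_cases hci : ctl' i
      · obtain ⟨v, hv, hvY⟩ := (h2 i ho).1 hci
        have hz := hf u v hv (by rw [if_neg hu]; exact hvY)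
        rw [if_neg hu] at hz
        rw [(hcu.2 i ho).1 hci]
        refine ⟨fun w hw => ?_, fun _ => ⟨f u, by simpa using hδ1, Or.inr hz.2⟩⟩
        obtain rfl : w = f u := by simpa using hw
        exact Or.inr ⟨hz.1, hc.child _⟩
      · have hY := fun v hv => (h2 i ho).2 hci v ((hcu.2 i ho).2 v hv)
        obtain ⟨v, hv⟩ := (p h u).exists_card_inv_le
        have hv' : δ ≤ (p h u v).toReal := hδc.trans hv
        exact ⟨fun w hw => Or.inr ⟨(hY w hw).1, hc.child w⟩,
          fun _ => ⟨v, hv', Or.inr (hY v (PMF.ne_zero_of_le hδ hv')).2⟩⟩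

/-- Qualitative determinacy in positional strategies: every event that depends only on the terminal
vertex that is reached has a winning region. -/
theorem exists_region [Fintype V] [Nonempty V] (ctl : I → Prop) (F : Set V) (inf : Prop) :
    ∃ B f ε, G.IsRegion ctl F inf B f ε := by
  by_cases hi : inf
  · exact G.exists_region_of_inf ctl F hi
  · exact G.exists_region_of_not_inf ctl F hi

end Determinacy

/-! ### The payoff of a play -/

section Payoff

variable {V I : Type*} (G : Game V I)

open Classical in
/-- The payoff of player `i` at a terminal vertex, with the value `0` at other vertices. -/
noncomputable def terminalPayoff (i : I) (u : V) : ℝ :=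
  if h : u ∈ G.terminals then G.payoff ⟨u, h⟩ i else 0

variable {G} in
lemma eq_of_absorbed {π : ℕ → V} {m : ℕ} (hm : π m ∈ G.terminals)
    (hπ : ∀ n, π n ∈ G.terminals → π (n + 1) = π n) (k : ℕ) : π (m + k) = π m := by
  induction k with
  | zero => rfl
  | succ k ih => rw [← add_assoc, hπ _ (by rwa [ih]), ih]

lemma playPayoff_of_mem {π : ℕ → V} {n : ℕ} (i : I) (hn : π n ∈ G.terminals)
    (hπ : ∀ n, π n ∈ G.terminals → π (n + 1) = π n) :
    G.playPayoff i π = G.terminalPayoff i (π n) := by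
  classical
  have h : ∃ n, ∀ v, ¬ G.Adj (π n) v := ⟨n, hn⟩
  obtain ⟨k, hk⟩ := Nat.exists_eq_add_of_le (Nat.find_min' h hn)
  have hk' : π n = π (Nat.find h) := by
    rw [← eq_of_absorbed (Nat.find_spec h : π (Nat.find h) ∈ G.terminals) hπ k, ← hk]
  have hm : π (Nat.find h) ∈ G.terminals := Nat.find_spec h
  rw [playPayoff, dif_pos h, hk', terminalPayoff, dif_pos hm]

lemma playPayoff_of_forall {π : ℕ → V} (i : I) (h : ∀ n, π n ∉ G.terminals) :
    G.playPayoff i π = 0 := by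
  classical
  rw [playPayoff, dif_neg]
  rintro ⟨n, hn⟩
  exact h n hn

lemma finite_range_playPayoff [Finite V] (i : I) : (Set.range (G.playPayoff i)).Finite := by
  classical
  refine ((Set.finite_range fun t : {t : V // ∀ v, ¬ G.Adj t v} => G.payoff t i).insert 0).subset ?_
  rintro _ ⟨π, rfl⟩
  unfold playPayoff
  split_ifs
  · exact Or.inr ⟨_, rfl⟩
  · exact Or.inl rfl

end Payoff

/-! ### The measure over plays -/

section PlayMeasure

open MeasureTheory ProbabilityTheory
open scoped ENNReal

variable {V I : Type*} [Fintype V] [MeasurableSpace V] [DiscreteMeasurableSpace V]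
  (G : Game V I) (v₀ : V) (σ : G.Profile)

instance : IsProbabilityMeasure (G.playMeasure v₀ σ) := by
  unfold playMeasure; infer_instance

/-- The history of a play before its `n`-th vertex. -/
def history {V : Type*} (π : ℕ → V) (n : ℕ) : List V := List.ofFn fun k : Fin n => π k

lemma history_succ {V : Type*} (π : ℕ → V) (n : ℕ) : history π (n + 1) = history π n ++ [π n] := by
  simp only [history, List.ofFn_succ', List.concat_eq_append]
  rfl

lemma lintegral_pmf (μ : PMF V) (F : V → ℝ≥0∞) :
    ∫⁻ v, F v ∂μ.toMeasure = ∑ v, μ v * F v := by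
  rw [lintegral_fintype]
  refine Finset.sum_congr rfl fun v _ => ?_
  rw [PMF.toMeasure_apply_singleton _ _ (measurableSet_singleton v), mul_comm]

/-- The Markov property of the measure over plays. -/
lemma lintegral_succ (F : List V → V → V → ℝ≥0∞) (n : ℕ) :
    ∫⁻ π, F (history π n) (π n) (π (n + 1)) ∂G.playMeasure v₀ σ =
      ∫⁻ π, ∑ v, G.step σ (history π n) (π n) v * F (history π n) (π n) v
        ∂G.playMeasure v₀ σ := by
  set F' : (Finset.Iic n → V) → V → ℝ≥0∞ := fun x v =>
    F (List.ofFn fun k : Fin n => x ⟨k, Finset.mem_Iic.2 k.2.le⟩)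
        (x ⟨n, Finset.mem_Iic.2 le_rfl⟩) v
  have h1 := Kernel.partialTraj_compProd_eq_map_traj (X := fun _ => V) (κ := G.stepKernel σ)
    (Nat.zero_le n) (x₀ := fun _ => v₀)
  have hF : Measurable fun y : (Finset.Iic n → V) × V => F' y.1 y.2 := measurable_of_countable _
  calc ∫⁻ π, F (history π n) (π n) (π (n + 1)) ∂G.playMeasure v₀ σ
      = ∫⁻ y, F' y.1 y.2 ∂((G.playMeasure v₀ σ).map
          fun x => (Preorder.frestrictLe n x, x (n + 1))) := by
        rw [lintegral_map hF (by fun_prop)]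
        rfl
    _ = ∫⁻ x, ∫⁻ v, F' x v ∂(G.stepKernel σ n x)
          ∂(Kernel.partialTraj (X := fun _ => V) (G.stepKernel σ) 0 n fun _ => v₀) := by
        rw [playMeasure, ← h1, Measure.lintegral_compProd hF]
    _ = _ := by
        rw [← Kernel.traj_map_frestrictLe_apply, lintegral_map (measurable_of_countable _)
          (by fun_prop)]
        refine lintegral_congr fun π => ?_
        exact lintegral_pmf _ _

lemma ae_zero : ∀ᵐ π ∂G.playMeasure v₀ σ, π 0 = v₀ := by
  have h := Kernel.traj_map_frestrictLe_apply (X := fun _ => V) (κ := G.stepKernel σ) 0 0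
    (fun _ => v₀)
  rw [Kernel.partialTraj_self, Kernel.id_apply] at h
  have h2 : ∀ᵐ x ∂((Kernel.traj (X := fun _ => V) (G.stepKernel σ) 0 fun _ => v₀).map
      (Preorder.frestrictLe 0)), x ⟨0, Finset.mem_Iic.2 le_rfl⟩ = v₀ := by
    rw [h, ae_dirac_eq]
    rfl
  exact ae_of_ae_map (by fun_prop) h2

/-- The probability to be in `A` at time `n + k`, computed from the history at time `k`. -/
lemma lintegral_hit (A : Set V) (n k : ℕ) :
    ∫⁻ π, ENNReal.ofReal (HistoryChain.hit (G.step σ) A n (history π k) (π k)) ∂G.playMeasure v₀ σ =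
      ENNReal.ofReal (HistoryChain.hit (G.step σ) A (n + k) [] v₀) := by
  induction k generalizing n with
  | zero =>
    have : ∀ᵐ π ∂G.playMeasure v₀ σ,
        ENNReal.ofReal (HistoryChain.hit (G.step σ) A n (history π 0) (π 0)) =
        ENNReal.ofReal (HistoryChain.hit (G.step σ) A n [] v₀) := by
      filter_upwards [G.ae_zero v₀ σ] with π hπ
      rw [hπ]
      rfl
    rw [lintegral_congr_ae this]
    simp
  | succ k ih =>
    rw [show n + (k + 1) = n + 1 + k by ring, ← ih]
    simp only [history_succ]
    rw [G.lintegral_succ v₀ σ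
      (fun h u v => ENNReal.ofReal (HistoryChain.hit (G.step σ) A n (h ++ [u]) v))]
    refine lintegral_congr fun π => ?_
    rw [HistoryChain.hit, PMF.avg, ENNReal.ofReal_sum_of_nonneg fun v _ =>
      mul_nonneg ENNReal.toReal_nonneg (HistoryChain.hit_nonneg n _ v)]
    refine Finset.sum_congr rfl fun v _ => ?_
    rw [ENNReal.ofReal_mul ENNReal.toReal_nonneg, ENNReal.ofReal_toReal (PMF.apply_ne_top _ _)]

lemma measure_hit (A : Set V) (n : ℕ) :
    G.playMeasure v₀ σ {π | π n ∈ A} = ENNReal.ofReal (HistoryChain.hit (G.step σ) A n [] v₀) := by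
  classical
  have hA : MeasurableSet {π : ℕ → V | π n ∈ A} := measurable_pi_apply n (.of_discrete (s := A))
  have h := G.lintegral_hit v₀ σ A 0 n
  rw [zero_add] at h
  rw [← h, ← lintegral_indicator_one hA]
  refine lintegral_congr fun π => ?_
  by_cases hπ : π n ∈ A <;> simp [HistoryChain.hit, Set.indicator, hπ]

/-- Almost every play stays in a terminal vertex once it has reached it. -/
lemma ae_absorbed : ∀ᵐ π ∂G.playMeasure v₀ σ, ∀ n, π n ∈ G.terminals → π (n + 1) = π n := by
  classical
  rw [ae_all_iff]
  intro n
  have h := G.lintegral_succ v₀ σ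
    (fun _ u v => if u ∈ G.terminals ∧ v ≠ u then 1 else 0) n
  have h0 : ∀ π : ℕ → V, ∑ v, G.step σ (history π n) (π n) v *
      (if π n ∈ G.terminals ∧ v ≠ π n then (1 : ℝ≥0∞) else 0) = 0 := by
    intro π
    refine Finset.sum_eq_zero fun v _ => ?_
    split_ifs with hc
    · rw [G.absorbs_step σ _ _ hc.1]
      simp [hc.2]
    · simp
  simp only [h0, lintegral_zero] at h
  rw [lintegral_eq_zero_iff] at h
  · filter_upwards [h] with π hπ ht
    by_contra hne
    simp [ht, hne] at hπ
  · have := (measurable_of_countable (fun y : V × V =>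
      if y.1 ∈ G.terminals ∧ y.2 ≠ y.1 then (1 : ℝ≥0∞) else 0)).comp
      (show Measurable fun π : ℕ → V => (π n, π (n + 1)) by fun_prop)
    exact this

lemma measure_reach {A : Set V} (hA : A ⊆ G.terminals) :
    G.playMeasure v₀ σ {π | ∃ n, π n ∈ A} =
      ENNReal.ofReal (HistoryChain.reach (G.step σ) A [] v₀) := by
  have hAE := G.ae_absorbed v₀ σ
  have hab := HistoryChain.Absorbs.mono (G.absorbs_step σ) hA
  have h1 : G.playMeasure v₀ σ {π | ∃ n, π n ∈ A} =
      G.playMeasure v₀ σ (⋃ n, {π | ∃ m ≤ n, π m ∈ A}) := by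
    congr 1
    ext π
    simp only [Set.mem_ofPred_eq, Set.mem_iUnion]
    exact ⟨fun ⟨n, hn⟩ => ⟨n, n, le_rfl, hn⟩, fun ⟨_, m, _, hm⟩ => ⟨m, hm⟩⟩
  have hmono : Monotone fun n => {π : ℕ → V | ∃ m ≤ n, π m ∈ A} :=
    fun a b hab π ⟨m, hm, hmA⟩ => ⟨m, hm.trans hab, hmA⟩
  have h2 : ∀ n, G.playMeasure v₀ σ {π | ∃ m ≤ n, π m ∈ A} =
      ENNReal.ofReal (HistoryChain.hit (G.step σ) A n [] v₀) := by
    intro n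
    rw [← measure_hit]
    refine measure_congr ?_
    filter_upwards [hAE] with π hπ
    refine propext ⟨fun ⟨m, hm, hmA⟩ => ?_, fun h => ⟨n, le_rfl, h⟩⟩
    obtain ⟨k, rfl⟩ := Nat.exists_eq_add_of_le hm
    have := eq_of_absorbed (hA hmA) hπ k
    change π (m + k) ∈ A
    rwa [this]
  have h3 := tendsto_measure_iUnion_atTop (μ := G.playMeasure v₀ σ) hmono
  rw [h1]
  refine tendsto_nhds_unique h3 ?_
  simp only [Function.comp_def, h2]
  exact (ENNReal.continuous_ofReal.tendsto _).comp (HistoryChain.tendsto_hit hab [] v₀)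

/-- The distribution of the payoff of a player, in terms of the transition probabilities. -/
lemma measure_playPayoff (i : I) (A : Set ℝ) :
    G.playMeasure v₀ σ {π | G.playPayoff i π ∈ A} =
      ENNReal.ofReal (HistoryChain.win (G.step σ) G.terminals
        {u | G.terminalPayoff i u ∈ A} (0 ∈ A) [] v₀) := by
  have hAE := G.ae_absorbed v₀ σ
  by_cases h0 : (0 : ℝ) ∈ A
  · rw [HistoryChain.win_of_inf h0, ENNReal.ofReal_sub _ (HistoryChain.reach_nonneg _ _),
      ← measure_reach G v₀ σ Set.sdiff_subset, ENNReal.ofReal_one]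
    have hm : MeasurableSet {π : ℕ → V |
        ∃ n, π n ∈ G.terminals \ {u | G.terminalPayoff i u ∈ A}} := by
      rw [Set.ofPred_exists]
      exact MeasurableSet.iUnion fun n => measurable_pi_apply n (.of_discrete)
    rw [← prob_compl_eq_one_sub hm]
    refine measure_congr ?_
    filter_upwards [hAE] with π hπ
    refine propext ⟨?_, ?_⟩
    · rintro h ⟨n, hn, hn'⟩
      exact hn' (by rw [Set.mem_ofPred_eq, ← G.playPayoff_of_mem i hn hπ]; exact h)
    · intro h
      by_cases ht : ∃ n, π n ∈ G.terminals
      · obtain ⟨n, hn⟩ := ht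
        by_contra hc
        refine h ⟨n, hn, fun hA => hc ?_⟩
        change G.playPayoff i π ∈ A
        rw [G.playPayoff_of_mem i hn hπ]
        exact hA
      · push Not at ht
        change G.playPayoff i π ∈ A
        rwa [G.playPayoff_of_forall i ht]
  · rw [HistoryChain.win_of_not_inf h0, ← measure_reach G v₀ σ Set.inter_subset_left]
    refine measure_congr ?_
    filter_upwards [hAE] with π hπ
    refine propext ⟨fun h => ?_, ?_⟩
    · by_cases ht : ∃ n, π n ∈ G.terminals
      · obtain ⟨n, hn⟩ := ht
        refine ⟨n, hn, ?_⟩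
        rw [Set.mem_ofPred_eq, ← G.playPayoff_of_mem i hn hπ]
        exact h
      · push Not at ht
        have h' : G.playPayoff i π ∈ A := h
        rw [G.playPayoff_of_forall i ht] at h'
        exact absurd h' h0
    · rintro ⟨n, hn, hA⟩
      change G.playPayoff i π ∈ A
      rw [G.playPayoff_of_mem i hn hπ]
      exact hA

end PlayMeasure

/-! ### Essential infima and suprema of functions with finite range -/

section EssInf

open MeasureTheory

variable {α : Type*} {m : MeasurableSpace α} {μ : Measure α} [IsProbabilityMeasure μ] {f : α → ℝ}

lemma le_essInf_iff_of_finite (hf : (Set.range f).Finite) (x : ℝ) :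
    x ≤ essInf f μ ↔ μ {a | f a < x} = 0 := by
  have hbelow : Filter.IsBoundedUnder (· ≥ ·) (ae μ) f :=
    hf.bddBelow.isBoundedUnder_of_range
  have habove : Filter.IsBoundedUnder (· ≤ ·) (ae μ) f :=
    hf.bddAbove.isBoundedUnder_of_range
  constructor
  · intro h
    have := ae_essInf_le (μ := μ) hbelow
    rw [ae_iff] at this
    refine measure_mono_null (fun a ha => ?_) this
    exact not_le.2 (lt_of_lt_of_le ha h)
  · intro h
    refine le_essInf_of_ae_le x ?_ habove.isCoboundedUnder_ge
    rw [Filter.EventuallyLE, ae_iff]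
    simpa only [not_le] using h

lemma essInf_le_iff_of_finite (hf : (Set.range f).Finite) (x : ℝ) :
    essInf f μ ≤ x ↔ μ {a | f a ≤ x} ≠ 0 := by
  have hbelow : Filter.IsBoundedUnder (· ≥ ·) (ae μ) f :=
    hf.bddBelow.isBoundedUnder_of_range
  rw [← not_iff_not, not_le, not_not]
  constructor
  · intro h
    have := ae_lt_of_lt_essInf h hbelow
    rw [ae_iff] at this
    simpa only [not_lt] using this
  · intro h
    have hne : (Set.range f ∩ Set.Ioi x).Nonempty := by
      by_contra hemp
      have : {a | f a ≤ x} = Set.univ := Set.eq_univ_of_forall fun a =>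
        show f a ≤ x from not_lt.1 fun ha => hemp ⟨f a, ⟨a, rfl⟩, ha⟩
      rw [this, measure_univ] at h
      exact one_ne_zero h
    -- the smallest value of `f` above `x` is a lower bound almost everywhere
    obtain ⟨y, hy, hmin⟩ := Set.exists_min_image _ id (hf.inter_of_left _) hne
    refine lt_of_lt_of_le hy.2 ((le_essInf_iff_of_finite hf y).2 ?_)
    refine measure_mono_null (fun a ha => ?_) h
    exact show f a ≤ x from not_lt.1 fun hx => not_le.2 ha (hmin (f a) ⟨⟨a, rfl⟩, hx⟩)

lemma essSup_le_iff_of_finite (hf : (Set.range f).Finite) (x : ℝ) :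
    essSup f μ ≤ x ↔ μ {a | x < f a} = 0 := by
  have hbelow : Filter.IsBoundedUnder (· ≥ ·) (ae μ) f :=
    hf.bddBelow.isBoundedUnder_of_range
  have habove : Filter.IsBoundedUnder (· ≤ ·) (ae μ) f :=
    hf.bddAbove.isBoundedUnder_of_range
  constructor
  · intro h
    have := ae_le_essSup (μ := μ) habove
    rw [ae_iff] at this
    refine measure_mono_null (fun a ha => ?_) this
    exact not_le.2 (lt_of_le_of_lt h ha)
  · intro h
    refine essSup_le_of_ae_le x ?_ hbelow.isCoboundedUnder_le
    rw [Filter.EventuallyLE, ae_iff]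
    simpa only [not_le] using h

lemma le_essSup_iff_of_finite (hf : (Set.range f).Finite) (x : ℝ) :
    x ≤ essSup f μ ↔ μ {a | x ≤ f a} ≠ 0 := by
  have hf' : (Set.range fun a => - f a).Finite :=
    (hf.image Neg.neg).subset (by rintro _ ⟨a, rfl⟩; exact ⟨f a, ⟨a, rfl⟩, rfl⟩)
  have h : essSup f μ = - essInf (fun a => - f a) μ := by
    refine eq_of_forall_ge_iff fun y => ?_
    rw [essSup_le_iff_of_finite hf, neg_le, le_essInf_iff_of_finite hf']
    simp only [neg_lt_neg_iff]
  rw [h, le_neg, essInf_le_iff_of_finite hf']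
  simp only [neg_le_neg_iff]

end EssInf

/-! ### A measure-free form of the equilibrium condition -/

section Stable

variable {V I : Type*} (G : Game V I)

open Classical in
/-- The sign that turns an optimist into a pessimist: extreme risk is an essential infimum for the
payoff of a pessimist, and the negative of an essential infimum for the negated payoff of an
optimist. -/
noncomputable def sign (P : Set I) (i : I) : ℝ := if i ∈ P then 1 else -1

/-- The payoff at terminal vertices, negated for the optimists. -/
noncomputable def signedPayoff (P : Set I) (i : I) (u : V) : ℝ := sign P i * G.terminalPayoff i u

/-- For payoffs `g` and values `z` (both negated for the optimists), every player `i` obtains at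
most `z i` with positive probability and at least `z i` almost surely.  The first property
is stable under deviations of the pessimists, and the second one under deviations of the
optimists. -/
def IsStable [Fintype V] (P : Set I) (v₀ : V) (g : I → V → ℝ) (z : I → ℝ) (σ : G.Profile) : Prop :=
  ∀ i, (∀ τ, (i ∈ P ∨ τ = σ i) → HistoryChain.win (G.step (G.deviate σ i τ)) G.terminals
      {u | g i u ≤ z i} (0 ≤ z i) [] v₀ ≠ 0) ∧
    ∀ τ, (i ∉ P ∨ τ = σ i) → HistoryChain.win (G.step (G.deviate σ i τ)) G.terminals
      {u | g i u < z i} (0 < z i) [] v₀ = 0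

variable [Fintype V] [MeasurableSpace V] [DiscreteMeasurableSpace V] {G} {P : Set I} {v₀ : V}

open MeasureTheory

lemma measure_ne_zero_iff (σ : G.Profile) (i : I) (A : Set ℝ) :
    G.playMeasure v₀ σ {π | G.playPayoff i π ∈ A} ≠ 0 ↔
      HistoryChain.win (G.step σ) G.terminals {u | G.terminalPayoff i u ∈ A} (0 ∈ A) [] v₀ ≠ 0 := by
  rw [measure_playPayoff, ne_eq, ENNReal.ofReal_eq_zero,
    (HistoryChain.win_nonneg _ _).ge_iff_eq']

lemma extremeRisk_iff_of_pessimist {i : I} (hi : i ∈ P) (σ : G.Profile) (x : ℝ) :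
    (G.extremeRisk P v₀ σ i ≤ x ↔ HistoryChain.win (G.step σ) G.terminals
      {u | G.signedPayoff P i u ≤ sign P i * x} (0 ≤ sign P i * x) [] v₀ ≠ 0) ∧
    (x ≤ G.extremeRisk P v₀ σ i ↔ HistoryChain.win (G.step σ) G.terminals
      {u | G.signedPayoff P i u < sign P i * x} (0 < sign P i * x) [] v₀ = 0) := by
  have hs : sign P i = 1 := if_pos hi
  rw [extremeRisk, if_pos hi, essInf_le_iff_of_finite (G.finite_range_playPayoff i),
    le_essInf_iff_of_finite (G.finite_range_playPayoff i)]
  have h1 := measure_ne_zero_iff (v₀ := v₀) σ i (Set.Iic x)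
  have h2 := not_iff_not.2 (measure_ne_zero_iff (v₀ := v₀) σ i (Set.Iio x))
  rw [not_not, not_not] at h2
  simp only [signedPayoff, hs, one_mul]
  exact ⟨h1, h2⟩

lemma extremeRisk_iff_of_optimist {i : I} (hi : i ∉ P) (σ : G.Profile) (x : ℝ) :
    (x ≤ G.extremeRisk P v₀ σ i ↔ HistoryChain.win (G.step σ) G.terminals
      {u | G.signedPayoff P i u ≤ sign P i * x} (0 ≤ sign P i * x) [] v₀ ≠ 0) ∧
    (G.extremeRisk P v₀ σ i ≤ x ↔ HistoryChain.win (G.step σ) G.terminals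
      {u | G.signedPayoff P i u < sign P i * x} (0 < sign P i * x) [] v₀ = 0) := by
  have hs : sign P i = -1 := if_neg hi
  rw [extremeRisk, if_neg hi, essSup_le_iff_of_finite (G.finite_range_playPayoff i),
    le_essSup_iff_of_finite (G.finite_range_playPayoff i)]
  have h1 := measure_ne_zero_iff (v₀ := v₀) σ i (Set.Ici x)
  have h2 := not_iff_not.2 (measure_ne_zero_iff (v₀ := v₀) σ i (Set.Ioi x))
  rw [not_not, not_not] at h2
  simp only [signedPayoff, hs, neg_mul, one_mul, neg_le_neg_iff, neg_lt_neg_iff,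
    Left.nonneg_neg_iff, Left.neg_pos_iff]
  exact ⟨h1, h2⟩

/-- The equilibria with extreme risks `x` are the stable profiles. -/
theorem isStable_iff (x : I → ℝ) (σ : G.Profile) :
    G.IsStable P v₀ (G.signedPayoff P) (fun i => sign P i * x i) σ ↔
      G.IsXRSE P v₀ σ ∧ ∀ i, G.extremeRisk P v₀ σ i = x i := by
  constructor
  · intro h
    have hx : ∀ i, G.extremeRisk P v₀ σ i = x i := by
      intro i
      have h1 := (h i).1 (σ i) (Or.inr rfl)
      have h2 := (h i).2 (σ i) (Or.inr rfl)
      rw [deviate_eq_self] at h1 h2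
      by_cases hi : i ∈ P
      · exact le_antisymm ((extremeRisk_iff_of_pessimist hi σ _).1.2 h1)
          ((extremeRisk_iff_of_pessimist hi σ _).2.2 h2)
      · exact le_antisymm ((extremeRisk_iff_of_optimist hi σ _).2.2 h2)
          ((extremeRisk_iff_of_optimist hi σ _).1.2 h1)
    refine ⟨fun i τ => not_lt.2 ?_, hx⟩
    rw [hx]
    by_cases hi : i ∈ P
    · exact (extremeRisk_iff_of_pessimist hi _ _).1.2 ((h i).1 τ (Or.inl hi))
    · exact (extremeRisk_iff_of_optimist hi _ _).2.2 ((h i).2 τ (Or.inl hi))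
  · rintro ⟨h, hx⟩ i
    have hle : ∀ τ, G.extremeRisk P v₀ (G.deviate σ i τ) i ≤ x i := fun τ =>
      (not_lt.1 (h i τ)).trans_eq (hx i)
    by_cases hi : i ∈ P
    · refine ⟨fun τ _ => (extremeRisk_iff_of_pessimist hi _ _).1.1 (hle τ), ?_⟩
      rintro τ (hτ | rfl)
      · exact absurd hi hτ
      · rw [deviate_eq_self]
        exact (extremeRisk_iff_of_pessimist hi _ _).2.1 (hx i).ge
    · refine ⟨?_, fun τ _ => (extremeRisk_iff_of_optimist hi _ _).2.1 (hle τ)⟩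
      rintro τ (hτ | rfl)
      · exact absurd hτ hi
      · rw [deviate_eq_self]
        exact (extremeRisk_iff_of_optimist hi _ _).1.1 (hx i).ge

end Stable

/-! ### Deviations after a given history -/

section Deviations

variable {V I : Type*} {G : Game V I}

lemma step_deviate_congr (σ : G.Profile) {i : I} {τ τ' : G.Strategy i} {h : List V} {u : V}
    (hττ : ∀ hu, τ h ⟨u, hu⟩ = τ' h ⟨u, hu⟩) :
    G.step (G.deviate σ i τ) h u = G.step (G.deviate σ i τ') h u := by
  by_cases ho : G.owner u = some i
  · by_cases hu : u ∈ G.terminals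
    · rw [G.absorbs_step _ _ _ hu, G.absorbs_step _ _ _ hu]
    · rw [step_of_owner _ h ho (exists_adj hu), step_of_owner _ h ho (exists_adj hu),
        deviate_self, deviate_self, hττ]
  · rw [step_deviate_of_ne _ _ _ ho, step_deviate_of_ne _ _ _ ho]

open Classical in
/-- A player who owns the last vertex of a history can move to any successor and continue with any
strategy. -/
lemma exists_deviation [Fintype V] (σ : G.Profile) {i : I} (τ : G.Strategy i) (h : List V) {u v : V}
    (ho : G.owner u = some i) (huv : G.Adj u v) (F : Set V) (inf : Prop) :
    ∃ τ' : G.Strategy i, HistoryChain.win (G.step (G.deviate σ i τ')) G.terminals F inf h u =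
      HistoryChain.win (G.step (G.deviate σ i τ)) G.terminals F inf (h ++ [u]) v := by
  refine ⟨fun h' u' => if hc : h' = h ∧ G.Adj u' v then PMF.pure ⟨v, hc.2⟩ else τ h' u', ?_⟩
  rw [HistoryChain.win_eq (G.absorbs_step _), step_of_owner _ h ho ⟨v, huv⟩, deviate_self]
  simp only [huv, and_self, dif_pos, PMF.pure_map, PMF.avg_pure]
  refine HistoryChain.win_congr fun g w hg => step_deviate_congr σ fun hu => ?_
  rw [dif_neg]
  rintro ⟨rfl, -⟩
  have := hg.length_le
  simp at this

/-- The positional strategy given by a choice of successors. -/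
noncomputable def positional (i : I) (f : V → V) (hf : ∀ u, u ∉ G.terminals → G.Adj u (f u)) :
    G.Strategy i :=
  fun _ u => PMF.pure ⟨f u, hf u fun hu => u.2.2.elim fun v hv => hu v hv⟩

lemma conforms_positional (σ : G.Profile) (i : I) (f : V → V)
    (hf : ∀ u, u ∉ G.terminals → G.Adj u (f u)) (h : List V) (u : V) :
    G.Conforms (fun j => j = i) f (G.step (G.deviate σ i (positional i f hf))) h u := by
  refine ⟨G.absorbs_step _, fun g w _ hw => ⟨fun ho => step_of_nature _ g hw ho, fun j hj =>
    ⟨?_, fun v hv => adj_of_step hw hv⟩⟩⟩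
  rintro rfl
  rw [step_of_owner _ g hj (exists_adj hw), deviate_self, positional, PMF.pure_map]

end Deviations

/-! ### Histories in the support of a profile -/

section Support

variable {V I : Type*} (G : Game V I)

/-- `hu` is a history that occurs with positive probability under `σ`. -/
inductive Supp (v₀ : V) (σ : G.Profile) : List V → V → Prop
  | root : Supp v₀ σ [] v₀
  | step {h : List V} {u v : V} : Supp v₀ σ h u → u ∉ G.terminals → G.step σ h u v ≠ 0 →
      Supp v₀ σ (h ++ [u]) v

/-- The vertices that are reached with positive probability under `σ`. -/
def Reached (v₀ : V) (σ : G.Profile) (u : V) : Prop := ∃ h, G.Supp v₀ σ h u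

/-- The edge from `u` to `v` is used with positive probability under `σ`. -/
def Used (v₀ : V) (σ : G.Profile) (u v : V) : Prop :=
  u ∉ G.terminals ∧ ∃ h, G.Supp v₀ σ h u ∧ G.step σ h u v ≠ 0

variable {G} {v₀ : V} {σ : G.Profile}

lemma Used.reached {u v : V} (h : G.Used v₀ σ u v) : G.Reached v₀ σ v :=
  let ⟨hu, _, hg, hv⟩ := h
  ⟨_, hg.step hu hv⟩

lemma Used.adj {u v : V} (h : G.Used v₀ σ u v) : G.Adj u v :=
  let ⟨hu, _, _, hv⟩ := h
  adj_of_step hu hv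

lemma Supp.isPathFrom {h : List V} {u : V} (hu : G.Supp v₀ σ h u) :
    G.IsPathFrom v₀ (h ++ [u]) := by
  induction hu with
  | root => exact ⟨rfl, List.isChain_singleton _⟩
  | @step h u v _ hu hv ih =>
    refine ⟨?_, ?_⟩
    · rw [List.head?_append_of_ne_nil _ (by simp)]
      exact ih.1
    · refine List.IsChain.append ih.2 (List.isChain_singleton _) ?_
      intro x hx y hy
      simp at hx hy
      subst hx hy
      exact adj_of_step hu hv

/-- Under a pure profile the successor of a vertex of a player is determined by the history. -/
lemma IsPure.eq_of_step (hp : G.IsPure v₀ σ) {h : List V} {u v w : V} {i : I}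
    (hs : G.Supp v₀ σ h u) (hu : u ∉ G.terminals) (ho : G.owner u = some i)
    (hv : G.step σ h u v ≠ 0) (hw : G.step σ h u w ≠ 0) : v = w := by
  obtain ⟨a, ha⟩ := hp i h ⟨u, ho, exists_adj hu⟩ hs.isPathFrom
  have hpure : ∀ b, (σ i h ⟨u, ho, exists_adj hu⟩) b ≠ 0 → b = a := by
    intro b hb
    by_contra hne
    have hsupp := (PMF.apply_eq_one_iff _ a).1 ha
    have : b ∈ (σ i h ⟨u, ho, exists_adj hu⟩).support := (PMF.mem_support_iff _ _).2 hb
    rw [hsupp] at this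
    exact hne this
  have key : ∀ x, G.step σ h u x ≠ 0 → x = a.1 := by
    intro x hx
    rw [step_of_owner σ h ho (exists_adj hu), ← PMF.mem_support_iff,
      PMF.mem_support_map_iff] at hx
    obtain ⟨b, hb, rfl⟩ := hx
    rw [hpure b ((PMF.mem_support_iff _ _).1 hb)]
  rw [key v hv, key w hw]

end Support

/-! ### Histories at which a player is still bounded -/

section Alive

variable {V I : Type*} [Fintype V] {G : Game V I} (P : Set I) (g : I → V → ℝ) (z : I → ℝ)
  (σ : G.Profile)

/-- After the history `hu`, player `i` obtains at most `z i` with positive probability, also if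
she deviates in case that she is a pessimist. -/
def Alive (i : I) (h : List V) (u : V) : Prop :=
  ∀ τ, (i ∈ P ∨ τ = σ i) → HistoryChain.win (G.step (G.deviate σ i τ)) G.terminals
    {u | g i u ≤ z i} (0 ≤ z i) h u ≠ 0

/-- After the history `hu`, player `i` obtains at least `z i` almost surely, also if
she deviates in case that she is an optimist. -/
def Secure (i : I) (h : List V) (u : V) : Prop :=
  ∀ τ, (i ∉ P ∨ τ = σ i) → HistoryChain.win (G.step (G.deviate σ i τ)) G.terminals
    {u | g i u < z i} (0 < z i) h u = 0

variable {P g z σ}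

lemma Alive.move {i : I} {h : List V} {u v : V} (ha : Alive P g z σ i h u) (hi : i ∈ P)
    (ho : G.owner u = some i) (huv : G.Adj u v) : Alive P g z σ i (h ++ [u]) v := by
  intro τ _
  obtain ⟨τ', hτ'⟩ := exists_deviation σ τ h ho huv {u | g i u ≤ z i} (0 ≤ z i)
  rw [← hτ']
  exact ha τ' (Or.inl hi)

lemma Alive.le {i : I} {h : List V} {u : V} (ha : Alive P g z σ i h u) (hu : u ∈ G.terminals) :
    g i u ≤ z i := by
  by_contra hc
  exact ha (σ i) (Or.inr rfl) (HistoryChain.win_of_not_mem (G.absorbs_step _) hu hc h)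

lemma Secure.move {i : I} {h : List V} {u v : V} (hs : Secure P g z σ i h u) (hi : i ∉ P)
    (ho : G.owner u = some i) (huv : G.Adj u v) : Secure P g z σ i (h ++ [u]) v := by
  intro τ _
  obtain ⟨τ', hτ'⟩ := exists_deviation σ τ h ho huv {u | g i u < z i} (0 < z i)
  rw [← hτ']
  exact hs τ' (Or.inl hi)

lemma Secure.step {i : I} {h : List V} {u v : V} (hs : Secure P g z σ i h u)
    (hu : u ∉ G.terminals) (hv : G.step σ h u v ≠ 0) : Secure P g z σ i (h ++ [u]) v := by
  by_cases hc : i ∉ P ∧ G.owner u = some i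
  · exact hs.move hc.1 hc.2 (adj_of_step hu hv)
  intro τ hτ
  refine HistoryChain.win_child_eq_zero (G.absorbs_step _) (hs τ hτ) ?_
  by_cases ho : G.owner u = some i
  · rcases hτ with hi | rfl
    · exact absurd ⟨hi, ho⟩ hc
    · rwa [deviate_eq_self]
  · rwa [step_deviate_of_ne _ _ _ ho]

lemma Secure.le {i : I} {h : List V} {u : V} (hs : Secure P g z σ i h u) (hu : u ∈ G.terminals) :
    z i ≤ g i u := by
  by_contra hc
  have := hs (σ i) (Or.inr rfl)
  rw [HistoryChain.win_of_mem (G.absorbs_step _) hu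
    (show u ∈ {u | g i u < z i} from not_le.1 hc)] at this
  exact one_ne_zero this

lemma secure_of_supp {v₀ : V} (hσ : G.IsStable P v₀ g z σ) {h : List V} {u : V}
    (hs : G.Supp v₀ σ h u) (i : I) : Secure P g z σ i h u := by
  induction hs with
  | root => exact (hσ i).2
  | step _ hu hv ih => exact ih.step hu hv

/-- If some player requires a positive payoff, then the play terminates almost surely. -/
lemma reach_terminals_eq_one {v₀ : V} (hσ : G.IsStable P v₀ g z σ) {i : I} (hi : 0 < z i)
    {h : List V} {u : V} (hs : G.Supp v₀ σ h u) :
    HistoryChain.reach (G.step σ) G.terminals h u = 1 := by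
  have h1 := secure_of_supp hσ hs i (σ i) (Or.inr rfl)
  rw [deviate_eq_self, HistoryChain.win_of_inf hi, sub_eq_zero] at h1
  refine le_antisymm (HistoryChain.reach_le_one h u) (h1.trans_le ?_)
  refine HistoryChain.reach_le fun n => le_trans ?_ (HistoryChain.hit_le_reach n h u)
  exact HistoryChain.hit_mono Set.sdiff_subset n h u

/-- In a vertex outside the region of the coalition against the pessimist `i`, player `i` would win
by a positional strategy. -/
lemma Alive.mem_region {i : I} {B : Set V} {f : V → V} {ε : ℝ}
    (hB : G.IsRegion (fun j => j ≠ i) {u | g i u ≤ z i} (0 ≤ z i) B f ε) (hi : i ∈ P)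
    {h : List V} {u : V} (ha : Alive P g z σ i h u) : u ∈ B := by
  by_contra hu
  refine ha (positional i f hB.adj) (Or.inl hi) (hB.win_of_not_mem hu ?_)
  have := conforms_positional σ i f hB.adj h u
  simpa only [ne_eq, not_not] using this

lemma Secure.not_mem_region {i : I} {B : Set V} {f : V → V} {ε : ℝ}
    (hB : G.IsRegion (fun j => j = i) {u | g i u < z i} (0 < z i) B f ε) (hi : i ∉ P)
    {h : List V} {u : V} (hs : Secure P g z σ i h u) : u ∉ B := by
  intro hu
  have h1 := hB.win_of_mem hu (conforms_positional σ i f hB.adj h u)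
  have h2 := hs (positional i f hB.adj) (Or.inl hi)
  linarith [hB.pos]

open Classical in
/-- Switching strategies: player `i` follows `κ` after the history `h₀u₀` until a history is
reached at which she is no longer bounded, and then plays a strategy by which she almost surely
exceeds the bound.  The predicate `C` collects the histories at which she has not switched. -/
lemma exists_switch {i : I} {h₀ : List V} {u₀ : V} (ha : Alive P g z σ i h₀ u₀)
    {κ : G.Strategy i} (hκ : i ∈ P ∨ κ = σ i) :
    ∃ (τ : G.Strategy i) (C : List V → V → Prop), (i ∈ P ∨ τ = σ i) ∧ C h₀ u₀ ∧
      (∀ h u, C h u → G.step (G.deviate σ i τ) h u = G.step (G.deviate σ i κ) h u) ∧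
      (∀ h u v, C h u → Alive P g z σ i (h ++ [u]) v → C (h ++ [u]) v) ∧
      ∀ h u v, C h u → ¬ Alive P g z σ i (h ++ [u]) v →
        HistoryChain.win (G.step (G.deviate σ i τ)) G.terminals {u | g i u ≤ z i} (0 ≤ z i)
          (h ++ [u]) v = 0 := by
  set k := h₀.length
  set Bad : List V → Prop := fun L => ∃ h u, L = h ++ [u] ∧ ¬ Alive P g z σ i h u
  have hTB : ∀ L, ∃ τ : G.Strategy i, (i ∈ P ∨ τ = σ i) ∧ ∀ h u, L = h ++ [u] →
      ¬ Alive P g z σ i h u → HistoryChain.win (G.step (G.deviate σ i τ)) G.terminals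
        {u | g i u ≤ z i} (0 ≤ z i) h u = 0 := by
    intro L
    by_cases hL : Bad L
    · obtain ⟨h, u, rfl, hu⟩ := hL
      have hu' := hu
      simp only [Alive, not_forall, not_not] at hu
      obtain ⟨τ, hτ, h0⟩ := hu
      refine ⟨τ, hτ, fun h' u' he _ => ?_⟩
      obtain ⟨rfl, he⟩ := List.append_inj' he rfl
      obtain rfl : u = u' := by simpa using he
      exact h0
    · exact ⟨κ, hκ, fun h u he hu => absurd ⟨h, u, he, hu⟩ hL⟩
  choose TB hTB1 hTB2 using hTB
  -- The prefix of `L` of length `n` is longer than `h₀u₀`, and player `i` is not bounded after it.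
  set H : List V → ℕ → Prop := fun L n => k < n ∧ n ≤ L.length ∧ Bad (L.take n)
  set τ : G.Strategy i := fun h u => if hH : ∃ n, H (h ++ [u.1]) n
    then TB ((h ++ [u.1]).take (Nat.find hH)) h u else κ h u with hτ
  have hCs : ∀ h u v, (∀ n, ¬ H (h ++ [u]) n) → ∀ m ≤ (h ++ [u]).length,
      ¬ H ((h ++ [u]) ++ [v]) m := by
    rintro h u v hC m hm ⟨h1, h2, h3⟩
    rw [List.take_append_of_le_length hm] at h3
    exact hC m ⟨h1, hm, h3⟩
  refine ⟨τ, fun h u => k ≤ h.length ∧ ∀ n, ¬ H (h ++ [u]) n, ?_, ⟨le_rfl, ?_⟩, ?_, ?_, ?_⟩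
  · by_cases hi : i ∈ P
    · exact Or.inl hi
    · refine Or.inr (funext fun h => funext fun u => ?_)
      simp only [hτ]
      split_ifs
      · rw [(hTB1 _).resolve_left hi]
      · rw [hκ.resolve_left hi]
  · rintro n ⟨h1, h2, h, u, h3, h4⟩
    have : n = (h₀ ++ [u₀]).length := by
      simp only [List.length_append, List.length_singleton] at h2 ⊢
      omega
    rw [this, List.take_length] at h3
    obtain ⟨rfl, he⟩ := List.append_inj' h3 rfl
    obtain rfl : u₀ = u := by simpa using he
    exact h4 ha
  · intro h u hC
    refine step_deviate_congr σ fun hu => ?_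
    simp only [hτ]
    rw [dif_neg]
    rintro ⟨n, hn⟩
    exact hC.2 n hn
  · intro h u v hC hv
    refine ⟨by simp only [List.length_append]; omega, fun n hn => ?_⟩
    by_cases hle : n ≤ (h ++ [u]).length
    · exact hCs h u v hC.2 n hle hn
    · obtain ⟨h1, h2, h', u', h3, h4⟩ := hn
      have : n = (h ++ [u] ++ [v]).length := by
        simp only [List.length_append, List.length_singleton] at hle h2 ⊢
        omega
      rw [this, List.take_length] at h3
      obtain ⟨rfl, he⟩ := List.append_inj' h3 rfl
      obtain rfl : v = u' := by simpa using he
      exact h4 hv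
  · intro h u v hC hv
    refine Eq.trans ?_ (hTB2 _ _ _ rfl hv)
    refine HistoryChain.win_congr fun g' w hg => step_deviate_congr σ fun hu => ?_
    have hlen : (h ++ [u] ++ [v]).length = (h ++ [u]).length + 1 := by simp
    have htake : (g' ++ [w]).take (h ++ [u] ++ [v]).length = h ++ [u] ++ [v] :=
      (List.prefix_iff_eq_take.1 hg).symm
    have hH : H (g' ++ [w]) (h ++ [u] ++ [v]).length :=
      ⟨by simp only [List.length_append, List.length_singleton]; omega, hg.length_le,
        _, v, htake, hv⟩
    have hex : ∃ n, H (g' ++ [w]) n := ⟨_, hH⟩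
    have hfind : Nat.find hex = (h ++ [u] ++ [v]).length := by
      rw [Nat.find_eq_iff]
      refine ⟨hH, fun m hm hmH => hCs h u v hC.2 m (by omega) ⟨hmH.1, by omega, ?_⟩⟩
      have h3 := hmH.2.2
      rwa [← htake, List.take_take, min_eq_left hm.le]
    simp only [hτ]
    rw [dif_pos hex, hfind, htake]

lemma Alive.exists_child {i : I} {h : List V} {u : V} (ha : Alive P g z σ i h u) :
    ∃ v, G.step σ h u v ≠ 0 ∧ Alive P g z σ i (h ++ [u]) v := by
  obtain ⟨τ, C, hτ, hC, h1, -, h3⟩ := exists_switch ha (κ := σ i) (Or.inr rfl)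
  by_contra! hcon
  refine ha τ hτ (HistoryChain.win_eq_zero_of_children (G.absorbs_step _) fun v hv => ?_)
  rw [h1 h u hC, deviate_eq_self] at hv
  exact h3 h u v hC (hcon v hv)

end Alive

/-! ### Vertices where play may go on forever -/

section Safe

variable {V I : Type*} (G : Game V I) (P : Set I) (g : I → V → ℝ) (z : I → ℝ) (v₀ : V)
  (σ : G.Profile) (B : I → Set V)

/-- The local condition for the vertices in `D` to be harmless for the players in `J`: a terminal
vertex keeps these players bounded, and at any other vertex play may go on forever inside `D` along
used edges, while every deviation of a pessimist in `J` leads into the region `B i` where she can be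
punished. -/
def SafeStep (J : Finset I) (D : Set V) (u : V) : Prop :=
  G.Reached v₀ σ u ∧ (u ∈ G.terminals → ∀ j ∈ J, g j u ≤ z j) ∧
    (u ∉ G.terminals → (∀ i, z i ≤ 0) ∧ (∀ j ∈ J, 0 ≤ z j) ∧
      (G.owner u = none → ∀ v, G.nature u v ≠ 0 → v ∈ D) ∧
      ∀ i, G.owner u = some i → (∃ v ∈ D, G.Used v₀ σ u v) ∧
        (i ∈ P → i ∈ J → ∀ v, G.Adj u v → v ∈ B i))

variable {G P g z v₀ σ B} in
lemma SafeStep.mono {J : Finset I} {D D' : Set V} (hD : D ⊆ D') {u : V}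
    (h : SafeStep G P g z v₀ σ B J D u) : SafeStep G P g z v₀ σ B J D' u := by
  refine ⟨h.1, h.2.1, fun hu => ?_⟩
  obtain ⟨h1, h2, h3, h4⟩ := h.2.2 hu
  exact ⟨h1, h2, fun ho v hv => hD (h3 ho v hv), fun i hi =>
    ⟨let ⟨v, hv, hv'⟩ := (h4 i hi).1; ⟨v, hD hv, hv'⟩, (h4 i hi).2⟩⟩

/-- The monotone operator whose least fixed point is the complement of the safe set. -/
def safeComplHom (J : Finset I) : Set V →o Set V :=
  ⟨fun S => {u | ¬ SafeStep G P g z v₀ σ B J Sᶜ u}, fun _ _ hS _ hu hu' =>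
    hu (hu'.mono (Set.compl_subset_compl.2 hS))⟩

/-- The greatest set of vertices with the local condition `SafeStep`. -/
def safe (J : Finset I) : Set V := (safeComplHom G P g z v₀ σ B J).lfpᶜ

variable {G P g z v₀ σ B} {J : Finset I}

lemma safeStep_of_mem_safe {u : V} (hu : u ∈ safe G P g z v₀ σ B J) :
    SafeStep G P g z v₀ σ B J (safe G P g z v₀ σ B J) u := by
  by_contra hc
  exact hu ((safeComplHom G P g z v₀ σ B J).map_lfp.subset hc)

lemma subset_safe {D : Set V} (hD : ∀ u ∈ D, SafeStep G P g z v₀ σ B J D u) :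
    D ⊆ safe G P g z v₀ σ B J := by
  intro u hu hu'
  have : (safeComplHom G P g z v₀ σ B J).lfp ≤ Dᶜ := by
    refine OrderHom.lfp_le _ fun w hw hwD => hw ?_
    rw [compl_compl]
    exact hD w hwD
  exact this hu' hu

end Safe

/-! ### Players that cannot be separated -/

section Trap

variable {V I : Type*} [Fintype V] {G : Game V I} (P : Set I) (g : I → V → ℝ) (z : I → ℝ) (v₀ : V)
  (σ : G.Profile)

/-- The history `hu` has positive probability under `σ`, and all players in `J` are still
bounded. -/
def JointlyAlive (J : Finset I) (h : List V) (u : V) : Prop :=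
  G.Supp v₀ σ h u ∧ ∀ j ∈ J, Alive P g z σ j h u

/-- A trap is a set of histories, closed under `σ` as long as the players in `J` are
bounded, in which these players can only be bounded together, and in which no safe
vertex is visited. -/
structure IsTrap (B : I → Set V) (J : Finset I) (Tr : List V → V → Prop) : Prop where
  jointlyAlive : ∀ {h u}, Tr h u → JointlyAlive P g z v₀ σ J h u
  not_terminal : ∀ {h u}, Tr h u → u ∉ G.terminals
  not_safe : ∀ {h u}, Tr h u → u ∉ safe G P g z v₀ σ B J
  child : ∀ {h u v}, Tr h u → G.step σ h u v ≠ 0 → (∀ j ∈ J, Alive P g z σ j (h ++ [u]) v) →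
    Tr (h ++ [u]) v
  child_of_alive : ∀ {h u v j}, Tr h u → G.step σ h u v ≠ 0 → j ∈ J →
    ¬ (j ∈ P ∧ G.owner u = some j) → Alive P g z σ j (h ++ [u]) v → Tr (h ++ [u]) v
  exists_child : ∀ {h u}, Tr h u → ∃ v, G.step σ h u v ≠ 0 ∧ Tr (h ++ [u]) v
  unique : ∀ {h u v w j k}, Tr h u → j ∈ J → k ∈ J → j ≠ k → G.owner u ≠ some j →
    G.owner u ≠ some k → G.step σ h u v ≠ 0 → G.step σ h u w ≠ 0 → Tr (h ++ [u]) v →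
    Tr (h ++ [u]) w → v = w

variable {P g z v₀ σ} {B : I → Set V} {J : Finset I} {Tr : List V → V → Prop}

/-- A strategy `κ` of a player `j ∈ J` that keeps the play in the trap at the vertices of `j`, and
that is combined with the strategies that punish for leaving the trap. -/
lemma IsTrap.exists_switch (ht : IsTrap P g z v₀ σ B J Tr) {j : I} (hj : j ∈ J) {κ : G.Strategy j}
    (hκ : j ∈ P ∨ κ = σ j) (hmove : ∀ h u v, Tr h u → G.owner u = some j → j ∈ P →
      G.step (G.deviate σ j κ) h u v ≠ 0 → G.step σ h u v ≠ 0 ∧ Tr (h ++ [u]) v)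
    {h₀ : List V} {u₀ : V} (h0 : Tr h₀ u₀) :
    ∃ (τ : G.Strategy j) (Γ : List V → V → Prop), (j ∈ P ∨ τ = σ j) ∧ Γ h₀ u₀ ∧
      (∀ h u, Γ h u → Tr h u) ∧
      (∀ h u, Γ h u → G.step (G.deviate σ j τ) h u = G.step (G.deviate σ j κ) h u) ∧
      (∀ h u v, Γ h u → G.step (G.deviate σ j τ) h u v ≠ 0 → G.step σ h u v ≠ 0) ∧
      (∀ h u v, Γ h u → Tr (h ++ [u]) v → Γ (h ++ [u]) v) ∧
      ∀ h u v, Γ h u → G.step (G.deviate σ j τ) h u v ≠ 0 →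
        HistoryChain.win (G.step (G.deviate σ j τ)) G.terminals {u | g j u ≤ z j} (0 ≤ z j)
          (h ++ [u]) v = 0 ∨ Γ (h ++ [u]) v := by
  obtain ⟨τ, C, hτ, hC, h1, h2, h3⟩ := Game.exists_switch ((ht.jointlyAlive h0).2 j hj) hκ
  have hstep : ∀ h u v, Tr h u → G.step (G.deviate σ j κ) h u v ≠ 0 →
      G.step σ h u v ≠ 0 ∧ (Alive P g z σ j (h ++ [u]) v → Tr (h ++ [u]) v) := by
    intro h u v hTr hv
    by_cases hc : j ∈ P ∧ G.owner u = some j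
    · obtain ⟨ha, hb⟩ := hmove h u v hTr hc.2 hc.1 hv
      exact ⟨ha, fun _ => hb⟩
    · have hv' : G.step σ h u v ≠ 0 := by
        by_cases ho : G.owner u = some j
        · rcases hκ with hjP | rfl
          · exact absurd ⟨hjP, ho⟩ hc
          · rwa [deviate_eq_self] at hv
        · rwa [step_deviate_of_ne _ _ _ ho] at hv
      exact ⟨hv', ht.child_of_alive hTr hv' hj hc⟩
  refine ⟨τ, fun h u => Tr h u ∧ C h u, hτ, ⟨h0, hC⟩, fun h u hΓ => hΓ.1, fun h u hΓ => h1 h u hΓ.2,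
    fun h u v hΓ hv => (hstep h u v hΓ.1 (by rwa [← h1 h u hΓ.2])).1,
    fun h u v hΓ hv => ⟨hv, h2 h u v hΓ.2 ((ht.jointlyAlive hv).2 j hj)⟩, fun h u v hΓ hv => ?_⟩
  by_cases ha : Alive P g z σ j (h ++ [u]) v
  · exact Or.inr ⟨(hstep h u v hΓ.1 (by rwa [← h1 h u hΓ.2])).2 ha, h2 h u v hΓ.2 ha⟩
  · exact Or.inl (h3 h u v hΓ.2 ha)

/-- A pure strategy of player `j` that selects successors with the property `R` wherever
possible. -/
lemma exists_selection (j : I) (R : List V → V → V → Prop) :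
    ∃ κ : G.Strategy j, ∀ h u, G.owner u = some j → (∃ v, R h u v ∧ G.Adj u v) →
      ∃ v, R h u v ∧ G.step (G.deviate σ j κ) h u = PMF.pure v := by
  classical
  refine ⟨fun h u => if hv : ∃ v, R h u v ∧ G.Adj u v then PMF.pure ⟨hv.choose, hv.choose_spec.2⟩
    else PMF.pure ⟨u.2.2.choose, u.2.2.choose_spec⟩, fun h u ho hv => ⟨hv.choose,
      hv.choose_spec.1, ?_⟩⟩
  rw [step_of_owner _ h ho ⟨_, hv.choose_spec.2⟩, deviate_self]
  simp only [dif_pos hv, PMF.pure_map]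

lemma IsTrap.exists_stay (ht : IsTrap P g z v₀ σ B J Tr) (j : I) :
    ∃ κ : G.Strategy j, (j ∈ P ∨ κ = σ j) ∧ ∀ h u v, Tr h u → G.owner u = some j → j ∈ P →
      G.step (G.deviate σ j κ) h u v ≠ 0 → G.step σ h u v ≠ 0 ∧ Tr (h ++ [u]) v := by
  by_cases hj : j ∈ P
  · obtain ⟨κ, hκ⟩ := exists_selection (σ := σ) j fun h u v => G.step σ h u v ≠ 0 ∧ Tr (h ++ [u]) v
    refine ⟨κ, Or.inl hj, fun h u v hTr ho _ hv => ?_⟩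
    obtain ⟨w, hw, hw'⟩ := ht.exists_child hTr
    obtain ⟨v', h1, h2⟩ := hκ h u ho ⟨w, ⟨hw, hw'⟩, adj_of_step (ht.not_terminal hTr) hw⟩
    rw [h2, PMF.pure_apply] at hv
    obtain rfl : v = v' := by simpa using hv
    exact h1
  · exact ⟨σ j, Or.inr rfl, fun _ _ _ _ _ h => absurd h hj⟩

/-- If `z j < 0`, then player `j` could exceed her bound by staying in the trap forever. -/
lemma IsTrap.nonneg (ht : IsTrap P g z v₀ σ B J Tr) {j : I} (hj : j ∈ J) {h₀ : List V} {u₀ : V}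
    (h0 : Tr h₀ u₀) : 0 ≤ z j := by
  by_contra hz
  obtain ⟨κ, hκ, hmove⟩ := ht.exists_stay j
  obtain ⟨τ, Γ, hτ, hΓ0, hΓ, -, -, -, h4⟩ := ht.exists_switch hj hκ hmove h0
  exact (ht.jointlyAlive h0).2 j hj τ hτ (HistoryChain.win_zero_of_rank (G.absorbs_step _) one_pos
    le_rfl (N := 0) (b := fun _ _ => 0) (fun h => absurd h hz)
    (fun h u hu => Or.inr
      ⟨ht.not_terminal (hΓ h u hu), fun v => h4 h u v hu, fun h => absurd h hz⟩) hΓ0)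

/-- If no player requires a positive payoff, then a player in `J` can leave the trap, since its
vertices are not safe. -/
lemma IsTrap.exists_pos [Nonempty V] (ht : IsTrap P g z v₀ σ B J Tr) (hB : ∀ i ∈ P, ∃ f ε,
      G.IsRegion (fun j => j ≠ i) {u | g i u ≤ z i} (0 ≤ z i) (B i) f ε)
    {j : I} (hj : j ∈ J) {h₀ : List V} {u₀ : V}
    (h0 : Tr h₀ u₀) : ∃ i, 0 < z i := by
  by_contra! hz
  obtain ⟨κ, hκ, hmove⟩ := ht.exists_stay j
  obtain ⟨τ, Γ, hτ, hΓ0, hΓ, -, h2, -, h4⟩ := ht.exists_switch hj hκ hmove h0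
  obtain ⟨δ, hδ, hδ1, hδc, hδn⟩ := G.exists_min_prob
  obtain ⟨r, hr, -⟩ := OrderHom.exists_rank (safeComplHom G P g z v₀ σ B J)
  obtain ⟨N, hN⟩ := Finite.exists_nat_bound r
  refine (ht.jointlyAlive h0).2 j hj τ hτ (HistoryChain.win_zero_of_rank (G.absorbs_step _) hδ hδ1
    (b := fun _ u => r u) (fun _ _ u _ => hN u) (fun h u hu => Or.inr
      ⟨ht.not_terminal (hΓ h u hu), fun v => h4 h u v hu, fun _ => ?_⟩) hΓ0)
  have hTr := hΓ h u hu
  have hal := ht.jointlyAlive hTr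
  have huT := ht.not_terminal hTr
  have huS : u ∈ (safeComplHom G P g z v₀ σ B J).lfp := not_not.1 (ht.not_safe hTr)
  have hstep := hr u huS
  by_contra! hcon
  have hcon' : ∀ v, δ ≤ (G.step (G.deviate σ j τ) h u v).toReal →
      v ∈ {v | v ∈ (safeComplHom G P g z v₀ σ B J).lfp ∧ r v < r u}ᶜ := by
    rintro v hv ⟨-, hlt⟩
    exact (hcon v hv).2.not_gt hlt
  refine hstep ⟨⟨h, hal.1⟩, fun hu' => absurd hu' huT, fun _ =>
    ⟨hz, fun k hk => ht.nonneg hk h0, fun ho v hv => hcon' v ?_, fun i ho => ⟨?_, ?_⟩⟩⟩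
  · rw [step_of_nature _ h huT ho]
    exact hδn u v hv
  · obtain ⟨v, hv⟩ := PMF.exists_card_inv_le (G.step (G.deviate σ j τ) h u)
    have hv := hδc.trans hv
    exact ⟨v, hcon' v hv, huT, h, hal.1, h2 h u v hu (PMF.ne_zero_of_le hδ hv)⟩
  · intro hi hiJ v hv
    obtain ⟨f, ε, hBi⟩ := hB i hi
    exact ((hal.2 i hiJ).move hi ho hv).mem_region hBi hi

/-- Let `j ∈ J` be an optimist, or the only player in `J`.  If play ends almost surely under `σ`,
then `j` can exceed her bound in a trap: she follows `σ` as long as she is bounded, and no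
terminal vertex lies in the trap. -/
lemma IsTrap.false_of_sigma (ht : IsTrap P g z v₀ σ B J Tr) (hσ : G.IsStable P v₀ g z σ) {i : I}
    (hi : 0 < z i) {j : I} (hj : j ∈ J) (hjJ : j ∈ P → ∀ k ∈ J, k = j) {h₀ : List V} {u₀ : V}
    (h0 : Tr h₀ u₀) : False := by
  have hz := ht.nonneg hj h0
  obtain ⟨τ, Γ, hτ, hΓ0, hΓ, h1, -, -, h4⟩ := ht.exists_switch hj (κ := σ j) (Or.inr rfl) (by
    intro h u v hTr ho hjP hv
    rw [deviate_eq_self] at hv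
    refine ⟨hv, ht.child hTr hv fun k hk => ?_⟩
    rw [hjJ hjP k hk]
    exact ((ht.jointlyAlive hTr).2 j hj).move hjP ho (adj_of_step (ht.not_terminal hTr) hv)) h0
  simp only [deviate_eq_self] at h1
  have key : ∀ n h u, Γ h u → HistoryChain.hit (G.step σ) G.terminals n h u ≤
      1 - HistoryChain.win (G.step (G.deviate σ j τ)) G.terminals {u | g j u ≤ z j} (0 ≤ z j)
        h u := by
    intro n
    induction n with
    | zero =>
      intro h u hu
      rw [HistoryChain.hit, if_neg (ht.not_terminal (hΓ h u hu))]
      exact sub_nonneg.2 (HistoryChain.win_le_one _ _)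
    | succ n ih =>
      intro h u hu
      rw [HistoryChain.win_eq (G.absorbs_step _), ← PMF.avg_one_sub, h1 h u hu]
      refine PMF.avg_mono _ fun v hv => ?_
      rcases h4 h u v hu (by rwa [h1 h u hu]) with h0 | hv'
      · rw [h0, sub_zero]
        exact HistoryChain.hit_le_one _ _ _
      · exact ih _ _ hv'
  refine (ht.jointlyAlive h0).2 j hj τ hτ (le_antisymm ?_ (HistoryChain.win_nonneg _ _))
  have := HistoryChain.reach_le fun n => key n h₀ u₀ hΓ0
  rw [reach_terminals_eq_one hσ hi (ht.jointlyAlive h0).1] at this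
  linarith

end Trap

/-! ### The probability of staying in a trap -/

section Stay

variable {V I : Type*} [Fintype V] (G : Game V I) (σ : G.Profile) (Tr : List V → V → Prop) (j : I)

open Classical in
/-- The least probability to stay in `Tr` for `n` steps under `σ`, if player `j` minimizes it by her
choice among the successors in the support of `σ` and in `Tr`. -/
noncomputable def stay : ℕ → List V → V → ℝ
  | 0, h, u => if Tr h u then 1 else 0
  | n + 1, h, u => if Tr h u then
      if G.owner u = some j then
        Finset.univ.inf' ⟨u, Finset.mem_univ u⟩ fun v =>
          if G.step σ h u v ≠ 0 ∧ Tr (h ++ [u]) v then stay n (h ++ [u]) v else 1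
      else (G.step σ h u).avg fun v => stay n (h ++ [u]) v
    else 0

variable {G σ Tr j}

lemma stay_of_not {h : List V} {u : V} (hu : ¬ Tr h u) (n : ℕ) : stay G σ Tr j n h u = 0 := by
  cases n <;> simp [stay, hu]

lemma stay_succ_of_ne {h : List V} {u : V} (hu : Tr h u) (ho : G.owner u ≠ some j) (n : ℕ) :
    stay G σ Tr j (n + 1) h u = (G.step σ h u).avg fun v => stay G σ Tr j n (h ++ [u]) v := by
  rw [stay, if_pos hu, if_neg ho]

lemma stay_mem_Icc (n : ℕ) (h : List V) (u : V) : stay G σ Tr j n h u ∈ Set.Icc (0 : ℝ) 1 := by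
  induction n generalizing h u with
  | zero => rw [stay]; split_ifs <;> simp
  | succ n ih =>
    rw [stay]
    split_ifs
    · refine ⟨Finset.le_inf' _ _ fun v _ => ?_, (Finset.inf'_le _ (Finset.mem_univ u)).trans ?_⟩
      · split_ifs
        exacts [(ih _ _).1, zero_le_one]
      · split_ifs
        exacts [(ih _ _).2, le_rfl]
    · exact ⟨PMF.avg_nonneg _ fun v => (ih _ _).1, PMF.avg_le _ fun v _ => (ih _ _).2⟩
    · simp

lemma stay_succ_le_child {h : List V} {u v : V} (hu : Tr h u) (ho : G.owner u = some j)
    (hv : G.step σ h u v ≠ 0) (hv' : Tr (h ++ [u]) v) (n : ℕ) :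
    stay G σ Tr j (n + 1) h u ≤ stay G σ Tr j n (h ++ [u]) v := by
  rw [stay, if_pos hu, if_pos ho]
  refine (Finset.inf'_le _ (Finset.mem_univ v)).trans ?_
  rw [if_pos ⟨hv, hv'⟩]

lemma exists_child_le_stay {h : List V} {u : V} (hu : Tr h u) (ho : G.owner u = some j)
    (hex : ∃ v, G.step σ h u v ≠ 0 ∧ Tr (h ++ [u]) v) (n : ℕ) :
    ∃ v, (G.step σ h u v ≠ 0 ∧ Tr (h ++ [u]) v) ∧
      stay G σ Tr j n (h ++ [u]) v ≤ stay G σ Tr j (n + 1) h u := by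
  classical
  rw [stay, if_pos hu, if_pos ho]
  obtain ⟨v, -, hv⟩ := Finset.exists_mem_eq_inf' (s := Finset.univ) ⟨u, Finset.mem_univ u⟩ fun v =>
    if G.step σ h u v ≠ 0 ∧ Tr (h ++ [u]) v then stay G σ Tr j n (h ++ [u]) v else 1
  rw [hv]
  by_cases hc : G.step σ h u v ≠ 0 ∧ Tr (h ++ [u]) v
  · exact ⟨v, hc, by rw [if_pos hc]⟩
  · obtain ⟨w, hw⟩ := hex
    exact ⟨w, hw, by rw [if_neg hc]; exact (stay_mem_Icc _ _ _).2⟩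

lemma stay_succ_le (n : ℕ) (h : List V) (u : V) :
    stay G σ Tr j (n + 1) h u ≤ stay G σ Tr j n h u := by
  induction n generalizing h u with
  | zero =>
    by_cases hu : Tr h u
    · rw [show stay G σ Tr j 0 h u = 1 from if_pos hu]
      exact (stay_mem_Icc _ _ _).2
    · rw [stay_of_not hu, stay_of_not hu]
  | succ n ih =>
    by_cases hu : Tr h u
    · rw [stay, stay, if_pos hu, if_pos hu]
      split_ifs
      · refine Finset.inf'_mono_fun fun v _ => ?_
        split_ifs
        exacts [ih _ _, le_rfl]
      · exact PMF.avg_mono _ fun v _ => ih _ _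
    · rw [stay_of_not hu, stay_of_not hu]

variable (G σ Tr j) in
/-- The least probability to stay in `Tr` forever, if player `j` minimizes it. -/
noncomputable def stayForever (h : List V) (u : V) : ℝ := ⨅ n, stay G σ Tr j n h u

lemma bddBelow_stay (h : List V) (u : V) :
    BddBelow (Set.range fun n => stay G σ Tr j n h u) :=
  ⟨0, by rintro _ ⟨n, rfl⟩; exact (stay_mem_Icc _ _ _).1⟩

lemma tendsto_stay (h : List V) (u : V) :
    Filter.Tendsto (fun n => stay G σ Tr j n h u) Filter.atTop (nhds (stayForever G σ Tr j h u)) :=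
  tendsto_atTop_ciInf (antitone_nat_of_succ_le fun n => stay_succ_le n h u) (bddBelow_stay h u)

lemma stayForever_nonneg (h : List V) (u : V) : 0 ≤ stayForever G σ Tr j h u :=
  le_ciInf fun _ => (stay_mem_Icc _ _ _).1

lemma stayForever_le_one (h : List V) (u : V) : stayForever G σ Tr j h u ≤ 1 :=
  (ciInf_le (bddBelow_stay h u) 0).trans (stay_mem_Icc _ _ _).2

lemma stayForever_of_not {h : List V} {u : V} (hu : ¬ Tr h u) : stayForever G σ Tr j h u = 0 := by
  simp [stayForever, stay_of_not hu]

lemma stayForever_eq_avg {h : List V} {u : V} (hu : Tr h u) (ho : G.owner u ≠ some j) :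
    stayForever G σ Tr j h u =
      (G.step σ h u).avg fun v => stayForever G σ Tr j (h ++ [u]) v := by
  refine tendsto_nhds_unique ((tendsto_stay h u).comp (Filter.tendsto_add_atTop_nat 1)) ?_
  simp only [Function.comp_def, stay_succ_of_ne hu ho]
  exact PMF.tendsto_avg _ fun v => tendsto_stay _ v

lemma stayForever_le_child {h : List V} {u v : V} (hu : Tr h u) (ho : G.owner u = some j)
    (hv : G.step σ h u v ≠ 0) (hv' : Tr (h ++ [u]) v) :
    stayForever G σ Tr j h u ≤ stayForever G σ Tr j (h ++ [u]) v :=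
  le_ciInf fun n => (ciInf_le (bddBelow_stay h u) (n + 1)).trans (stay_succ_le_child hu ho hv hv' n)

/-- The distribution of `σ` at `u`, reweighted by the probability to stay in `Tr` forever; if this
probability is zero, then any successor in `Tr` is taken. -/
lemma exists_reweight (σ : G.Profile) (Tr : List V → V → Prop) (j k : I) :
    ∃ κ : G.Strategy k, ∀ h u, G.owner u = some k → u ∉ G.terminals → Tr h u →
      G.owner u ≠ some j → (∃ v, G.step σ h u v ≠ 0 ∧ Tr (h ++ [u]) v) →
      (∀ v, G.step (G.deviate σ k κ) h u v ≠ 0 → G.step σ h u v ≠ 0 ∧ Tr (h ++ [u]) v) ∧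
      ∀ f : V → ℝ, stayForever G σ Tr j h u * (G.step (G.deviate σ k κ) h u).avg f =
        (G.step σ h u).avg fun v => stayForever G σ Tr j (h ++ [u]) v * f v := by
  have hloc : ∀ h (u : G.DecisionVertex k), ∃ μ : PMF {v : V // G.Adj u.1 v},
      Tr h u.1 → G.owner u.1 ≠ some j → (∃ v, G.step σ h u.1 v ≠ 0 ∧ Tr (h ++ [u.1]) v) →
      (∀ v, μ.map Subtype.val v ≠ 0 → G.step σ h u.1 v ≠ 0 ∧ Tr (h ++ [u.1]) v) ∧
      ∀ f : V → ℝ, stayForever G σ Tr j h u.1 * (μ.map Subtype.val).avg f =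
        (G.step σ h u.1).avg fun v => stayForever G σ Tr j (h ++ [u.1]) v * f v := by
    rintro h ⟨u, ho, hu⟩
    have huT : u ∉ G.terminals := fun ht => hu.elim ht
    by_cases hc : Tr h u ∧ G.owner u ≠ some j ∧ ∃ v, G.step σ h u v ≠ 0 ∧ Tr (h ++ [u]) v
    swap
    · exact ⟨PMF.pure ⟨hu.choose, hu.choose_spec⟩, fun h1 h2 h3 => absurd ⟨h1, h2, h3⟩ hc⟩
    obtain ⟨h1, h2, v₁, h3, h4⟩ := hc
    have heq := stayForever_eq_avg (σ := σ) h1 h2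
    by_cases h0 : stayForever G σ Tr j h u = 0
    · refine ⟨PMF.pure ⟨v₁, adj_of_step huT h3⟩, fun _ _ _ => ⟨fun v hv => ?_, fun f => ?_⟩⟩
      · rw [PMF.pure_map, PMF.pure_apply] at hv
        obtain rfl : v = v₁ := by simpa using hv
        exact ⟨h3, h4⟩
      · rw [h0] at heq
        have hz := (PMF.avg_eq_zero_iff _ fun v => stayForever_nonneg _ _).1 heq.symm
        simp only [h0, zero_mul]
        refine Eq.symm (Eq.trans (PMF.avg_congr _ (g := fun _ => 0) fun v hv => ?_)
          (PMF.avg_const _ 0))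
        rw [hz v hv, zero_mul]
    set ψ : ℝ := stayForever G σ Tr j h u
    have hψ0 : 0 < ψ := lt_of_le_of_ne (stayForever_nonneg _ _) (Ne.symm h0)
    set w : V → ℝ := fun v => (G.step σ h u v).toReal * stayForever G σ Tr j (h ++ [u]) v with hw
    have hw0 : ∀ v, 0 ≤ w v := fun v => mul_nonneg ENNReal.toReal_nonneg (stayForever_nonneg _ _)
    have hwadj : ∀ v, w v ≠ 0 → G.step σ h u v ≠ 0 ∧ Tr (h ++ [u]) v := by
      intro v hv
      refine ⟨fun h0 => hv (by simp [hw, h0]), ?_⟩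
      by_contra hn
      exact hv (by simp [hw, stayForever_of_not hn])
    have hsum : ∑ v, w v / ψ = 1 := by
      rw [← Finset.sum_div]
      exact (div_eq_one_iff_eq h0).2 heq.symm
    obtain ⟨μ, hμ⟩ : ∃ μ : PMF V, ∀ v, μ v = ENNReal.ofReal (w v / ψ) :=
      ⟨PMF.ofFintype (fun v => ENNReal.ofReal (w v / ψ)) (by
        rw [← ENNReal.ofReal_sum_of_nonneg fun v _ => div_nonneg (hw0 v) hψ0.le, hsum,
          ENNReal.ofReal_one]), fun v => rfl⟩
    have hμ0 : ∀ v, μ v ≠ 0 → w v ≠ 0 := by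
      intro v hv h0
      rw [hμ, h0, zero_div, ENNReal.ofReal_zero] at hv
      exact hv rfl
    obtain ⟨μ', hμ'⟩ := μ.exists_map_val fun v hv => adj_of_step huT (hwadj v (hμ0 v hv)).1
    refine ⟨μ', fun _ _ _ => ?_⟩
    rw [hμ']
    refine ⟨fun v hv => hwadj v (hμ0 v hv), fun f => ?_⟩
    rw [PMF.avg, PMF.avg, Finset.mul_sum]
    refine Finset.sum_congr rfl fun v _ => ?_
    rw [hμ, ENNReal.toReal_ofReal (div_nonneg (hw0 v) hψ0.le)]
    simp only [hw]
    field_simp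
  choose κ hκ using hloc
  refine ⟨κ, fun h u ho hu hTr hne hex => ?_⟩
  rw [step_of_owner _ h ho (exists_adj hu), deviate_self]
  exact hκ h ⟨u, ho, exists_adj hu⟩ hTr hne hex

end Stay

/-! ### Every trap is empty -/

section Countdown

variable {V : Type*}

/-- A counter along histories: it counts down from `N h u`, and is reset whenever it has
expired. -/
def countdown (N : List V → V → ℕ) (h : List V) (u : V) : ℕ :=
  ((h ++ [u]).foldl (fun s v => (s.1 ++ [v], if s.2 ≤ 1 then N s.1 v else s.2 - 1))
    (([] : List V), 0)).2

lemma countdown_child (N : List V → V → ℕ) (h : List V) (u v : V) :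
    countdown N (h ++ [u]) v =
      if countdown N h u ≤ 1 then N (h ++ [u]) v else countdown N h u - 1 := by
  have hfst : ∀ l : List V, (l.foldl (fun s v => (s.1 ++ [v], if s.2 ≤ 1 then N s.1 v else s.2 - 1))
      (([] : List V), 0)).1 = l := by
    intro l
    induction l using List.reverseRecOn with
    | nil => rfl
    | append_singleton l a ih => rw [List.foldl_append, List.foldl_cons, List.foldl_nil, ih]
  unfold countdown
  rw [List.foldl_append (l := h ++ [u]), List.foldl_cons, List.foldl_nil, hfst]

end Countdown

section NoTrap

variable {V I : Type*} [Fintype V] {G : Game V I} {P : Set I} {g : I → V → ℝ} {z : I → ℝ} {v₀ : V}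
  {σ : G.Profile} {B : I → Set V} {J : Finset I} {Tr : List V → V → Prop}

/-- If two pessimists `j` and `k` are bounded in a trap, then `j` can leave the trap almost surely:
otherwise `k` could follow `σ` conditioned to stay in the trap, and would win since the trap
has been left or a terminal vertex has been reached. -/
lemma IsTrap.stayForever_eq_zero (ht : IsTrap P g z v₀ σ B J Tr) (hσ : G.IsStable P v₀ g z σ)
    {i : I} (hi : 0 < z i) {j k : I} (hj : j ∈ J) (hk : k ∈ J) (hjk : j ≠ k) (hkP : k ∈ P)
    {h₀ : List V} {u₀ : V} (h0 : Tr h₀ u₀) : stayForever G σ Tr j h₀ u₀ = 0 := by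
  obtain ⟨κ, hκ⟩ := exists_reweight σ Tr j k
  have hne : ∀ {u : V}, G.owner u = some k → G.owner u ≠ some j := fun ho h => by
    rw [ho] at h
    exact hjk (Option.some_injective _ h).symm
  obtain ⟨τ, Γ, hτ, hΓ0, hΓ, h1, h2, h3, h4⟩ := ht.exists_switch hk (κ := κ) (Or.inl hkP)
    (fun h u v hTr ho _ hv => (hκ h u ho (ht.not_terminal hTr) hTr (hne ho)
      (ht.exists_child hTr)).1 v hv) h0
  set ψ := stayForever G σ Tr j
  set W : List V → V → ℝ := HistoryChain.win (G.step (G.deviate σ k τ)) G.terminals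
    {u | g k u ≤ z k} (0 ≤ z k)
  have hW0 : ∀ h u, 0 ≤ W h u := HistoryChain.win_nonneg
  have hW1 : ∀ h u, W h u ≤ 1 := HistoryChain.win_le_one
  -- Following `σ` conditioned to stay, `k` is bounded at most when `σ` stays and has not ended yet.
  have key : ∀ n h u, Γ h u → HistoryChain.hit (G.step σ) G.terminals n h u ≤
      1 - ψ h u * W h u := by
    intro n
    induction n with
    | zero =>
      intro h u hu
      rw [HistoryChain.hit, if_neg (ht.not_terminal (hΓ h u hu))]
      exact sub_nonneg.2 (mul_le_one₀ (stayForever_le_one _ _) (hW0 _ _) (hW1 _ _))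
    | succ n ih =>
      intro h u hu
      have hTr := hΓ h u hu
      have hWu : W h u = (G.step (G.deviate σ k τ) h u).avg fun v => W (h ++ [u]) v :=
        HistoryChain.win_eq (G.absorbs_step _) h u
      rw [HistoryChain.hit]
      by_cases ho : G.owner u = some k
      · rw [hWu, h1 h u hu, (hκ h u ho (ht.not_terminal hTr) hTr (hne ho)
          (ht.exists_child hTr)).2, ← PMF.avg_one_sub]
        refine PMF.avg_mono _ fun v hv => ?_
        by_cases hv' : Tr (h ++ [u]) v
        · exact ih _ _ (h3 h u v hu hv')
        · rw [show ψ (h ++ [u]) v = 0 from stayForever_of_not hv', zero_mul, sub_zero]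
          exact HistoryChain.hit_le_one _ _ _
      · have hstep : G.step (G.deviate σ k τ) h u = G.step σ h u := step_deviate_of_ne _ _ _ ho
        -- Outside the vertices of `k`, the probability to stay is not larger than at a successor.
        have hle : ∀ v, G.step σ h u v ≠ 0 → Tr (h ++ [u]) v → ψ h u ≤ ψ (h ++ [u]) v := by
          intro v hv hv'
          by_cases hoj : G.owner u = some j
          · exact stayForever_le_child hTr hoj hv hv'
          · rw [show ψ h u = _ from stayForever_eq_avg hTr hoj]
            refine PMF.avg_le _ fun w hw => ?_
            by_cases hw' : Tr (h ++ [u]) w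
            · rw [ht.unique hTr hj hk hjk hoj ho hv hw hv' hw']
            · rw [stayForever_of_not hw']
              exact stayForever_nonneg _ _
        rw [hWu, hstep, ← PMF.avg_mul_left, ← PMF.avg_one_sub]
        refine PMF.avg_mono _ fun v hv => ?_
        rcases h4 h u v hu (by rwa [hstep]) with hz | hv'
        · rw [show W (h ++ [u]) v = 0 from hz, mul_zero, sub_zero]
          exact HistoryChain.hit_le_one _ _ _
        · refine (ih _ _ hv').trans ?_
          have := mul_le_mul_of_nonneg_right (hle v hv (hΓ _ _ hv')) (hW0 (h ++ [u]) v)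
          linarith
  have h5 := HistoryChain.reach_le fun n => key n h₀ u₀ hΓ0
  rw [reach_terminals_eq_one hσ hi (ht.jointlyAlive h0).1] at h5
  have h6 : W h₀ u₀ ≠ 0 := (ht.jointlyAlive h0).2 k hk τ hτ
  have h7 : ψ h₀ u₀ * W h₀ u₀ = 0 :=
    le_antisymm (by linarith) (mul_nonneg (stayForever_nonneg _ _) (hW0 _ _))
  exact (mul_eq_zero.1 h7).resolve_right h6

/-- A player who can leave the trap almost surely by strategies that depend on the required
precision can leave it almost surely by a single strategy. -/
lemma IsTrap.false_of_stay (ht : IsTrap P g z v₀ σ B J Tr) {j : I} (hj : j ∈ J) (hjP : j ∈ P)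
    (hstay : ∀ h u, Tr h u → stayForever G σ Tr j h u = 0) {h₀ : List V} {u₀ : V}
    (h0 : Tr h₀ u₀) : False := by
  have hN : ∀ h u, ∃ n, 0 < n ∧ (Tr h u → stay G σ Tr j n h u ≤ 1 / 2) := by
    intro h u
    by_cases hu : Tr h u
    · have := tendsto_stay (G := G) (σ := σ) (Tr := Tr) (j := j) h u
      rw [hstay h u hu] at this
      obtain ⟨n, hn, hn'⟩ := (((tendsto_order.1 this).2 (1 / 2) one_half_pos).and
        (Filter.eventually_gt_atTop 0)).exists
      exact ⟨n, hn', fun _ => hn.le⟩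
    · exact ⟨1, one_pos, fun h => absurd h hu⟩
  choose N hN0 hN using hN
  set c := countdown N
  have hc : ∀ h u v, c (h ++ [u]) v = if c h u ≤ 1 then N (h ++ [u]) v else c h u - 1 :=
    countdown_child N
  obtain ⟨κ, hκ⟩ := exists_selection (σ := σ) j fun h u v => (G.step σ h u v ≠ 0 ∧
    Tr (h ++ [u]) v) ∧ stay G σ Tr j (c h u - 1) (h ++ [u]) v ≤ stay G σ Tr j (c h u - 1 + 1) h u
  have hκ' : ∀ h u, Tr h u → G.owner u = some j → ∃ v, ((G.step σ h u v ≠ 0 ∧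
      Tr (h ++ [u]) v) ∧
      stay G σ Tr j (c h u - 1) (h ++ [u]) v ≤ stay G σ Tr j (c h u - 1 + 1) h u) ∧
      G.step (G.deviate σ j κ) h u = PMF.pure v := by
    intro h u hTr ho
    obtain ⟨v, hv⟩ := exists_child_le_stay hTr ho (ht.exists_child hTr) (c h u - 1)
    exact hκ h u ho ⟨v, hv, adj_of_step (ht.not_terminal hTr) hv.1.1⟩
  obtain ⟨τ, Γ, hτ, hΓ0, hΓ, h1, h2, h3, h4⟩ := ht.exists_switch hj (κ := κ) (Or.inl hjP) (by
    intro h u v hTr ho _ hv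
    obtain ⟨w, hw, hw'⟩ := hκ' h u hTr ho
    rw [hw', PMF.pure_apply] at hv
    obtain rfl : v = w := by simpa using hv
    exact hw.1) h0
  set W : List V → V → ℝ := HistoryChain.win (G.step (G.deviate σ j τ)) G.terminals
    {u | g j u ≤ z j} (0 ≤ z j)
  have hWeq : ∀ h u, W h u = (G.step (G.deviate σ j τ) h u).avg fun v => W (h ++ [u]) v :=
    HistoryChain.win_eq (G.absorbs_step _)
  have hW0 : ∀ h u, 0 ≤ W h u := HistoryChain.win_nonneg
  have hstep : ∀ C n h u, Γ h u → c h u = n + 1 → 0 ≤ C →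
      (∀ v, Γ (h ++ [u]) v → W (h ++ [u]) v ≤ C * stay G σ Tr j n (h ++ [u]) v) →
      W h u ≤ C * stay G σ Tr j (n + 1) h u := by
    intro C n h u hu hcu hC hch
    have hch' : ∀ v, G.step (G.deviate σ j τ) h u v ≠ 0 →
        W (h ++ [u]) v ≤ C * stay G σ Tr j n (h ++ [u]) v := fun v hv =>
      (h4 h u v hu hv).elim (fun hz => (show W (h ++ [u]) v = 0 from hz).trans_le
        (mul_nonneg hC (stay_mem_Icc _ _ _).1)) (hch v)
    have hTr := hΓ h u hu
    rw [hWeq]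
    by_cases ho : G.owner u = some j
    · obtain ⟨v, hv, hpure⟩ := hκ' h u hTr ho
      rw [hcu, Nat.add_sub_cancel] at hv
      rw [h1 h u hu, hpure, PMF.avg_pure]
      refine (hch' v ?_).trans (mul_le_mul_of_nonneg_left hv.2 hC)
      rw [h1 h u hu, hpure]
      simp
    · rw [stay_succ_of_ne hTr ho, ← PMF.avg_mul_left, ← step_deviate_of_ne σ τ h ho]
      exact PMF.avg_mono _ hch'
  -- A bound at the histories where the counter is reset gives one at all histories.
  have key : ∀ C : ℝ, 0 ≤ C → (∀ h u, Γ h u → c h u = N h u → W h u ≤ C) →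
      ∀ n h u, Γ h u → c h u = n + 1 → W h u ≤ C * stay G σ Tr j (n + 1) h u := by
    intro C hC hreset n
    induction n with
    | zero =>
      intro h u hu hcu
      refine hstep C 0 h u hu hcu hC fun v hv => ?_
      rw [show stay G σ Tr j 0 (h ++ [u]) v = 1 from if_pos (hΓ _ _ hv), mul_one]
      exact hreset _ _ hv (by rw [hc, if_pos (by omega)])
    | succ n ih =>
      intro h u hu hcu
      exact hstep C _ h u hu hcu hC fun v hv => ih _ _ hv (by rw [hc, if_neg (by omega)]; omega)
  have hc0 : ∀ h u, ∃ n, c h u = n + 1 := by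
    intro h u
    refine Nat.exists_eq_succ_of_ne_zero ?_
    rcases List.eq_nil_or_concat' h with rfl | ⟨h, a, rfl⟩
    · exact (hN0 [] u).ne'
    · rw [hc]
      split_ifs with hle
      · exact (hN0 _ _).ne'
      · omega
  have hhalf : ∀ m : ℕ, ∀ h u, Γ h u → c h u = N h u → W h u ≤ (1 / 2) ^ m := by
    intro m
    induction m with
    | zero => exact fun h u _ _ => (HistoryChain.win_le_one h u).trans_eq (pow_zero _).symm
    | succ m ih =>
      intro h u hu hcu
      obtain ⟨n, hn⟩ := hc0 h u
      refine (key _ (by positivity) ih n h u hu hn).trans ?_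
      rw [← hn, hcu, pow_succ]
      exact mul_le_mul_of_nonneg_left (hN h u (hΓ h u hu)) (by positivity)
  have hzero : ∀ m : ℕ, W h₀ u₀ ≤ (1 / 2) ^ m := by
    intro m
    obtain ⟨n, hn⟩ := hc0 h₀ u₀
    refine (key _ (by positivity) (hhalf m) n h₀ u₀ hΓ0 hn).trans ?_
    exact mul_le_of_le_one_right (by positivity) (stay_mem_Icc _ _ _).2
  refine (ht.jointlyAlive h0).2 j hj τ hτ (le_antisymm ?_ (hW0 h₀ u₀))
  exact ge_of_tendsto' (tendsto_pow_atTop_nhds_zero_of_lt_one (by norm_num) (by norm_num)) hzero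

/-- No trap is visited by a stable profile. -/
theorem IsTrap.not_mem [Nonempty V] (ht : IsTrap P g z v₀ σ B J Tr) (hσ : G.IsStable P v₀ g z σ)
    (hB : ∀ i ∈ P, ∃ f ε, G.IsRegion (fun j => j ≠ i) {u | g i u ≤ z i} (0 ≤ z i) (B i) f ε)
    (h : List V) (u : V) : ¬ Tr h u := by
  intro h0
  rcases J.eq_empty_or_nonempty with rfl | ⟨j, hj⟩
  · by_cases ha : ∃ i, 0 < z i
    · obtain ⟨i, hi⟩ := ha
      have key : ∀ n h u, Tr h u → HistoryChain.hit (G.step σ) G.terminals n h u ≤ 0 := by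
        intro n
        induction n with
        | zero =>
          intro h u hu
          rw [HistoryChain.hit, if_neg (ht.not_terminal hu)]
        | succ n ih =>
          intro h u hu
          rw [HistoryChain.hit]
          exact PMF.avg_le _ fun v hv => ih _ _ (ht.child hu hv (by simp))
      have := HistoryChain.reach_le fun n => key n h u h0
      rw [reach_terminals_eq_one hσ hi (ht.jointlyAlive h0).1] at this
      exact absurd this (by norm_num)
    · push Not at ha
      have hsub : {u | G.Reached v₀ σ u} ⊆ safe G P g z v₀ σ B ∅ := by
        refine subset_safe fun u hu => ⟨hu, by simp, fun huT => ⟨ha, by simp, ?_, ?_⟩⟩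
        · rintro ho v hv
          obtain ⟨h, hs⟩ := hu
          exact ⟨_, hs.step huT (by rwa [step_of_nature _ h huT ho])⟩
        · intro i ho
          obtain ⟨h, hs⟩ := hu
          obtain ⟨v, hv⟩ := (G.step σ h u).exists_ne_zero
          exact ⟨⟨v, ⟨_, hs.step huT hv⟩, huT, h, hs, hv⟩, by simp⟩
      exact ht.not_safe h0 (hsub ⟨h, (ht.jointlyAlive h0).1⟩)
  · obtain ⟨i, hi⟩ := ht.exists_pos hB hj h0
    by_cases hopt : ∃ j ∈ J, j ∉ P
    · obtain ⟨k, hk, hkP⟩ := hopt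
      exact ht.false_of_sigma hσ hi hk (fun h => absurd h hkP) h0
    push Not at hopt
    by_cases hcard : ∀ k ∈ J, k = j
    · exact ht.false_of_sigma hσ hi hj (fun _ => hcard) h0
    push Not at hcard
    obtain ⟨k, hk, hkj⟩ := hcard
    exact ht.false_of_stay hj (hopt j hj) (fun h u hu =>
      ht.stayForever_eq_zero hσ hi hj hk hkj.symm (hopt k hk) hu) h0

end NoTrap

/-! ### Reaching a safe vertex or a separation -/

section Followers

variable {V I : Type*}

open Classical in
/-- The players in `J` other than a pessimist who owns `u`.  Such a pessimist stays bounded at every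
successor of `u`, so that only the other players constrain the choice of a successor. -/
noncomputable def followers (G : Game V I) (P : Set I) (J : Finset I) (u : V) : Finset I :=
  J.filter fun j => ¬ (j ∈ P ∧ G.owner u = some j)

lemma mem_followers {G : Game V I} {P : Set I} {J : Finset I} {u : V} {j : I} :
    j ∈ followers G P J u ↔ j ∈ J ∧ ¬ (j ∈ P ∧ G.owner u = some j) := by
  simp [followers]

end Followers

section Goal

variable {V I : Type*} [Fintype V] {G : Game V I} (P : Set I) (g : I → V → ℝ) (z : I → ℝ) (v₀ : V)
  (σ : G.Profile) (B : I → Set V)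

/-- At `hu`, the bounds of the players in `J` can be distributed to several successors of `u`. -/
def Separates (J : Finset I) (h : List V) (u : V) (c : I → V) : Prop :=
  (∀ j ∈ followers G P J u, G.step σ h u (c j) ≠ 0 ∧ Alive P g z σ j (h ++ [u]) (c j)) ∧
    ∃ j ∈ followers G P J u, ∃ k ∈ followers G P J u, c j ≠ c k

/-- After `n` further steps, through histories at which all players in `J` are bounded, one may
reach a safe vertex or a history at which the players in `J` can be separated. -/
def Reaches (J : Finset I) : ℕ → List V → V → Prop
  | 0, h, u => u ∈ safe G P g z v₀ σ B J ∨ (u ∉ G.terminals ∧ ∃ c, Separates P g z σ J h u c)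
  | n + 1, h, u => ∃ v, u ∉ G.terminals ∧ G.step σ h u v ≠ 0 ∧
      JointlyAlive P g z v₀ σ J (h ++ [u]) v ∧ Reaches J n (h ++ [u]) v

variable {P g z v₀ σ B}

lemma JointlyAlive.mem_safe {J : Finset I} {h : List V} {u : V}
    (ha : JointlyAlive P g z v₀ σ J h u) (hu : u ∈ G.terminals) :
    u ∈ safe G P g z v₀ σ B J := by
  refine subset_safe (D := {u}) ?_ rfl
  rintro _ rfl
  exact ⟨⟨h, ha.1⟩, fun _ j hj => (ha.2 j hj).le hu, fun hu' => absurd hu hu'⟩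

/-- Otherwise the histories from which neither a safe vertex nor a separation can be reached would
form a trap. -/
theorem JointlyAlive.reaches [Nonempty V] (hσ : G.IsStable P v₀ g z σ)
    (hB : ∀ i ∈ P, ∃ f ε, G.IsRegion (fun j => j ≠ i) {u | g i u ≤ z i} (0 ≤ z i) (B i) f ε)
    {J : Finset I} {h : List V} {u : V} (ha : JointlyAlive P g z v₀ σ J h u) :
    ∃ n, Reaches P g z v₀ σ B J n h u := by
  classical
  by_contra! hn
  set Tr : List V → V → Prop := fun h u => JointlyAlive P g z v₀ σ J h u ∧
    ∀ n, ¬ Reaches P g z v₀ σ B J n h u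
  have hT : ∀ {h u}, Tr h u → u ∉ G.terminals := fun hu hT => hu.2 0 (Or.inl (hu.1.mem_safe hT))
  have hchild : ∀ {h u v}, Tr h u → G.step σ h u v ≠ 0 →
      (∀ j ∈ J, Alive P g z σ j (h ++ [u]) v) → Tr (h ++ [u]) v := by
    intro h u v hu hv hal
    have hj : JointlyAlive P g z v₀ σ J (h ++ [u]) v := ⟨hu.1.1.step (hT hu) hv, hal⟩
    exact ⟨hj, fun n hr => hu.2 (n + 1) ⟨v, hT hu, hv, hj, hr⟩⟩
  have hown : ∀ {h u v j}, Tr h u → G.step σ h u v ≠ 0 → j ∈ J → j ∉ followers G P J u →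
      Alive P g z σ j (h ++ [u]) v := by
    intro h u v j hu hv hj hjf
    simp only [mem_followers, hj, true_and, not_not] at hjf
    exact (hu.1.2 j hj).move hjf.1 hjf.2 (adj_of_step (hT hu) hv)
  have hex : ∀ {h u}, Tr h u → ∀ j, ∃ v, j ∈ J → G.step σ h u v ≠ 0 ∧
      Alive P g z σ j (h ++ [u]) v := by
    intro h u hu j
    by_cases hj : j ∈ J
    · obtain ⟨v, hv⟩ := (hu.1.2 j hj).exists_child
      exact ⟨v, fun _ => hv⟩
    · exact ⟨u, fun h => absurd h hj⟩
  -- Two followers cannot be bounded at different successors, since this would separate them.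
  have heq : ∀ {h u v w j k}, Tr h u → j ∈ followers G P J u → k ∈ followers G P J u → j ≠ k →
      G.step σ h u v ≠ 0 → Alive P g z σ j (h ++ [u]) v → G.step σ h u w ≠ 0 →
      Alive P g z σ k (h ++ [u]) w → v = w := by
    intro h u v w j k hu hj hk hjk hv hvj hw hwk
    by_contra hvw
    choose c hc using hex hu
    refine hu.2 0 (Or.inr ⟨hT hu, Function.update (Function.update c j v) k w, fun i hi => ?_,
      j, hj, k, hk, ?_⟩)
    · by_cases hik : i = k
      · subst hik
        simpa using ⟨hw, hwk⟩
      by_cases hij : i = j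
      · subst hij
        simpa [hik] using ⟨hv, hvj⟩
      · simpa [hik, hij] using hc i (mem_followers.1 hi).1
    · simpa [hjk] using hvw
  have hcoa : ∀ {h u v j}, Tr h u → G.step σ h u v ≠ 0 → j ∈ followers G P J u →
      Alive P g z σ j (h ++ [u]) v → Tr (h ++ [u]) v := by
    intro h u v j hu hv hj hvj
    refine hchild hu hv fun k hk => ?_
    by_cases hkf : k ∈ followers G P J u
    · by_cases hjk : j = k
      · rwa [← hjk]
      · obtain ⟨w, hw⟩ := hex hu k
        obtain ⟨hw, hwk⟩ := hw hk
        rwa [heq hu hj hkf hjk hv hvj hw hwk]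
    · exact hown hu hv hk hkf
  refine IsTrap.not_mem (Tr := Tr) (J := J) (B := B) (P := P) (g := g) (z := z) (v₀ := v₀) (σ := σ)
    ⟨fun hu => hu.1, hT, fun hu hs => hu.2 0 (Or.inl hs), hchild,
      fun hu hv hj hjo hvj => hcoa hu hv (mem_followers.2 ⟨hj, hjo⟩) hvj, ?_, ?_⟩ hσ hB h u ⟨ha, hn⟩
  · intro h u hu
    by_cases hne : (followers G P J u).Nonempty
    · obtain ⟨j, hj⟩ := hne
      obtain ⟨v, hv⟩ := hex hu j
      obtain ⟨hv, hvj⟩ := hv (mem_followers.1 hj).1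
      exact ⟨v, hv, hcoa hu hv hj hvj⟩
    · obtain ⟨v, hv⟩ := (G.step σ h u).exists_ne_zero
      exact ⟨v, hv, hchild hu hv fun j hj => hown hu hv hj fun hjf => hne ⟨j, hjf⟩⟩
  · intro h u v w j k hu hj hk hjk hoj hok hv hw hTv hTw
    exact heq hu (mem_followers.2 ⟨hj, fun h => hoj h.2⟩) (mem_followers.2 ⟨hk, fun h => hok h.2⟩)
      hjk hv (hTv.1.2 j hj) hw (hTw.1.2 k hk)

end Goal

/-! ### Plans -/

section Plan

variable {V I : Type*}

/-- A plan is a graph of nodes that lie over the vertices of the game.  As long as everybody moves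
along the edges of the plan, the play stays in the plan; the first player who leaves the plan is
punished.  Here, `A i` is the set of vertices from which an optimist `i` could profit against any
punishment, and `B i` is the set of vertices from which the others can keep a pessimist `i`
bounded.  The players in `lab k` are those whose bound is still to be satisfied at the node `k`, and
`rank` measures the progress towards a terminal vertex or a safe node, where a safe node is one
below which play may go on forever. -/
structure Plan (G : Game V I) (P : Set I) (g : I → V → ℝ) (z : I → ℝ) (v₀ : V) (A B : I → Set V)
    (K : Type*) where
  root : K
  vert : K → V
  lab : K → Finset I
  succ : K → Finset V
  next : K → V → K
  safe : K → Prop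
  rank : K → ℕ
  vert_root : vert root = v₀
  lab_root : ∀ i, i ∈ lab root
  nonempty : ∀ k, vert k ∉ G.terminals → (succ k).Nonempty
  adj : ∀ k, ∀ v ∈ succ k, G.Adj (vert k) v
  vert_next : ∀ k, ∀ v ∈ succ k, vert (next k v) = v
  mem_succ : ∀ k, vert k ∉ G.terminals → G.owner (vert k) = none →
    ∀ v, v ∈ succ k ↔ G.nature (vert k) v ≠ 0
  le : ∀ k, vert k ∈ G.terminals → ∀ j ∈ lab k, g j (vert k) ≤ z j
  ge : ∀ k, vert k ∈ G.terminals → ∀ i, z i ≤ g i (vert k)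
  mem_region : ∀ k i, G.owner (vert k) = some i → i ∈ P → i ∈ lab k →
    ∀ v, G.Adj (vert k) v → v ∈ B i
  not_mem_region : ∀ k i, G.owner (vert k) = some i → i ∉ P → ∀ v, G.Adj (vert k) v → v ∉ A i
  safe_nonneg : ∀ k, vert k ∉ G.terminals → safe k → ∀ j ∈ lab k, 0 ≤ z j
  safe_next : ∀ k, safe k → ∀ v ∈ succ k, safe (next k v) ∧ lab k ⊆ lab (next k v)
  exists_progress : ∀ k, vert k ∉ G.terminals → ¬ safe k → ∀ j ∈ lab k,
    ∃ v ∈ succ k, j ∈ lab (next k v) ∧ rank (next k v) < rank k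
  progress : ∀ k i, ¬ safe k → G.owner (vert k) = some i → i ∈ P → i ∈ lab k →
    ∀ v ∈ succ k, i ∈ lab (next k v) ∧ rank (next k v) < rank k
  exists_ending : ∀ i, 0 < z i → ∀ k, vert k ∉ G.terminals → G.owner (vert k) = none →
    ∃ v ∈ succ k, rank (next k v) < rank k
  ending : ∀ i, 0 < z i → ∀ k j, G.owner (vert k) = some j →
    ∀ v ∈ succ k, rank (next k v) < rank k

namespace Plan

variable {G : Game V I} {P : Set I} {g : I → V → ℝ} {z : I → ℝ} {v₀ : V} {A B : I → Set V}
  {K : Type*} (Q : Plan G P g z v₀ A B K)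

open Classical in
/-- The memory state after reading the vertex `v`: a node of the plan, or the player that is
to be punished.  The state `none` is only used at the very beginning. -/
noncomputable def update : Option (K ⊕ I) → V → Option (K ⊕ I)
  | none, _ => some (Sum.inl Q.root)
  | some (Sum.inl k), v => if v ∈ Q.succ k then some (Sum.inl (Q.next k v)) else
      (G.owner (Q.vert k)).map Sum.inr
  | some (Sum.inr i), _ => some (Sum.inr i)

open Classical in
/-- The distribution at `u` when the current vertex has already been read: the uniform distribution
on the successors in the plan, or the punishing move `f i u`. -/
noncomputable def act (f : I → V → V) : Option (K ⊕ I) → (u : {u : V // ∃ v, G.Adj u v}) →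
    PMF {v : V // G.Adj u v}
  | some (Sum.inl k), u => if hk : Q.vert k = u then
      (PMF.exists_map_val (p := G.Adj u.1) (PMF.uniformOfFinset (Q.succ k)
        (Q.nonempty k (fun h => u.2.elim (hk ▸ h)))) (fun v hv => hk ▸ Q.adj k v
          ((PMF.mem_support_uniformOfFinset_iff _ _).1 hv))).choose
      else PMF.pure ⟨u.2.choose, u.2.choose_spec⟩
  | some (Sum.inr i), u => if hv : G.Adj u (f i u) then PMF.pure ⟨f i u, hv⟩ else
      PMF.pure ⟨u.2.choose, u.2.choose_spec⟩
  | none, u => PMF.pure ⟨u.2.choose, u.2.choose_spec⟩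

/-- The memory structure of a plan, with punishing moves `f`.  The state after the history `h` does
not yet account for the current vertex `u`, which is therefore read before acting. -/
noncomputable def memory (f : I → V → V) : G.MemoryStructure (Option (K ⊕ I)) where
  initial := none
  update := Q.update
  output s _ u := Q.act f (Q.update s u.1) ⟨u.1, u.2.2⟩

/-- The memory state after reading the history `hu`, including `u`. -/
noncomputable def state (h : List V) (u : V) : Option (K ⊕ I) := (h ++ [u]).foldl Q.update none

lemma state_child (h : List V) (u v : V) : Q.state (h ++ [u]) v = Q.update (Q.state h u) v := by
  rw [state, List.foldl_append, List.foldl_cons, List.foldl_nil, state]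

lemma state_of_mem_succ {h : List V} {u v : V} {k : K} (hk : Q.state h u = some (Sum.inl k))
    (hv : v ∈ Q.succ k) : Q.state (h ++ [u]) v = some (Sum.inl (Q.next k v)) := by
  rw [state_child, hk, update, if_pos hv]

lemma state_of_not_mem_succ {h : List V} {u v : V} {k : K} {i : I}
    (hk : Q.state h u = some (Sum.inl k)) (hv : v ∉ Q.succ k) (ho : G.owner (Q.vert k) = some i) :
    Q.state (h ++ [u]) v = some (Sum.inr i) := by
  rw [state_child, hk, update, if_neg hv, ho, Option.map_some]

lemma state_of_punish {h g' : List V} {u w : V} {i : I} (hk : Q.state h u = some (Sum.inr i))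
    (hg : h ++ [u] <+: g' ++ [w]) : Q.state g' w = some (Sum.inr i) := by
  obtain ⟨l, hl⟩ := hg
  rw [state, ← hl, List.foldl_append, ← state, hk]
  clear hl
  induction l with
  | nil => rfl
  | cons a l ih => exact ih

lemma profile_memory (f : I → V → V) (i : I) (h : List V) (u : G.DecisionVertex i) :
    (Q.memory f).profile i h u = Q.act f (Q.state h u.1) ⟨u.1, u.2.2⟩ := by
  rw [state, List.foldl_append]
  rfl

lemma map_act_of_node (f : I → V → V) {k : K} {u : {u : V // ∃ v, G.Adj u v}}
    (hk : Q.vert k = u.1) (hne : (Q.succ k).Nonempty) :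
    (Q.act f (some (Sum.inl k)) u).map Subtype.val = PMF.uniformOfFinset (Q.succ k) hne := by
  simp only [act]
  rw [dif_pos hk]
  exact Exists.choose_spec (p := fun μ : PMF {v : V // G.Adj u.1 v} => μ.map Subtype.val = _) _

lemma step_of_node (f : I → V → V) {h : List V} {u : V} {k : K} {i : I}
    (hk : Q.state h u = some (Sum.inl k)) (hu : Q.vert k = u) (ht : u ∉ G.terminals)
    (ho : G.owner u = some i) : G.step (Q.memory f).profile h u =
      PMF.uniformOfFinset (Q.succ k) (Q.nonempty k (hu ▸ ht)) := by
  rw [step_of_owner _ h ho (exists_adj ht), profile_memory]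
  simp only [hk]
  exact Q.map_act_of_node f hu _

lemma step_of_punish (f : I → V → V) (hf : ∀ i u, u ∉ G.terminals → G.Adj u (f i u)) {h : List V}
    {u : V} {i j : I} (hk : Q.state h u = some (Sum.inr i)) (ht : u ∉ G.terminals)
    (ho : G.owner u = some j) : G.step (Q.memory f).profile h u = PMF.pure (f i u) := by
  rw [step_of_owner _ h ho (exists_adj ht), profile_memory]
  simp only [hk, act]
  rw [dif_pos (hf i u ht), PMF.pure_map]

lemma conforms_of_punish (f : I → V → V) (hf : ∀ i u, u ∉ G.terminals → G.Adj u (f i u))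
    {h : List V} {u : V} {i : I} (hk : Q.state h u = some (Sum.inr i)) (τ : G.Strategy i) :
    G.Conforms (fun j => j ≠ i) (f i) (G.step (G.deviate (Q.memory f).profile i τ)) h u := by
  refine ⟨G.absorbs_step _, fun g' w hg hw => ⟨fun ho => step_of_nature _ g' hw ho, fun j hj =>
    ⟨fun hji => ?_, fun v hv => adj_of_step hw hv⟩⟩⟩
  rw [step_deviate_of_ne _ _ _ (by rw [hj]; exact fun h => hji (Option.some_injective _ h)),
    Q.step_of_punish f hf (Q.state_of_punish hk hg) hw hj]

open Classical in
/-- The rank of a history that has followed the plan, where all safe nodes are put at rank zero. -/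
noncomputable def bound (h : List V) (u : V) : ℕ :=
  match Q.state h u with
  | some (Sum.inl k) => if Q.safe k then 0 else Q.rank k
  | _ => 0

open Classical in
lemma bound_of_node {h : List V} {u : V} {k : K} (hk : Q.state h u = some (Sum.inl k)) :
    Q.bound h u = if Q.safe k then 0 else Q.rank k := by
  simp only [bound, hk]

lemma bound_lt {h : List V} {u v : V} {k : K} (hk : Q.state h u = some (Sum.inl k))
    (hs : ¬ Q.safe k) (hv : v ∈ Q.succ k) (hr : Q.rank (Q.next k v) < Q.rank k) :
    Q.bound (h ++ [u]) v < Q.bound h u := by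
  rw [Q.bound_of_node hk, Q.bound_of_node (Q.state_of_mem_succ hk hv), if_neg hs]
  split_ifs <;> omega

/-- The profile of a plan is pure if the plan has a single successor at the vertices of the
players. -/
theorem isPure (f : I → V → V) (hQ : ∀ k i, Q.vert k ∉ G.terminals → G.owner (Q.vert k) = some i →
    ∃ v, Q.succ k = {v}) : G.IsPure v₀ (Q.memory f).profile := by
  intro i h u _
  suffices ∀ s, ∃ v, Q.act f s ⟨u.1, u.2.2⟩ v = 1 by
    rw [profile_memory]
    exact this _
  have hp : ∀ v : {v // G.Adj u.1 v}, ∃ w, (PMF.pure v) w = 1 := fun v => ⟨v, by simp⟩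
  have ht : u.1 ∉ G.terminals := fun ht => u.2.2.elim ht
  rintro (_ | k | j)
  · exact hp _
  · by_cases hk : Q.vert k = u.1
    · obtain ⟨v, hv⟩ := hQ k i (hk ▸ ht) (hk ▸ u.2.1)
      have hmap := Q.map_act_of_node f (u := ⟨u.1, u.2.2⟩) hk (Q.nonempty k (hk ▸ ht))
      have hv' : v ∈ Q.succ k := by rw [hv]; exact Finset.mem_singleton_self v
      refine ⟨⟨v, hk ▸ Q.adj k v hv'⟩, ?_⟩
      rw [PMF.eq_pure_of_forall (a := ⟨v, hk ▸ Q.adj k v hv'⟩)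
        (μ := Q.act f (some (Sum.inl k)) ⟨u.1, u.2.2⟩), PMF.pure_apply_self]
      intro w hw
      have hw' : w.1 ∈ ((Q.act f (some (Sum.inl k)) ⟨u.1, u.2.2⟩).map Subtype.val).support :=
        (PMF.mem_support_map_iff _ _ _).2 ⟨w, hw, rfl⟩
      rw [hmap, PMF.mem_support_uniformOfFinset_iff, hv, Finset.mem_singleton] at hw'
      exact Subtype.ext hw'
    · simp only [act, dif_neg hk]
      exact hp _
  · simp only [act]
    split_ifs
    all_goals exact hp _

variable [Fintype V]

/-- At a node of the plan where the deviating player `i` has no influence, the successors in the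
plan are those with a positive probability, and their probabilities are bounded below. -/
lemma step_apply (f : I → V → V) {δ : ℝ} (hδc : δ ≤ (Fintype.card V : ℝ)⁻¹)
    (hδn : ∀ u v, G.nature u v ≠ 0 → δ ≤ (G.nature u v).toReal) {h : List V} {u : V} {k : K}
    (hk : Q.state h u = some (Sum.inl k)) (hu : Q.vert k = u) (ht : u ∉ G.terminals) {i : I}
    {τ : G.Strategy i} (hτ : G.owner u ≠ some i ∨ τ = (Q.memory f).profile i) (v : V) :
    (G.step (G.deviate (Q.memory f).profile i τ) h u v ≠ 0 → v ∈ Q.succ k) ∧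
      (v ∈ Q.succ k → δ ≤ (G.step (G.deviate (Q.memory f).profile i τ) h u v).toReal) := by
  have hstep : G.step (G.deviate (Q.memory f).profile i τ) h u =
      G.step (Q.memory f).profile h u := by
    rcases hτ with hτ | rfl
    · exact step_deviate_of_ne _ _ _ hτ
    · rw [deviate_eq_self]
  rw [hstep]
  rcases ho : G.owner u with _ | j
  · rw [step_of_nature _ h ht ho]
    have := Q.mem_succ k (hu ▸ ht) (hu ▸ ho) v
    rw [hu] at this
    exact ⟨this.2, fun hv => hδn u v (this.1 hv)⟩
  · rw [Q.step_of_node f hk hu ht ho]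
    refine ⟨fun hv => (PMF.mem_support_uniformOfFinset_iff _ _).1 hv, fun hv => ?_⟩
    rw [PMF.uniformOfFinset_apply_of_mem _ hv, ENNReal.toReal_inv, ENNReal.toReal_natCast]
    refine hδc.trans (inv_anti₀ ?_ ?_)
    · exact_mod_cast Finset.card_pos.2 ⟨v, hv⟩
    · exact_mod_cast Finset.card_le_univ _

variable {Q} {f : I → V → V}

/-- Under the profile of a plan, every player is bounded, also if she is a pessimist and
deviates. -/
theorem win_ne_zero [Nonempty V] [Finite K] (hf : ∀ i u, u ∉ G.terminals → G.Adj u (f i u))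
    (hB : ∀ i ∈ P, ∃ ε, G.IsRegion (fun j => j ≠ i) {u | g i u ≤ z i} (0 ≤ z i) (B i) (f i) ε)
    (i : I) (τ : G.Strategy i) (hτ : i ∈ P ∨ τ = (Q.memory f).profile i) :
    HistoryChain.win (G.step (G.deviate (Q.memory f).profile i τ)) G.terminals
      {u | g i u ≤ z i} (0 ≤ z i) [] v₀ ≠ 0 := by
  obtain ⟨δ, hδ, hδ1, hδc, hδn⟩ := G.exists_min_prob
  obtain ⟨N, hN⟩ := Finite.exists_nat_bound Q.rank
  obtain ⟨ε, hε, hε1, hpun⟩ : ∃ ε : ℝ, 0 < ε ∧ ε ≤ 1 ∧ (i ∈ P → ∀ h u,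
      Q.state h u = some (Sum.inr i) → u ∈ B i → ε ≤ HistoryChain.win
        (G.step (G.deviate (Q.memory f).profile i τ)) G.terminals {u | g i u ≤ z i} (0 ≤ z i)
          h u) := by
    by_cases hi : i ∈ P
    · obtain ⟨ε, hε⟩ := hB i hi
      exact ⟨ε, hε.pos, hε.le_one, fun _ h u hk hu =>
        hε.win_of_mem hu (Q.conforms_of_punish f hf hk τ)⟩
    · exact ⟨1, one_pos, le_rfl, fun h => absurd h hi⟩
  have hmain := HistoryChain.win_pos_of_rank (G.absorbs_step (G.deviate (Q.memory f).profile i τ))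
    (F := {u | g i u ≤ z i}) (inf := 0 ≤ z i)
    (G := fun h u => ∃ k, Q.state h u = some (Sum.inl k) ∧ Q.vert k = u ∧ i ∈ Q.lab k)
    (b := Q.bound) hδ hδ1 hε hε1 (N := N) ?_ ?_ (h := []) (u := v₀)
    ⟨Q.root, rfl, Q.vert_root, Q.lab_root i⟩
  · intro h0
    rw [h0] at hmain
    exact absurd hmain (not_le.2 (by positivity))
  · rintro h u ⟨k, hk, -, -⟩
    rw [Q.bound_of_node hk]
    split_ifs
    exacts [Nat.zero_le _, hN k]
  rintro h u ⟨k, hk, rfl, hik⟩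
  refine Or.inr ?_
  by_cases ht : Q.vert k ∈ G.terminals
  · exact Or.inl ⟨ht, Q.le k ht i hik⟩
  refine Or.inr ?_
  have hnode : ∀ v ∈ Q.succ k, i ∈ Q.lab (Q.next k v) → ∃ k',
      Q.state (h ++ [Q.vert k]) v = some (Sum.inl k') ∧ Q.vert k' = v ∧ i ∈ Q.lab k' :=
    fun v hv hi => ⟨_, Q.state_of_mem_succ hk hv, Q.vert_next k v hv, hi⟩
  -- A deviation of a pessimist is punished.
  have hleave : G.owner (Q.vert k) = some i → i ∈ P → ∀ v, G.Adj (Q.vert k) v → v ∉ Q.succ k →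
      ε ≤ HistoryChain.win (G.step (G.deviate (Q.memory f).profile i τ)) G.terminals
        {u | g i u ≤ z i} (0 ≤ z i) (h ++ [Q.vert k]) v := fun ho hi v hv hvs =>
    hpun hi _ _ (Q.state_of_not_mem_succ hk hvs ho) (Q.mem_region k i ho hi hik v hv)
  have happly : ¬ (G.owner (Q.vert k) = some i ∧ i ∈ P) → _ := fun hc =>
    Q.step_apply f hδc hδn hk rfl ht (i := i) (τ := τ) (by tauto)
  by_cases hs : Q.safe k
  · refine Or.inr ⟨Q.safe_nonneg k ht hs i hik, ht, fun v hv => ?_⟩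
    by_cases hvs : v ∈ Q.succ k
    · obtain ⟨h1, h2⟩ := Q.safe_next k hs v hvs
      refine Or.inr ⟨hnode v hvs (h2 hik), ?_⟩
      rw [Q.bound_of_node (Q.state_of_mem_succ hk hvs), if_pos h1]
      exact Nat.zero_le _
    · by_cases hc : G.owner (Q.vert k) = some i ∧ i ∈ P
      · exact Or.inl (hleave hc.1 hc.2 v (adj_of_step ht hv) hvs)
      · exact absurd ((happly hc v).1 hv) hvs
  · refine Or.inl ⟨ht, ?_⟩
    by_cases hc : G.owner (Q.vert k) = some i ∧ i ∈ P
    · obtain ⟨v, hv⟩ := (G.step (G.deviate (Q.memory f).profile i τ) h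
        (Q.vert k)).exists_card_inv_le
      have hv := hδc.trans hv
      refine ⟨v, hv, ?_⟩
      by_cases hvs : v ∈ Q.succ k
      · obtain ⟨h1, h2⟩ := Q.progress k i hs hc.1 hc.2 hik v hvs
        exact Or.inr ⟨hnode v hvs h1, Q.bound_lt hk hs hvs h2⟩
      · exact Or.inl (hleave hc.1 hc.2 v (adj_of_step ht (PMF.ne_zero_of_le hδ hv)) hvs)
    · obtain ⟨v, hvs, h1, h2⟩ := Q.exists_progress k ht hs i hik
      exact ⟨v, (happly hc v).2 hvs, Or.inr ⟨hnode v hvs h1, Q.bound_lt hk hs hvs h2⟩⟩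

/-- Under the profile of a plan, every player obtains at least her value almost surely, also if she
is an optimist and deviates. -/
theorem win_eq_zero [Nonempty V] [Finite K] (hf : ∀ i u, u ∉ G.terminals → G.Adj u (f i u))
    (hA : ∀ i ∉ P, ∃ ε, G.IsRegion (fun j => j = i) {u | g i u < z i} (0 < z i) (A i) (f i) ε)
    (i : I) (τ : G.Strategy i) (hτ : i ∉ P ∨ τ = (Q.memory f).profile i) :
    HistoryChain.win (G.step (G.deviate (Q.memory f).profile i τ)) G.terminals
      {u | g i u < z i} (0 < z i) [] v₀ = 0 := by
  obtain ⟨δ, hδ, hδ1, hδc, hδn⟩ := G.exists_min_prob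
  obtain ⟨N, hN⟩ := Finite.exists_nat_bound Q.rank
  refine HistoryChain.win_zero_of_rank (G.absorbs_step _) hδ hδ1
    (G := fun h u => ∃ k, Q.state h u = some (Sum.inl k) ∧ Q.vert k = u)
    (b := fun h u => match Q.state h u with
      | some (Sum.inl k) => Q.rank k
      | _ => 0) (N := N) ?_ ?_ ⟨Q.root, rfl, Q.vert_root⟩
  · rintro - h u ⟨k, hk, -⟩
    simp only [hk]
    exact hN k
  rintro h u ⟨k, hk, rfl⟩
  by_cases ht : Q.vert k ∈ G.terminals
  · exact Or.inl ⟨ht, fun hlt => (Q.ge k ht i).not_gt hlt⟩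
  refine Or.inr ⟨ht, ?_⟩
  have hleave : G.owner (Q.vert k) = some i → i ∉ P → ∀ v, G.Adj (Q.vert k) v → v ∉ Q.succ k →
      HistoryChain.win (G.step (G.deviate (Q.memory f).profile i τ)) G.terminals
        {u | g i u < z i} (0 < z i) (h ++ [Q.vert k]) v = 0 := by
    intro ho hi v hv hvs
    obtain ⟨ε, hε⟩ := hA i hi
    exact hε.win_of_not_mem (Q.not_mem_region k i ho hi v hv)
      (Q.conforms_of_punish f hf (Q.state_of_not_mem_succ hk hvs ho) τ)
  have happly : ¬ (G.owner (Q.vert k) = some i ∧ i ∉ P) → _ := fun hc =>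
    Q.step_apply f hδc hδn hk rfl ht (i := i) (τ := τ) (by tauto)
  refine ⟨fun v hv => ?_, fun hpos => ?_⟩
  · by_cases hvs : v ∈ Q.succ k
    · exact Or.inr ⟨_, Q.state_of_mem_succ hk hvs, Q.vert_next k v hvs⟩
    · by_cases hc : G.owner (Q.vert k) = some i ∧ i ∉ P
      · exact Or.inl (hleave hc.1 hc.2 v (adj_of_step ht hv) hvs)
      · exact absurd ((happly hc v).1 hv) hvs
  · have hlt : ∀ v ∈ Q.succ k, (match Q.state (h ++ [Q.vert k]) v with
          | some (Sum.inl k) => Q.rank k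
          | _ => 0) = Q.rank (Q.next k v) := fun v hv => by
      simp only [Q.state_of_mem_succ hk hv]
    simp only [hk]
    rcases ho : G.owner (Q.vert k) with _ | j
    · obtain ⟨v, hvs, hr⟩ := Q.exists_ending i hpos k ht ho
      refine ⟨v, (happly (by simp [ho]) v).2 hvs, Or.inr ?_⟩
      rwa [hlt v hvs]
    · by_cases hc : G.owner (Q.vert k) = some i ∧ i ∉ P
      · obtain ⟨v, hv⟩ := (G.step (G.deviate (Q.memory f).profile i τ) h
          (Q.vert k)).exists_card_inv_le
        have hv := hδc.trans hv
        refine ⟨v, hv, ?_⟩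
        by_cases hvs : v ∈ Q.succ k
        · right
          rw [hlt v hvs]
          exact Q.ending i hpos k j ho v hvs
        · exact Or.inl (hleave hc.1 hc.2 v (adj_of_step ht (PMF.ne_zero_of_le hδ hv)) hvs)
      · obtain ⟨v, hvs⟩ := Q.nonempty k ht
        refine ⟨v, (happly hc v).2 hvs, Or.inr ?_⟩
        rw [hlt v hvs]
        exact Q.ending i hpos k j ho v hvs

theorem isStable [Nonempty V] [Finite K] (hf : ∀ i u, u ∉ G.terminals → G.Adj u (f i u))
    (hA : ∀ i ∉ P, ∃ ε, G.IsRegion (fun j => j = i) {u | g i u < z i} (0 < z i) (A i) (f i) ε)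
    (hB : ∀ i ∈ P, ∃ ε, G.IsRegion (fun j => j ≠ i) {u | g i u ≤ z i} (0 ≤ z i) (B i) (f i) ε) :
    G.IsStable P v₀ g z (Q.memory f).profile :=
  fun i => ⟨win_ne_zero hf hB i, win_eq_zero hf hA i⟩

end Plan

end Plan

/-! ### Nodes and their successors -/

section Nodes

variable {V I : Type*} [Fintype V] {G : Game V I} (P : Set I) (g : I → V → ℝ) (z : I → ℝ) (v₀ : V)
  (σ : G.Profile) (B : I → Set V)

/-- A node `(J, u)` is admissible if `u` is safe for `J`, or if `u` is visited while all players in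
`J` are bounded. -/
def Admissible (J : Finset I) (u : V) : Prop :=
  u ∈ safe G P g z v₀ σ B J ∨ ∃ h, JointlyAlive P g z v₀ σ J h u

open Classical in
/-- The least number of steps from an admissible node to a safe vertex or to a separation. -/
noncomputable def dist (J : Finset I) (u : V) : ℕ :=
  if u ∈ safe G P g z v₀ σ B J then 0 else
    sInf {n | ∃ h, JointlyAlive P g z v₀ σ J h u ∧ Reaches P g z v₀ σ B J n h u}

open Classical in
/-- The label that is used where nothing has to be satisfied: with the label `{i₀}` instead of `∅`
where this is possible, there is only one such node over each vertex. -/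
noncomputable def defaultLabel (i₀ : I) (v : V) : Finset I :=
  if Admissible P g z v₀ σ B {i₀} v then {i₀} else ∅

variable {P g z v₀ σ B} {J : Finset I} {u : V}

lemma Admissible.reached (h : Admissible P g z v₀ σ B J u) : G.Reached v₀ σ u :=
  h.elim (fun h => (safeStep_of_mem_safe h).1) fun ⟨h, hh⟩ => ⟨h, hh.1⟩

lemma Admissible.mem_safe (h : Admissible P g z v₀ σ B J u) (hu : u ∈ G.terminals) :
    u ∈ safe G P g z v₀ σ B J :=
  h.elim id fun ⟨_, hh⟩ => hh.mem_safe hu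

lemma Admissible.mem_region (h : Admissible P g z v₀ σ B J u)
    (hB : ∀ i ∈ P, ∃ f ε, G.IsRegion (fun j => j ≠ i) {u | g i u ≤ z i} (0 ≤ z i) (B i) f ε)
    {i : I} (ho : G.owner u = some i) (hi : i ∈ P) (hiJ : i ∈ J) {v : V} (hv : G.Adj u v) :
    v ∈ B i := by
  rcases h with h | ⟨h, hh⟩
  · have hu : u ∉ G.terminals := fun hu => hu v hv
    exact (((safeStep_of_mem_safe h).2.2 hu).2.2.2 i ho).2 hi hiJ v hv
  · obtain ⟨f, ε, hBi⟩ := hB i hi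
    exact ((hh.2 i hiJ).move hi ho hv).mem_region hBi hi

lemma admissible_empty (h : G.Reached v₀ σ u) : Admissible P g z v₀ σ B ∅ u :=
  let ⟨h, hh⟩ := h
  Or.inr ⟨h, hh, by simp⟩

lemma admissible_defaultLabel (i₀ : I) (h : G.Reached v₀ σ u) :
    Admissible P g z v₀ σ B (defaultLabel P g z v₀ σ B i₀ u) u := by
  rw [defaultLabel]
  split_ifs with hc
  exacts [hc, admissible_empty h]

lemma dist_le {n : ℕ} {h : List V} (hj : JointlyAlive P g z v₀ σ J h u)
    (hr : Reaches P g z v₀ σ B J n h u) : dist P g z v₀ σ B J u ≤ n := by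
  rw [dist]
  split_ifs
  exacts [Nat.zero_le _, Nat.sInf_le ⟨h, hj, hr⟩]

/-- At an admissible node that is not safe, the players in `J` can be separated, or there is
a step that decreases the distance. -/
lemma Admissible.exists_step [Nonempty V] (hσ : G.IsStable P v₀ g z σ)
    (hB : ∀ i ∈ P, ∃ f ε, G.IsRegion (fun j => j ≠ i) {u | g i u ≤ z i} (0 ≤ z i) (B i) f ε)
    (ha : Admissible P g z v₀ σ B J u) (hs : u ∉ safe G P g z v₀ σ B J) :
    ∃ h, JointlyAlive P g z v₀ σ J h u ∧ ((∃ c, Separates P g z σ J h u c) ∨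
      ∃ v, G.step σ h u v ≠ 0 ∧ JointlyAlive P g z v₀ σ J (h ++ [u]) v ∧
        dist P g z v₀ σ B J v < dist P g z v₀ σ B J u) := by
  obtain ⟨h, hh⟩ := ha.resolve_left hs
  obtain ⟨n, hn⟩ := hh.reaches hσ hB
  have hmem := Nat.sInf_mem (s := {n | ∃ h, JointlyAlive P g z v₀ σ J h u ∧
    Reaches P g z v₀ σ B J n h u}) ⟨n, h, hh, hn⟩
  have hdist : dist P g z v₀ σ B J u = sInf {n | ∃ h, JointlyAlive P g z v₀ σ J h u ∧
    Reaches P g z v₀ σ B J n h u} := if_neg hs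
  rw [← hdist] at hmem
  obtain ⟨h', hh', hr⟩ := hmem
  refine ⟨h', hh', ?_⟩
  rcases hd : dist P g z v₀ σ B J u with _ | m
  · rw [hd] at hr
    exact Or.inl (hr.resolve_left hs).2
  · rw [hd] at hr
    obtain ⟨v, -, hv, hjv, hrv⟩ := hr
    exact Or.inr ⟨v, hv, hjv, Nat.lt_succ_of_le (dist_le hjv hrv)⟩

variable (P g z v₀ σ B)

/-- The successors `C` of the admissible node `(J, u)` and their labels `lab`, in each of the four
situations: `u` is safe for `J`; there is nothing to satisfy; one successor inherits the label
`J` and decreases the distance; the label `J` is distributed to at least two successors. -/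
structure IsExpansion (i₀ : I) (J : Finset I) (u : V) (C : Finset V) (lab : V → Finset I) :
    Prop where
  nonempty : C.Nonempty
  used : ∀ v ∈ C, G.Used v₀ σ u v
  mem_iff : G.owner u = none → ∀ v, v ∈ C ↔ G.nature u v ≠ 0
  singleton : G.IsPure v₀ σ → ∀ i, G.owner u = some i → ∃ v, C = {v}
  cases : (J ≠ ∅ ∧ u ∈ safe G P g z v₀ σ B J ∧ ∀ v ∈ C, lab v = J ∧ v ∈ safe G P g z v₀ σ B J) ∨
    (J = ∅ ∧ (∀ v ∈ C, lab v = defaultLabel P g z v₀ σ B i₀ v) ∧ ∀ i, 0 < z i →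
      ∃ w ∈ C, dist P g z v₀ σ B ∅ w < dist P g z v₀ σ B ∅ u ∧ (G.owner u ≠ none → C = {w})) ∨
    (J ≠ ∅ ∧ u ∉ safe G P g z v₀ σ B J ∧ ∃ w ∈ C, lab w = J ∧ Admissible P g z v₀ σ B J w ∧
      dist P g z v₀ σ B J w < dist P g z v₀ σ B J u ∧ (G.owner u ≠ none → C = {w}) ∧
      ∀ v ∈ C, v ≠ w → lab v = defaultLabel P g z v₀ σ B i₀ v) ∨
    (u ∉ safe G P g z v₀ σ B J ∧ ∃ c : I → V,
      (∃ j ∈ followers G P J u, ∃ k ∈ followers G P J u, c j ≠ c k) ∧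
      (∀ j ∈ followers G P J u, c j ∈ C) ∧
      (∀ v ∈ C, (∃ j ∈ followers G P J u, c j = v) → Admissible P g z v₀ σ B (lab v) v ∧
        ∀ j, j ∈ lab v ↔ j ∈ J ∧ (j ∈ followers G P J u → c j = v)) ∧
      ∀ v ∈ C, (¬ ∃ j ∈ followers G P J u, c j = v) →
        G.owner u = none ∧ lab v = defaultLabel P g z v₀ σ B i₀ v)

variable {P g z v₀ σ B}

/-- The set of successors of a node: prescribed at stochastic vertices, and else some set of
successors that are used after one history. -/
lemma exists_succ {h : List V} (hs : G.Supp v₀ σ h u) (hu : u ∉ G.terminals) {S : Finset V}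
    (hS : S.Nonempty) (hS' : ∀ v ∈ S, G.step σ h u v ≠ 0) :
    ∃ C : Finset V, S ⊆ C ∧ (∀ v ∈ C, G.step σ h u v ≠ 0) ∧ (G.owner u ≠ none → C = S) ∧
      (∀ v ∈ C, G.Used v₀ σ u v) ∧ (G.owner u = none → ∀ v, v ∈ C ↔ G.nature u v ≠ 0) ∧
      (G.IsPure v₀ σ → ∀ i, G.owner u = some i → ∃ v, C = {v}) := by
  classical
  by_cases ho : G.owner u = none
  · have hstep := step_of_nature σ h hu ho
    refine ⟨Finset.univ.filter fun v => G.nature u v ≠ 0, fun v hv => ?_, fun v hv => ?_,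
      fun h => absurd ho h, fun v hv => ⟨hu, h, hs, ?_⟩, fun _ v => by simp, fun _ i hi => ?_⟩
    · simpa [hstep] using hS' v hv
    · simpa [hstep] using hv
    · simpa [hstep] using hv
    · rw [ho] at hi
      cases hi
  · refine ⟨S, subset_rfl, hS', fun _ => rfl, fun v hv => ⟨hu, h, hs, hS' v hv⟩,
      fun h => absurd h ho, fun hp i hi => ?_⟩
    obtain ⟨v, hv⟩ := hS
    exact ⟨v, Finset.eq_singleton_iff_unique_mem.2
      ⟨hv, fun w hw => hp.eq_of_step hs hu hi (hS' w hw) (hS' v hv)⟩⟩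

lemma Admissible.exists_expansion [Nonempty V] (hσ : G.IsStable P v₀ g z σ)
    (hB : ∀ i ∈ P, ∃ f ε, G.IsRegion (fun j => j ≠ i) {u | g i u ≤ z i} (0 ≤ z i) (B i) f ε)
    (i₀ : I) (ha : Admissible P g z v₀ σ B J u) (hu : u ∉ G.terminals) :
    ∃ C lab, IsExpansion P g z v₀ σ B i₀ J u C lab := by
  classical
  set dl := defaultLabel P g z v₀ σ B i₀
  by_cases hJ : J = ∅
  · subst hJ
    obtain ⟨h, v, hs, hv, hd⟩ : ∃ h v, G.Supp v₀ σ h u ∧ G.step σ h u v ≠ 0 ∧ ∀ i, 0 < z i →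
        dist P g z v₀ σ B ∅ v < dist P g z v₀ σ B ∅ u := by
      by_cases hz : ∃ i, 0 < z i
      · obtain ⟨i, hi⟩ := hz
        obtain ⟨h, hh, ⟨c, -, j, hj, -⟩ | ⟨v, hv, -, hd⟩⟩ := ha.exists_step hσ hB fun hs =>
          (((safeStep_of_mem_safe hs).2.2 hu).1 i).not_gt hi
        · exact absurd (mem_followers.1 hj).1 (Finset.notMem_empty j)
        · exact ⟨h, v, hh.1, hv, fun _ _ => hd⟩
      · obtain ⟨h, hs⟩ := ha.reached
        obtain ⟨v, hv⟩ := (G.step σ h u).exists_ne_zero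
        exact ⟨h, v, hs, hv, fun i hi => absurd ⟨i, hi⟩ hz⟩
    obtain ⟨C, h1, -, h2, h3, h4, h5⟩ := exists_succ hs hu (Finset.singleton_nonempty v) (by simpa)
    have hvC := h1 (Finset.mem_singleton_self v)
    exact ⟨C, dl, ⟨v, hvC⟩, h3, h4, h5, Or.inr (Or.inl ⟨rfl, fun _ _ => rfl,
      fun i hi => ⟨v, hvC, hd i hi, h2⟩⟩)⟩
  by_cases hs : u ∈ safe G P g z v₀ σ B J
  · have hsafe := safeStep_of_mem_safe hs
    obtain ⟨-, -, hn, hp⟩ := hsafe.2.2 hu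
    obtain ⟨h, v, hh, hv, hvs⟩ : ∃ h v, G.Supp v₀ σ h u ∧ G.step σ h u v ≠ 0 ∧
        v ∈ safe G P g z v₀ σ B J := by
      rcases ho : G.owner u with _ | i
      · obtain ⟨h, hh⟩ := ha.reached
        obtain ⟨v, hv⟩ := (G.step σ h u).exists_ne_zero
        exact ⟨h, v, hh, hv, hn ho v (by rwa [← step_of_nature σ h hu ho])⟩
      · obtain ⟨⟨v, hv, -, h, hh, hstep⟩, -⟩ := hp i ho
        exact ⟨h, v, hh, hstep, hv⟩
    obtain ⟨C, h1, -, h2, h3, h4, h5⟩ := exists_succ hh hu (Finset.singleton_nonempty v) (by simpa)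
    have hvC := h1 (Finset.mem_singleton_self v)
    refine ⟨C, fun _ => J, ⟨v, hvC⟩, h3, h4, h5, Or.inl ⟨hJ, hs, fun w hw => ⟨rfl, ?_⟩⟩⟩
    by_cases ho : G.owner u = none
    · exact hn ho w ((h4 ho w).1 hw)
    · rw [h2 ho, Finset.mem_singleton] at hw
      rwa [hw]
  obtain ⟨h, hh, ⟨c, hc, hne⟩ | ⟨v, hv, hjv, hd⟩⟩ := ha.exists_step hσ hB hs
  · obtain ⟨j, hj, k, hk, hjk⟩ := hne
    obtain ⟨C, h1, -, h2, h3, h4, h5⟩ := exists_succ hh.1 hu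
      (S := (followers G P J u).image c) ⟨c j, Finset.mem_image_of_mem c hj⟩ (by
        intro v hv
        obtain ⟨i, hi, rfl⟩ := Finset.mem_image.1 hv
        exact (hc i hi).1)
    have hcC : ∀ i ∈ followers G P J u, c i ∈ C := fun i hi => h1 (Finset.mem_image_of_mem c hi)
    refine ⟨C, fun v => if ∃ j ∈ followers G P J u, c j = v then
      J.filter fun j => j ∈ followers G P J u → c j = v else dl v, ⟨_, hcC j hj⟩, h3, h4, h5,
      Or.inr (Or.inr (Or.inr ⟨hs, c, ⟨j, hj, k, hk, hjk⟩, hcC, fun v hv hex => ?_,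
        fun v hv hex => ⟨?_, if_neg hex⟩⟩))⟩
    · rw [if_pos hex]
      refine ⟨Or.inr ⟨h ++ [u], ?_, fun i hi => ?_⟩, fun j => by simp⟩
      · obtain ⟨i, hi, rfl⟩ := hex
        exact hh.1.step hu (hc i hi).1
      · obtain ⟨hiJ, hif⟩ := Finset.mem_filter.1 hi
        by_cases hfol : i ∈ followers G P J u
        · rw [← hif hfol]
          exact (hc i hfol).2
        · simp only [mem_followers, hiJ, true_and, not_not] at hfol
          exact (hh.2 i hiJ).move hfol.1 hfol.2 (h3 v hv).adj
    · by_contra ho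
      rw [h2 ho] at hv
      exact hex (Finset.mem_image.1 hv)
  · obtain ⟨C, h1, -, h2, h3, h4, h5⟩ := exists_succ hh.1 hu (Finset.singleton_nonempty v)
      (by simpa)
    have hvC := h1 (Finset.mem_singleton_self v)
    exact ⟨C, Function.update dl v J, ⟨v, hvC⟩, h3, h4, h5, Or.inr (Or.inr (Or.inl
      ⟨hJ, hs, v, hvC, Function.update_self .., Or.inr ⟨_, hjv⟩, hd, h2,
        fun w _ hw => Function.update_of_ne hw ..⟩))⟩

end Nodes

/-! ### Counting labels -/

section Parts

variable {V I : Type*}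

lemma card_sdiff_followers (G : Game V I) (P : Set I) [DecidableEq I] (J : Finset I) (u : V) :
    (J \ followers G P J u).card ≤ 1 := by
  refine Finset.card_le_one.2 fun a ha b hb => ?_
  simp only [Finset.mem_sdiff, mem_followers] at ha hb
  have h1 := (not_not.1 fun h => ha.2 ⟨ha.1, h⟩).2
  have h2 := (not_not.1 fun h => hb.2 ⟨hb.1, h⟩).2
  rw [h1] at h2
  exact Option.some_injective _ h2

/-- If `F ⊆ J` is distributed by `c` to at least two labels, and the at most one other element of
`J` is added to each of them, then the labels have `f v + e` elements, where the numbers `f v` are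
positive and add up to `J.card - e`, and `e ≤ 1`. -/
lemma card_parts [DecidableEq I] [DecidableEq V] {J F : Finset I} (hFJ : F ⊆ J)
    (hE : (J \ F).card ≤ 1) (c : I → V) {lab : V → Finset I}
    (hlab : ∀ v ∈ F.image c, ∀ j, j ∈ lab v ↔ j ∈ J ∧ (j ∈ F → c j = v)) {j k : I} (hj : j ∈ F)
    (hk : k ∈ F) (hjk : c j ≠ c k) :
    ∃ (f : V → ℕ) (e : ℕ), e ≤ 1 ∧ (∀ v ∈ F.image c, 1 ≤ f v ∧ (lab v).card = f v + e ∧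
      (lab v).card < J.card) ∧ ∑ v ∈ F.image c, f v + e = J.card ∧ 2 ≤ (F.image c).card := by
  have hW2 : 2 ≤ (F.image c).card := Finset.one_lt_card.2
    ⟨c j, Finset.mem_image_of_mem c hj, c k, Finset.mem_image_of_mem c hk, hjk⟩
  have hpos : ∀ v ∈ F.image c, 1 ≤ (F.filter fun i => c i = v).card := by
    intro v hv
    obtain ⟨i, hi, rfl⟩ := Finset.mem_image.1 hv
    exact Finset.card_pos.2 ⟨i, Finset.mem_filter.2 ⟨hi, rfl⟩⟩
  have hcard : ∀ v ∈ F.image c, (lab v).card = (F.filter fun i => c i = v).card + (J \ F).card := by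
    intro v hv
    rw [← Finset.card_union_of_disjoint
      (Finset.disjoint_sdiff.mono_left (Finset.filter_subset _ _))]
    congr 1
    ext i
    rw [hlab v hv i]
    have := @hFJ i
    simp only [Finset.mem_union, Finset.mem_filter, Finset.mem_sdiff]
    tauto
  have hsum : ∑ v ∈ F.image c, (F.filter fun i => c i = v).card = F.card :=
    (Finset.card_eq_sum_card_image c F).symm
  have hFJc : F.card + (J \ F).card = J.card := by
    rw [add_comm]
    exact Finset.card_sdiff_add_card_eq_card hFJ
  refine ⟨fun v => (F.filter fun i => c i = v).card, (J \ F).card, hE, fun v hv =>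
    ⟨hpos v hv, hcard v hv, ?_⟩, by rw [hsum, hFJc], hW2⟩
  obtain ⟨w, hw, hwv⟩ := Finset.exists_mem_ne hW2 v
  have h1 : ∑ x ∈ {v, w}, (F.filter fun i => c i = x).card ≤ F.card := by
    rw [← hsum]
    refine Finset.sum_le_sum_of_subset ?_
    intro x hx
    rcases Finset.mem_insert.1 hx with rfl | hx
    · exact hv
    · rwa [Finset.mem_singleton.1 hx]
  rw [Finset.sum_pair hwv.symm] at h1
  have := hpos w hw
  have := hcard v hv
  omega

end Parts

section Labels

variable {V I : Type*} [Fintype V] {G : Game V I} {P : Set I} {g : I → V → ℝ} {z : I → ℝ} {v₀ : V}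
  {σ : G.Profile} {B : I → Set V} {i₀ : I}

/-- The nodes with at most one player in the label that may occur. -/
def IsSmall (P : Set I) (g : I → V → ℝ) (z : I → ℝ) (v₀ : V) (σ : G.Profile) (B : I → Set V)
    (i₀ : I) (x : Finset I × V) : Prop :=
  Admissible P g z v₀ σ B x.1 x.2 ∧ (x.1.card = 1 ∨ x.1 = defaultLabel P g z v₀ σ B i₀ x.2)

/-- A choice of successors and labels for all nodes. -/
def IsExpansionMap (P : Set I) (g : I → V → ℝ) (z : I → ℝ) (v₀ : V) (σ : G.Profile)
    (B : I → Set V) (i₀ : I) (succ : Finset I × V → Finset V)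
    (lab : Finset I × V → V → Finset I) : Prop :=
  ∀ x, (x.2 ∈ G.terminals → succ x = ∅) ∧ (x.2 ∉ G.terminals → Admissible P g z v₀ σ B x.1 x.2 →
    IsExpansion P g z v₀ σ B i₀ x.1 x.2 (succ x) (lab x))

/-- The nodes that may follow a node. -/
def children (succ : Finset I × V → Finset V) (lab : Finset I × V → V → Finset I)
    (x : Finset I × V) : Set (Finset I × V) := {y | y.2 ∈ succ x ∧ y.1 = lab x y.2}

variable {succ : Finset I × V → Finset V} {lab : Finset I × V → V → Finset I}

lemma isSmall_default {v : V} (hv : G.Reached v₀ σ v) :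
    IsSmall P g z v₀ σ B i₀ (defaultLabel P g z v₀ σ B i₀ v, v) :=
  ⟨admissible_defaultLabel i₀ hv, Or.inr rfl⟩

lemma IsExpansionMap.isSmall_children (hs : IsExpansionMap P g z v₀ σ B i₀ succ lab)
    {x y : Finset I × V} (hx : IsSmall P g z v₀ σ B i₀ x) (hy : y ∈ children succ lab x) :
    IsSmall P g z v₀ σ B i₀ y := by
  obtain ⟨J, u⟩ := x
  obtain ⟨L, v⟩ := y
  obtain ⟨hv, hL⟩ := hy
  dsimp only at hv hL
  subst hL
  by_cases ht : u ∈ G.terminals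
  · rw [(hs (J, u)).1 ht] at hv
    exact absurd hv (Finset.notMem_empty v)
  have he := (hs (J, u)).2 ht hx.1
  have hcard : J ≠ ∅ → J.card = 1 := fun hJ => hx.2.elim id fun h => by
    change J = _ at h
    rw [defaultLabel] at h
    split_ifs at h
    · rw [h, Finset.card_singleton]
    · exact absurd h hJ
  have hsmall : lab (J, u) v = defaultLabel P g z v₀ σ B i₀ v →
      IsSmall P g z v₀ σ B i₀ (lab (J, u) v, v) := fun h => by
    rw [h]
    exact isSmall_default (he.used v hv).reached
  rcases he.cases with ⟨hJ, -, h⟩ | ⟨-, h, -⟩ | ⟨hJ, -, w, -, hwJ, hwa, -, -, h⟩ |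
    ⟨-, c, ⟨j, hj, k, hk, hjk⟩, -⟩
  · obtain ⟨h1, h2⟩ := h v hv
    rw [h1]
    exact ⟨Or.inl h2, Or.inl (hcard hJ)⟩
  · exact hsmall (h v hv)
  · by_cases hvw : v = w
    · subst hvw
      rw [hwJ]
      exact ⟨hwa, Or.inl (hcard hJ)⟩
    · exact hsmall (h v hv hvw)
  · have hj := (mem_followers.1 hj).1
    have hk := (mem_followers.1 hk).1
    have := Finset.card_le_one.1 (hcard (Finset.ne_empty_of_mem hj)).le j hj k hk
    exact absurd (congrArg c this) hjk

/-- From a node whose label has at least two elements, one gets by with few labels: such a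
label is passed on to a single successor until a safe vertex is reached or the label is
distributed, so the labels that occur form a tree in which every inner label is the union of its
children, and two children have at most one player in common. -/
lemma IsExpansionMap.exists_labels (hs : IsExpansionMap P g z v₀ σ B i₀ succ lab)
    (J : Finset I) (u : V) (hJ : 2 ≤ J.card) (ha : Admissible P g z v₀ σ B J u) :
    ∃ (N : Set (Finset I × V)) (L : Finset (Finset I)), (J, u) ∈ N ∧ J ∈ L ∧
      L.card + 3 ≤ 2 * J.card ∧ (∀ x ∈ N, Admissible P g z v₀ σ B x.1 x.2 ∧ x.1 ∈ L) ∧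
      ∀ x ∈ N, ∀ y ∈ children succ lab x, y ∈ N ∨ IsSmall P g z v₀ σ B i₀ y := by
  classical
  induction hc : J.card using Nat.strong_induction_on generalizing J u with
  | _ c ihc =>
  subst hc
  induction hd : dist P g z v₀ σ B J u using Nat.strong_induction_on generalizing u with
  | _ d ihd =>
  subst hd
  have hJ0 : J ≠ ∅ := by
    rintro rfl
    simp at hJ
  by_cases ht : u ∈ G.terminals
  · refine ⟨{(J, u)}, {J}, rfl, Finset.mem_singleton_self J,
      by rw [Finset.card_singleton]; omega, ?_, ?_⟩
    · rintro _ rfl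
      exact ⟨ha, Finset.mem_singleton_self J⟩
    · rintro _ rfl y hy
      rw [children, (hs (J, u)).1 ht] at hy
      exact absurd hy.1 (Finset.notMem_empty _)
  have he := (hs (J, u)).2 ht ha
  rcases he.cases with ⟨-, hsafe, -⟩ | ⟨h0, -⟩ | ⟨-, -, w, hw, hwJ, hwa, hwd, -, h⟩ |
    ⟨-, c, ⟨j, hj, k, hk, hjk⟩, hcC, himg, hrest⟩
  · refine ⟨{x | x.1 = J ∧ x.2 ∈ safe G P g z v₀ σ B J}, {J}, ⟨rfl, hsafe⟩,
      Finset.mem_singleton_self J, by rw [Finset.card_singleton]; omega, ?_, ?_⟩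
    · rintro ⟨K, v⟩ ⟨rfl, hv⟩
      exact ⟨Or.inl hv, Finset.mem_singleton_self _⟩
    · rintro ⟨K, v⟩ ⟨hKJ, hv⟩ ⟨K', w⟩ ⟨hw, hK⟩
      left
      dsimp only at hKJ hv hw hK
      subst hKJ
      have hva : Admissible P g z v₀ σ B K v := Or.inl hv
      by_cases hvt : v ∈ G.terminals
      · rw [(hs (K, v)).1 hvt] at hw
        exact absurd hw (Finset.notMem_empty _)
      rcases ((hs (K, v)).2 hvt hva).cases with ⟨-, -, h⟩ | ⟨h0, -⟩ | ⟨-, hn, -⟩ | ⟨hn, -⟩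
      · rw [hK]
        exact h w hw
      · exact absurd h0 hJ0
      · exact absurd hv hn
      · exact absurd hv hn
  · exact absurd h0 hJ0
  · obtain ⟨N, L, h1, h2, h3, h4, h5⟩ := ihd _ hwd w hwa rfl
    refine ⟨insert (J, u) N, L, Set.mem_insert _ _, h2, h3, ?_, ?_⟩
    · rintro x (rfl | hx)
      exacts [⟨ha, h2⟩, h4 x hx]
    · rintro x (rfl | hx) y hy
      · obtain ⟨K, v⟩ := y
        obtain ⟨hv, hK⟩ := hy
        dsimp only at hv hK
        subst hK
        by_cases hvw : v = w
        · subst hvw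
          rw [hwJ]
          exact Or.inl (Or.inr h1)
        · rw [h v hv hvw]
          exact Or.inr (isSmall_default (he.used v hv).reached)
      · exact (h5 x hx y hy).imp_left Or.inr
  · set F := followers G P J u
    set W := F.image c
    have hFJ : F ⊆ J := Finset.filter_subset _ _
    have hWC : ∀ v ∈ W, v ∈ succ (J, u) ∧ ∃ j ∈ F, c j = v := fun v hv => by
      obtain ⟨i, hi, rfl⟩ := Finset.mem_image.1 hv
      exact ⟨hcC i hi, i, hi, rfl⟩
    have hFJ : F ⊆ J := Finset.filter_subset _ _
    obtain ⟨f, e, he1, hf, hfJ, hW2⟩ :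
        ∃ (f : V → ℕ) (e : ℕ), e ≤ 1 ∧ (∀ v ∈ W, 1 ≤ f v ∧ (lab (J, u) v).card = f v + e ∧
          (lab (J, u) v).card < J.card) ∧ ∑ v ∈ W, f v + e = J.card ∧ 2 ≤ W.card := card_parts hFJ
      (card_sdiff_followers G P J u) c (lab := lab (J, u))
      (fun v hv => (himg v (hWC v hv).1 (hWC v hv).2).2) hj hk hjk
    -- A part `v` with at least two players needs at most `2 * (f v + e) - 3` labels; a part with one
    -- player needs none, and then `f v = 1` and `e = 0`.
    have hsub : ∀ v, ∃ (N : Set (Finset I × V)) (L : Finset (Finset I)), v ∈ W →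
        ((lab (J, u) v, v) ∈ N ∨ IsSmall P g z v₀ σ B i₀ (lab (J, u) v, v)) ∧
        L.card + 2 ≤ 2 * f v + e ∧
        (∀ x ∈ N, Admissible P g z v₀ σ B x.1 x.2 ∧ x.1 ∈ L) ∧
        ∀ x ∈ N, ∀ y ∈ children succ lab x, y ∈ N ∨ IsSmall P g z v₀ σ B i₀ y := by
      intro v
      by_cases hv : v ∈ W
      swap
      · exact ⟨∅, ∅, fun h => absurd h hv⟩
      have hva := (himg v (hWC v hv).1 (hWC v hv).2).1
      obtain ⟨h1, h2, hlt⟩ := hf v hv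
      by_cases h3 : 2 ≤ (lab (J, u) v).card
      · obtain ⟨N, L, h4, -, h5, h6, h7⟩ := ihc _ hlt _ v h3 hva rfl
        exact ⟨N, L, fun _ => ⟨Or.inl h4, by omega, h6, h7⟩⟩
      · exact ⟨∅, ∅, fun _ => ⟨Or.inr ⟨hva, Or.inl (by dsimp only; omega)⟩,
          by rw [Finset.card_empty]; omega, by simp, by simp⟩⟩
    choose N L hNL using hsub
    refine ⟨insert (J, u) (⋃ v ∈ W, N v), insert J (W.biUnion L), Set.mem_insert _ _,
      Finset.mem_insert_self _ _, ?_, ?_, ?_⟩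
    · have h1 : (insert J (W.biUnion L)).card ≤ (∑ v ∈ W, (L v).card) + 1 :=
        (Finset.card_insert_le _ _).trans (Nat.succ_le_succ Finset.card_biUnion_le)
      have h2 : ∑ v ∈ W, ((L v).card + 2) ≤ ∑ v ∈ W, (2 * f v + e) :=
        Finset.sum_le_sum fun v hv => (hNL v hv).2.1
      rw [Finset.sum_add_distrib, Finset.sum_add_distrib, ← Finset.mul_sum, Finset.sum_const,
        Finset.sum_const, smul_eq_mul, smul_eq_mul] at h2
      obtain rfl | rfl : e = 0 ∨ e = 1 := by omega
      all_goals omega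
    · rintro x (rfl | hx)
      · exact ⟨ha, Finset.mem_insert_self _ _⟩
      · obtain ⟨v, hv, hx⟩ := Set.mem_iUnion₂.1 hx
        obtain ⟨h1, h2⟩ := (hNL v hv).2.2.1 x hx
        exact ⟨h1, Finset.mem_insert_of_mem (Finset.mem_biUnion.2 ⟨v, hv, h2⟩)⟩
    · rintro x (rfl | hx) y hy
      · obtain ⟨K, v⟩ := y
        obtain ⟨hv, hK⟩ := hy
        dsimp only at hv hK
        subst hK
        by_cases hvW : v ∈ W
        · exact (hNL v hvW).1.imp_left fun h => Or.inr (Set.mem_iUnion₂.2 ⟨v, hvW, h⟩)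
        · rw [(hrest v hv fun h => hvW (Finset.mem_image.2 h)).2]
          exact Or.inr (isSmall_default (he.used v hv).reached)
      · obtain ⟨v, hv, hx⟩ := Set.mem_iUnion₂.1 hx
        exact ((hNL v hv).2.2.2 x hx y hy).imp_left fun h =>
          Or.inr (Set.mem_iUnion₂.2 ⟨v, hv, h⟩)

/-- There is a small closed set of nodes that contains the node at the initial vertex with the label
that consists of all players.  With `n` vertices and `p` players, it has at most `(2 * p - 2) * n`
nodes with at least two players, `(p - 1) * n` nodes with a single player other than `i₀`, and one
default node over each of the `n` vertices. -/
lemma IsExpansionMap.exists_nodes [Fintype I] (hs : IsExpansionMap P g z v₀ σ B i₀ succ lab)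
    (ha : Admissible P g z v₀ σ B Finset.univ v₀) :
    ∃ K : Finset (Finset I × V), (Finset.univ, v₀) ∈ K ∧
      (∀ x ∈ K, Admissible P g z v₀ σ B x.1 x.2) ∧
      (∀ x ∈ K, ∀ y ∈ children succ lab x, y ∈ K) ∧
      K.card + 2 * Fintype.card V ≤ 3 * Fintype.card V * Fintype.card I := by
  classical
  obtain ⟨N, L, h1, h2, h3, h4⟩ : ∃ (N : Set (Finset I × V)) (L : Finset (Finset I)),
      ((Finset.univ, v₀) ∈ N ∨ IsSmall P g z v₀ σ B i₀ (Finset.univ, v₀)) ∧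
      L.card + 2 ≤ 2 * Fintype.card I ∧
      (∀ x ∈ N, Admissible P g z v₀ σ B x.1 x.2 ∧ x.1 ∈ L) ∧
      ∀ x ∈ N, ∀ y ∈ children succ lab x, y ∈ N ∨ IsSmall P g z v₀ σ B i₀ y := by
    have hpos : 0 < Fintype.card I := Fintype.card_pos_iff.2 ⟨i₀⟩
    by_cases hI : 2 ≤ Fintype.card I
    · obtain ⟨N, L, h1, -, h2, h3, h4⟩ := hs.exists_labels Finset.univ v₀ hI ha
      rw [Finset.card_univ] at h2
      exact ⟨N, L, Or.inl h1, by omega, h3, h4⟩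
    · exact ⟨∅, ∅, Or.inr ⟨ha, Or.inl (by rw [Finset.card_univ]; omega)⟩,
        by rw [Finset.card_empty]; omega, by simp, by simp⟩
  set S : Set (Finset I × V) := N ∪ {x | IsSmall P g z v₀ σ B i₀ x}
  set U : Finset (Finset I × V) := (L ×ˢ Finset.univ) ∪
    (((Finset.univ.erase i₀).image fun i => ({i} : Finset I)) ×ˢ Finset.univ) ∪
    Finset.univ.image fun v => (defaultLabel P g z v₀ σ B i₀ v, v)
  have hSU : ∀ x ∈ S, x ∈ U := by
    rintro ⟨J, v⟩ (hx | ⟨hx, hx'⟩)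
    · exact Finset.mem_union_left _ (Finset.mem_union_left _
        (Finset.mem_product.2 ⟨(h3 _ hx).2, Finset.mem_univ v⟩))
    have hdef : J = defaultLabel P g z v₀ σ B i₀ v → (J, v) ∈ U := fun h =>
      Finset.mem_union_right _ (Finset.mem_image.2 ⟨v, Finset.mem_univ v, by rw [h]⟩)
    rcases hx' with hx' | hx'
    · obtain ⟨i, rfl⟩ := Finset.card_eq_one.1 hx'
      by_cases hi : i = i₀
      · subst hi
        exact hdef (if_pos hx).symm
      · exact Finset.mem_union_left _ (Finset.mem_union_right _ (Finset.mem_product.2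
          ⟨Finset.mem_image.2 ⟨i, Finset.mem_erase.2 ⟨hi, Finset.mem_univ i⟩, rfl⟩,
            Finset.mem_univ v⟩))
    · exact hdef hx'
  refine ⟨U.filter (· ∈ S), ?_, ?_, ?_, ?_⟩
  · exact Finset.mem_filter.2 ⟨hSU _ h1, h1⟩
  · intro x hx
    exact (Finset.mem_filter.1 hx).2.elim (fun h => (h3 x h).1) fun h => h.1
  · intro x hx y hy
    have : y ∈ S := (Finset.mem_filter.1 hx).2.elim (fun h => h4 x h y hy)
      fun h => Or.inr (hs.isSmall_children h hy)
    exact Finset.mem_filter.2 ⟨hSU y this, this⟩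
  · have hcard : (U.filter (· ∈ S)).card ≤ L.card * Fintype.card V +
        (Fintype.card I - 1) * Fintype.card V + Fintype.card V := by
      refine (Finset.card_filter_le _ _).trans ((Finset.card_union_le _ _).trans
        (add_le_add ((Finset.card_union_le _ _).trans (add_le_add ?_ ?_)) ?_))
      · rw [Finset.card_product, Finset.card_univ]
      · rw [Finset.card_product, Finset.card_univ]
        refine Nat.mul_le_mul_right _ (Finset.card_image_le.trans ?_)
        rw [Finset.card_erase_of_mem (Finset.mem_univ i₀), Finset.card_univ]
      · exact Finset.card_image_le.trans_eq Finset.card_univ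
    obtain ⟨q, hq⟩ : ∃ q, Fintype.card I = q + 1 :=
      Nat.exists_eq_succ_of_ne_zero (Fintype.card_pos_iff.2 ⟨i₀⟩).ne'
    rw [hq] at h2 hcard ⊢
    rw [Nat.add_sub_cancel] at hcard
    have : L.card * Fintype.card V ≤ 2 * q * Fintype.card V := Nat.mul_le_mul_right _ (by omega)
    nlinarith

end Labels

/-! ### The plan of an equilibrium -/

section Ranks

variable {V I : Type*} [Fintype V] {G : Game V I} {P : Set I} {g : I → V → ℝ} {z : I → ℝ} {v₀ : V}
  {σ : G.Profile} {B : I → Set V} {i₀ : I}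

open Classical in
/-- The rank of a node: labels with fewer players come first, where the empty label is put after the
labels with one player since `{i₀}` may follow it; nodes with the same label are compared by their
distance, which is at most `M`. -/
noncomputable def nodeRank (P : Set I) (g : I → V → ℝ) (z : I → ℝ) (v₀ : V) (σ : G.Profile)
    (B : I → Set V) (M : ℕ) (x : Finset I × V) : ℕ :=
  (if x.1 = ∅ then 2 else x.1.card) * (M + 1) + dist P g z v₀ σ B x.1 x.2

variable {M : ℕ} {J L : Finset I} {u v : V}

lemma nodeRank_lt_of_dist (h : dist P g z v₀ σ B J v < dist P g z v₀ σ B J u) :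
    nodeRank P g z v₀ σ B M (J, v) < nodeRank P g z v₀ σ B M (J, u) :=
  Nat.add_lt_add_left h _

open Classical in
lemma nodeRank_lt_of_card (hM : dist P g z v₀ σ B L v ≤ M) (hL : L ≠ ∅)
    (h : L.card < if J = ∅ then 2 else J.card) :
    nodeRank P g z v₀ σ B M (L, v) < nodeRank P g z v₀ σ B M (J, u) := by
  have h1 := Nat.mul_le_mul_right (M + 1) (Nat.succ_le_of_lt h)
  simp only [nodeRank, if_neg hL]
  rw [Nat.succ_mul] at h1
  omega

namespace IsExpansion

variable {C : Finset V} {lab : V → Finset I}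

/-- A successor to which a proper part of the label is distributed has a smaller rank. -/
lemma split_lt (hM : dist P g z v₀ σ B (lab v) v ≤ M) {c : I → V}
    (hne : ∃ j ∈ followers G P J u, ∃ k ∈ followers G P J u, c j ≠ c k)
    (hv : ∃ j ∈ followers G P J u, c j = v)
    (hlab : ∀ j, j ∈ lab v ↔ j ∈ J ∧ (j ∈ followers G P J u → c j = v)) :
    nodeRank P g z v₀ σ B M (lab v, v) < nodeRank P g z v₀ σ B M (J, u) := by
  obtain ⟨i, hi, hiv⟩ := hv
  have hiJ := (mem_followers.1 hi).1
  refine nodeRank_lt_of_card hM (Finset.ne_empty_of_mem ((hlab i).2 ⟨hiJ, fun _ => hiv⟩)) ?_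
  rw [if_neg (Finset.ne_empty_of_mem hiJ)]
  obtain ⟨j, hj, hjv⟩ : ∃ j ∈ followers G P J u, c j ≠ v := by
    obtain ⟨j, hj, k, hk, hjk⟩ := hne
    by_cases h : c j = v
    · exact ⟨k, hk, fun h' => hjk (h.trans h'.symm)⟩
    · exact ⟨j, hj, h⟩
  exact Finset.card_lt_card ⟨fun a ha => ((hlab a).1 ha).1, fun hsub =>
    hjv (((hlab j).1 (hsub (mem_followers.1 hj).1)).2 hj)⟩

lemma exists_progress (he : IsExpansion P g z v₀ σ B i₀ J u C lab)
    (hM : ∀ J u, dist P g z v₀ σ B J u ≤ M) (hu : u ∉ safe G P g z v₀ σ B J) {j : I} (hj : j ∈ J) :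
    ∃ v ∈ C, j ∈ lab v ∧
      nodeRank P g z v₀ σ B M (lab v, v) < nodeRank P g z v₀ σ B M (J, u) := by
  rcases he.cases with ⟨-, h, -⟩ | ⟨rfl, -⟩ | ⟨-, -, w, hw, hwJ, -, hd, -⟩ |
    ⟨-, c, ⟨k, hk, l, hl, hkl⟩, hc, himg, -⟩
  · exact absurd h hu
  · exact absurd hj (Finset.notMem_empty j)
  · refine ⟨w, hw, hwJ ▸ hj, ?_⟩
    rw [hwJ]
    exact nodeRank_lt_of_dist hd
  · obtain ⟨i, hi, hij⟩ : ∃ i ∈ followers G P J u, j ∈ followers G P J u → c j = c i := by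
      by_cases h : j ∈ followers G P J u
      exacts [⟨j, h, fun _ => rfl⟩, ⟨k, hk, fun h' => absurd h' h⟩]
    have hlab := (himg _ (hc i hi) ⟨i, hi, rfl⟩).2
    exact ⟨c i, hc i hi, (hlab j).2 ⟨hj, hij⟩,
      split_lt (hM _ _) ⟨k, hk, l, hl, hkl⟩ ⟨i, hi, rfl⟩ hlab⟩

lemma progress (he : IsExpansion P g z v₀ σ B i₀ J u C lab)
    (hM : ∀ J u, dist P g z v₀ σ B J u ≤ M) (hu : u ∉ safe G P g z v₀ σ B J) (hJ : J ≠ ∅)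
    (ho : G.owner u ≠ none) {v : V} (hv : v ∈ C) :
    (∀ i ∈ J, i ∉ followers G P J u → i ∈ lab v) ∧
      nodeRank P g z v₀ σ B M (lab v, v) < nodeRank P g z v₀ σ B M (J, u) := by
  rcases he.cases with ⟨-, h, -⟩ | ⟨rfl, -⟩ | ⟨-, -, w, hw, hwJ, -, hd, hC, -⟩ |
    ⟨-, c, hne, hc, himg, hrest⟩
  · exact absurd h hu
  · exact absurd rfl hJ
  · rw [hC ho, Finset.mem_singleton] at hv
    subst hv
    rw [hwJ]
    exact ⟨fun i hi _ => hi, nodeRank_lt_of_dist hd⟩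
  · by_cases hex : ∃ j ∈ followers G P J u, c j = v
    · have hlab := (himg v hv hex).2
      exact ⟨fun i hi hif => (hlab i).2 ⟨hi, fun h => absurd h hif⟩, split_lt (hM _ _) hne hex hlab⟩
    · exact absurd (hrest v hv hex).1 ho

lemma ending (he : IsExpansion P g z v₀ σ B i₀ J u C lab)
    (hM : ∀ J u, dist P g z v₀ σ B J u ≤ M) (hu : u ∉ safe G P g z v₀ σ B J) {i : I}
    (hi : 0 < z i) :
    (∃ v ∈ C, nodeRank P g z v₀ σ B M (lab v, v) < nodeRank P g z v₀ σ B M (J, u)) ∧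
      (G.owner u ≠ none → ∀ v ∈ C,
        nodeRank P g z v₀ σ B M (lab v, v) < nodeRank P g z v₀ σ B M (J, u)) := by
  by_cases hJ : J = ∅
  · subst hJ
    rcases he.cases with ⟨h, -⟩ | ⟨-, hlab, h⟩ | ⟨h, -⟩ | ⟨-, c, ⟨j, hj, -⟩, -⟩
    · exact absurd rfl h
    · obtain ⟨w, hw, hd, hC⟩ := h i hi
      have hlt : nodeRank P g z v₀ σ B M (lab w, w) < nodeRank P g z v₀ σ B M (∅, u) := by
        rw [hlab w hw, defaultLabel]
        split_ifs
        · exact nodeRank_lt_of_card (hM _ _) (Finset.singleton_ne_empty i₀) (by simp)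
        · exact nodeRank_lt_of_dist hd
      refine ⟨⟨w, hw, hlt⟩, fun ho v hv => ?_⟩
      rw [hC ho, Finset.mem_singleton] at hv
      rwa [hv]
    · exact absurd rfl h
    · exact absurd (mem_followers.1 hj).1 (Finset.notMem_empty j)
  · obtain ⟨j, hj⟩ := Finset.nonempty_iff_ne_empty.2 hJ
    obtain ⟨v, hv, -, h⟩ := he.exists_progress hM hu hj
    exact ⟨⟨v, hv, h⟩, fun ho v hv => (he.progress hM hu hJ ho hv).2⟩

end IsExpansion

/-- A stable profile gives rise to a plan with few nodes. -/
theorem IsStable.exists_plan [Fintype I] [Nonempty V] [Nonempty I] (hσ : G.IsStable P v₀ g z σ)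
    {A : I → Set V} {f : I → V → V}
    (hA : ∀ i ∉ P, ∃ ε, G.IsRegion (fun j => j = i) {u | g i u < z i} (0 < z i) (A i) (f i) ε)
    (hB : ∀ i ∈ P, ∃ ε, G.IsRegion (fun j => j ≠ i) {u | g i u ≤ z i} (0 ≤ z i) (B i) (f i) ε) :
    ∃ (K : Finset (Finset I × V)) (Q : Plan G P g z v₀ A B K),
      K.card + 2 * Fintype.card V ≤ 3 * Fintype.card V * Fintype.card I ∧
      (G.IsPure v₀ σ → ∀ k i, Q.vert k ∉ G.terminals → G.owner (Q.vert k) = some i →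
        ∃ v, Q.succ k = {v}) := by
  classical
  obtain ⟨i₀⟩ := ‹Nonempty I›
  have hB' : ∀ i ∈ P, ∃ f ε, G.IsRegion (fun j => j ≠ i) {u | g i u ≤ z i} (0 ≤ z i) (B i) f ε :=
    fun i hi => ⟨f i, hB i hi⟩
  have hex : ∀ x : Finset I × V, ∃ (C : Finset V) (lab : V → Finset I),
      (x.2 ∈ G.terminals → C = ∅) ∧ (x.2 ∉ G.terminals → Admissible P g z v₀ σ B x.1 x.2 →
        IsExpansion P g z v₀ σ B i₀ x.1 x.2 C lab) := by
    rintro ⟨J, u⟩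
    by_cases hu : u ∈ G.terminals
    · exact ⟨∅, fun _ => ∅, fun _ => rfl, fun h => absurd hu h⟩
    · by_cases ha : Admissible P g z v₀ σ B J u
      · obtain ⟨C, lab, h⟩ := ha.exists_expansion hσ hB' i₀ hu
        exact ⟨C, lab, fun h => absurd h hu, fun _ _ => h⟩
      · exact ⟨∅, fun _ => ∅, fun h => absurd h hu, fun _ h => absurd h ha⟩
  choose succ lab hs using hex
  have hroot : Admissible P g z v₀ σ B Finset.univ v₀ :=
    Or.inr ⟨[], Supp.root, fun j _ => (hσ j).1⟩
  obtain ⟨K, hK1, hK2, hK3, hK4⟩ := IsExpansionMap.exists_nodes (i₀ := i₀) hs hroot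
  obtain ⟨M, hM⟩ := Finite.exists_nat_bound fun x : Finset I × V => dist P g z v₀ σ B x.1 x.2
  replace hM : ∀ J u, dist P g z v₀ σ B J u ≤ M := fun J u => hM (J, u)
  have hmem : ∀ (k : K), ∀ v ∈ succ k.1, (lab k.1 v, v) ∈ K := fun k v hv =>
    hK3 k.1 k.2 _ ⟨hv, rfl⟩
  have hnt : ∀ (k : K), ∀ v ∈ succ k.1, k.1.2 ∉ G.terminals := fun k v hv ht => by
    rw [(hs k.1).1 ht] at hv
    exact absurd hv (Finset.notMem_empty v)
  have hexp : ∀ k : K, k.1.2 ∉ G.terminals →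
      IsExpansion P g z v₀ σ B i₀ k.1.1 k.1.2 (succ k.1) (lab k.1) := fun k hk =>
    (hs k.1).2 hk (hK2 k.1 k.2)
  set next : K → V → K := fun k v => if h : (lab k.1 v, v) ∈ K then ⟨_, h⟩ else k
  have hnext : ∀ (k : K), ∀ v ∈ succ k.1, (next k v).1 = (lab k.1 v, v) := fun k v hv => by
    simp only [next, dif_pos (hmem k v hv)]
  have hnz : ∀ k : K, k.1.2 ∉ G.terminals → ∀ i, 0 < z i →
      k.1.2 ∉ safe G P g z v₀ σ B k.1.1 := fun k hk i hi hsafe =>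
    (((safeStep_of_mem_safe hsafe).2.2 hk).1 i).not_gt hi
  refine ⟨K, {
    root := ⟨_, hK1⟩
    vert := fun k => k.1.2
    lab := fun k => k.1.1
    succ := fun k => succ k.1
    next := next
    safe := fun k => k.1.1 ≠ ∅ ∧ k.1.2 ∈ safe G P g z v₀ σ B k.1.1
    rank := fun k => nodeRank P g z v₀ σ B M k.1
    vert_root := rfl
    lab_root := Finset.mem_univ
    nonempty := fun k hk => (hexp k hk).nonempty
    adj := fun k v hv => ((hexp k (hnt k v hv)).used v hv).adj
    vert_next := fun k v hv => by rw [hnext k v hv]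
    mem_succ := fun k hk => (hexp k hk).mem_iff
    le := fun k hk => (safeStep_of_mem_safe ((hK2 k.1 k.2).mem_safe hk)).2.1 hk
    ge := fun k hk i => by
      obtain ⟨h, hh⟩ := (hK2 k.1 k.2).reached
      exact (secure_of_supp hσ hh i).le hk
    mem_region := fun k i ho hi hik v hv => (hK2 k.1 k.2).mem_region hB' ho hi hik hv
    not_mem_region := fun k i ho hi v hv => by
      obtain ⟨h, hh⟩ := (hK2 k.1 k.2).reached
      obtain ⟨ε, hε⟩ := hA i hi
      exact ((secure_of_supp hσ hh i).move hi ho hv).not_mem_region hε hi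
    safe_nonneg := fun k hk hsafe => ((safeStep_of_mem_safe hsafe.2).2.2 hk).2.1
    safe_next := ?_
    exists_progress := ?_
    progress := ?_
    exists_ending := ?_
    ending := ?_ }, hK4, fun hp k i hk ho => (hexp k hk).singleton hp i ho⟩
  · rintro k ⟨hk0, hks⟩ v hv
    rcases (hexp k (hnt k v hv)).cases with ⟨-, -, h⟩ | ⟨h, -⟩ | ⟨-, h, -⟩ | ⟨h, -⟩
    · obtain ⟨h1, h2⟩ := h v hv
      rw [hnext k v hv]
      dsimp only
      rw [h1]
      exact ⟨⟨hk0, h2⟩, subset_rfl⟩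
    · exact absurd h hk0
    · exact absurd hks h
    · exact absurd hks h
  · intro k hk hks j hj
    obtain ⟨v, hv, h⟩ := (hexp k hk).exists_progress hM
      (fun h => hks ⟨Finset.ne_empty_of_mem hj, h⟩) hj
    refine ⟨v, hv, ?_⟩
    rwa [hnext k v hv]
  · intro k i hks ho hi hik v hv
    have hne := Finset.ne_empty_of_mem hik
    obtain ⟨h1, h2⟩ := (hexp k (hnt k v hv)).progress hM (fun h => hks ⟨hne, h⟩) hne
      (by rw [ho]; simp) hv
    rw [hnext k v hv]
    exact ⟨h1 i hik fun h => (mem_followers.1 h).2 ⟨hi, ho⟩, h2⟩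
  · intro i hi k hk _
    obtain ⟨v, hv, h⟩ := ((hexp k hk).ending hM (hnz k hk i hi) hi).1
    refine ⟨v, hv, ?_⟩
    rwa [hnext k v hv]
  · intro i hi k j ho v hv
    have hk := hnt k v hv
    rw [hnext k v hv]
    exact ((hexp k hk).ending hM (hnz k hk i hi) hi).2 (by rw [ho]; simp) v hv

end Ranks

end Game

/-! ### Finite-memory equilibria -/

namespace Game

/-- The profile of a memory structure does not change if its states are renamed. -/
lemma MemoryStructure.exists_of_equiv {V I S T : Type*} {G : Game V I} (M : G.MemoryStructure S)
    (e : S ≃ T) : ∃ M' : G.MemoryStructure T, M'.profile = M.profile := by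
  refine ⟨⟨e M.initial, fun t v => e (M.update (e.symm t) v), fun t => M.output (e.symm t)⟩, ?_⟩
  have : ∀ (h : List V) (s : S),
      h.foldl (fun t v => e (M.update (e.symm t) v)) (e s) = e (h.foldl M.update s) := by
    intro h
    induction h with
    | nil => intro s; rfl
    | cons a h ih => intro s; rw [List.foldl_cons, List.foldl_cons, e.symm_apply_apply, ih]
  funext i h u
  simp only [profile, this, e.symm_apply_apply]

end Game

theorem mainTheorem3 {V I : Type*} [Fintype V] [MeasurableSpace V] [DiscreteMeasurableSpace V]
    [Fintype I] [Nonempty I] (G : Game V I) (v₀ : V) (P : Set I)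
    (σ : G.Profile) (hσ : G.IsXRSE P v₀ σ) :
    ∃ (S : Type) (_ : Fintype S) (M : G.MemoryStructure S),
      (Fintype.card S : ℤ) ≤
        3 * (Fintype.card V : ℤ) * (Fintype.card I : ℤ) - 2 * (Fintype.card V : ℤ)
          + (Fintype.card I : ℤ) + 1 ∧
      G.IsXRSE P v₀ M.profile ∧
      (∀ i, G.extremeRisk P v₀ M.profile i = G.extremeRisk P v₀ σ i) ∧
      (G.IsPure v₀ σ → G.IsPure v₀ M.profile) := by
  classical
  have : Nonempty V := ⟨v₀⟩
  set x := G.extremeRisk P v₀ σ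
  have hstable := (Game.isStable_iff x σ).2 ⟨hσ, fun _ => rfl⟩
  set g := G.signedPayoff P
  set z : I → ℝ := fun i => Game.sign P i * x i
  -- A region and a punishing strategy for every player.
  have hreg : ∀ i, ∃ (B : Set V) (f : V → V),
      (i ∉ P → ∃ ε, G.IsRegion (fun j => j = i) {u | g i u < z i} (0 < z i) B f ε) ∧
      (i ∈ P → ∃ ε, G.IsRegion (fun j => j ≠ i) {u | g i u ≤ z i} (0 ≤ z i) B f ε) := by
    intro i
    by_cases hi : i ∈ P
    · obtain ⟨B, f, h⟩ := G.exists_region (fun j => j ≠ i) {u | g i u ≤ z i} (0 ≤ z i)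
      exact ⟨B, f, fun h => absurd hi h, fun _ => h⟩
    · obtain ⟨B, f, h⟩ := G.exists_region (fun j => j = i) {u | g i u < z i} (0 < z i)
      exact ⟨B, f, fun _ => h, fun h => absurd h hi⟩
  choose B f hA hB using hreg
  have hf : ∀ i u, u ∉ G.terminals → G.Adj u (f i u) := fun i => by
    by_cases hi : i ∈ P
    · obtain ⟨ε, hε⟩ := hB i hi
      exact hε.adj
    · obtain ⟨ε, hε⟩ := hA i hi
      exact hε.adj
  obtain ⟨K, Q, hcard, hpure⟩ := hstable.exists_plan hA hB
  -- The nodes live in the universes of `V` and `I`, so the states have to be renamed.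
  obtain ⟨M, hM⟩ := (Q.memory f).exists_of_equiv (Fintype.equivFin _)
  refine ⟨Fin (Fintype.card (Option (K ⊕ I))), inferInstance, M, ?_, ?_⟩
  · rw [Fintype.card_fin, Fintype.card_option, Fintype.card_sum, Fintype.card_coe]
    have : ((K.card + 2 * Fintype.card V : ℕ) : ℤ) ≤ (3 * Fintype.card V * Fintype.card I : ℕ) :=
      Int.ofNat_le.2 hcard
    push_cast at this ⊢
    linarith
  · obtain ⟨h1, h2⟩ := (Game.isStable_iff x (Q.memory f).profile).1 (Game.Plan.isStable hf hA hB)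
    rw [hM]
    exact ⟨h1, h2, fun hp => Q.isPure f (hpure hp)⟩
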